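/- Let $\Bbbk$ be a field and let $A$, $H$ be a weak quasitriangular pair of Hopf algebras over $\Bbbk$. That is, there is a pairing $\langle\,,\rangle\colon H\otimes A\to\Bbbk$ with $$\langle hk,a\rangle=\langle h,a_{(2)}\rangle\langle k,a_{(1)}\rangle,\quad \langle h,ab\rangle=\langle h_{(1)},b\rangle\langle h_{(2)},a\rangle,\quad \langle 1,a\rangle=\varepsilon(a),\quad \langle h,1\rangle=\varepsilon(h),\quad \langle Sh,a\rangle=\langle h,Sa\rangle,$$ together with Hopf algebra maps $R,\overline R\colon A\to H^{\operatorname{op}}$ (anti-multiplicative unital coalgebra maps to $H$) with two-sided convolution inverses $R^{-*},\overline R^{-*}$ in $\operatorname{Hom}(A,H^{\operatorname{op}})$, such that $\langle\overline R(a),b\rangle=\langle R^{-*}(b),a\rangle$ and $$h_{(1)}R(a_{(1)})\langle h_{(2)},a_{(2)}\rangle=R(a_{(2)})h_{(2)}\langle h_{(1)},a_{(1)}\rangle,\qquad h_{(1)}\overline R(a_{(1)})\langle h_{(2)},a_{(2)}\rangle=\overline R(a_{(2)})h_{(2)}\langle h_{(1)},a_{(1)}\rangle$$ for all $a,b\in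 A$, $h,k\in H$. Write $v\mapsto v^{(-1)}\otimes v^{(0)}$ for left $A$-coactions. A left $A$-comodule is a left $H$-module by $h\triangleright v=\langle h,v^{(-1)}\rangle v^{(0)}$; tensor products of comodules have the coaction $v\otimes w\mapsto v^{(-1)}w^{(-1)}\otimes v^{(0)}\otimes w^{(0)}$, and the braiding is $\Psi(w\otimes v)=v^{(0)}\otimes (R(v^{(-1)})\triangleright w)$. Let $B$ be a Hopf algebra with antipode $S$, and $C$ a bialgebra, in left $A$-comodules (all structure maps are $A$-colinear, and coproducts are multiplicative with respect to $\Psi$). Let $B,C$ be weakly dual: there is an $A$-colinear $\operatorname{ev}\colon C\otimes B\to\Bbbk$ with $$\operatorname{ev}(cc',b)=\operatorname{ev}(c',b_{(1)})\operatorname{ev}(c,b_{(2)}),\quad \operatorname{ev}(c,bb')=\operatorname{ev}(c_{(2)},b)\operatorname{ev}(c_{(1)},b'),\quad \operatorname{ev}(1,b)=\varepsilon(b),\quad \operatorname{ev}(c,1)=\varepsilon(c).$$ Let $D'$ be an algebra in left $A$-comodules with an $A$-colinear right $C$-coaction $\delta_C(d)=d^{\overline{(0)}}\otimes d^{\overline{(-1)}}\in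 D'\otimes C$ making it a right $C$-comodule algebra: $\delta_C(1)=1\otimes 1$ and $\delta_C m_{D'}=(m_{D'}\otimes m_C)(\operatorname{Id}\otimes\Psi_{C,D'}\otimes\operatorname{Id})(\delta_C\otimes\delta_C)$. Let $\operatorname{Drin}_H(C,B)$ be the $\Bbbk$-algebra generated by the algebras $C,H,B$ subject to $hb=(h_{(2)}\triangleright b)h_{(1)}$, $hc=(h_{(2)}\triangleright c)h_{(1)}$ and $$(R^{-*}(c_{(1)}{}^{(-1)})\triangleright b_{(2)})\,c_{(1)}{}^{(0)}\operatorname{ev}(c_{(2)},b_{(1)})=R^{-*}(c_{(1)}{}^{(-1)})\,c_{(2)}\,b_{(1)}\,\overline R^{-*}(b_{(2)}{}^{(-1)})\operatorname{ev}(c_{(1)}{}^{(0)},b_{(2)}{}^{(0)}).$$ Then: 1. The map $\alpha=(\operatorname{Id}_{D'}\otimes\operatorname{ev})(\delta_C\otimes\operatorname{Id}_B)\Psi_{B,D'}(S\otimes\operatorname{Id}_{D'})\colon B\otimes D'\to D'$ is a left $B$-action making $D'$ a left $B$-module algebra in $H$-modules (with respect to $\Psi$). 2. The crossed product $D'\rtimes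 B$ on $D'\otimes B$, with product $$(m_{D'}\otimes m_B)(\operatorname{Id}\otimes\alpha\otimes\operatorname{Id}\otimes\operatorname{Id})(\operatorname{Id}\otimes\operatorname{Id}\otimes\Psi_{B,D'}\otimes\operatorname{Id})(\operatorname{Id}\otimes\Delta_B\otimes\operatorname{Id}\otimes\operatorname{Id}),$$ and $D'\rtimes B\rtimes H$ on $D'\otimes B\otimes H$, with product $(x\otimes h)(y\otimes k)=x(h_{(2)}\triangleright y)\otimes h_{(1)}k$ for $x,y\in D'\rtimes B$, are associative unital algebras. 3. $\operatorname{Drin}_H(C,B)$ is a bialgebra, with coproduct given on generators by $\Delta(h)=h_{(2)}\otimes h_{(1)}$, $\Delta(b)=b_{(1)}\overline R^{-*}(b_{(2)}{}^{(-1)})\otimes b_{(2)}{}^{(0)}$, $\Delta(c)=R^{-*}(c_{(1)}{}^{(-1)})c_{(2)}\otimes c_{(1)}{}^{(0)}$, and with counit extending those of $C$, $H$, $B$. The algebra $D'\rtimes B\rtimes H$ is a left $\operatorname{Drin}_H(C,B)$-comodule algebra, with coaction determined by $$\delta_{\operatorname{Drin}}(d)=R^{-*}(d^{\overline{(0)}(-1)})\,d^{\overline{(-1)}}\otimes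 d^{\overline{(0)}(0)},\quad \delta_{\operatorname{Drin}}(b)=b_{(1)}\overline R^{-*}(b_{(2)}{}^{(-1)})\otimes b_{(2)}{}^{(0)},\quad \delta_{\operatorname{Drin}}(h)=h_{(2)}\otimes h_{(1)}$$ for $d\in D'$, $b\in B$, $h\in H$, and $D'\rtimes B$ is a comodule subalgebra. -/

import Mathlib

open scoped TensorProduct

noncomputable section

namespace BraidedDouble

/-! ## Linear-algebra plumbing

Sweedler notation in the comments: `Δ x = x₁ ⊗ x₂`, a left coaction of `A` is written
`v ↦ v₍₋₁₎ ⊗ v₍₀₎`, and a right coaction of `C` is written `d ↦ d₀ ⊗ d₁`. -/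

section Plumbing

variable {k : Type*} [Field k]
variable {U V W Z V₁ W₁ : Type*}
  [AddCommGroup U] [Module k U] [AddCommGroup V] [Module k V] [AddCommGroup W] [Module k W]
  [AddCommGroup Z] [Module k Z] [AddCommGroup V₁] [Module k V₁] [AddCommGroup W₁] [Module k W₁]

/-- `id_U ⊗ f ⊗ id_Z`, for `f : V ⊗ W → W₁ ⊗ V₁`. -/
def midMap (f : V ⊗[k] W →ₗ[k] W₁ ⊗[k] V₁) :
    (U ⊗[k] V) ⊗[k] (W ⊗[k] Z) →ₗ[k] (U ⊗[k] W₁) ⊗[k] (V₁ ⊗[k] Z) :=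
  (TensorProduct.assoc k U W₁ (V₁ ⊗[k] Z)).symm.toLinearMap ∘ₗ
    LinearMap.lTensor U ((TensorProduct.assoc k W₁ V₁ Z).toLinearMap ∘ₗ
      LinearMap.rTensor Z f ∘ₗ (TensorProduct.assoc k V W Z).symm.toLinearMap) ∘ₗ
    (TensorProduct.assoc k U V (W ⊗[k] Z)).toLinearMap

/-- `id_U ⊗ f ⊗ id_Z`, for a form `f : V ⊗ W → k`. -/
def contract (f : V ⊗[k] W →ₗ[k] k) : (U ⊗[k] V) ⊗[k] (W ⊗[k] Z) →ₗ[k] U ⊗[k] Z :=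
  LinearMap.lTensor U ((TensorProduct.lid k Z).toLinearMap ∘ₗ
      LinearMap.rTensor Z f ∘ₗ (TensorProduct.assoc k V W Z).symm.toLinearMap) ∘ₗ
    (TensorProduct.assoc k U V (W ⊗[k] Z)).toLinearMap

/-- The square of a form, in the nested ("categorical") convention:
`f (id ⊗ f ⊗ id)`, that is `(u ⊗ u') ⊗ (v ⊗ v') ↦ f (u' ⊗ v) * f (u ⊗ v')`. -/
def formSq (f : U ⊗[k] V →ₗ[k] k) : (U ⊗[k] U) ⊗[k] (V ⊗[k] V) →ₗ[k] k :=
  f ∘ₗ contract f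

/-- The product `(x ⊗ y) (x' ⊗ y') = (m_X ⊗ m_Y) (x ⊗ τ (y ⊗ x') ⊗ y')` on `X ⊗ Y` determined by
products on `X`, `Y` and a map `τ : Y ⊗ X → X ⊗ Y`. -/
def twistMul (mX : V ⊗[k] V →ₗ[k] V) (mY : W ⊗[k] W →ₗ[k] W) (τ : W ⊗[k] V →ₗ[k] V ⊗[k] W) :
    (V ⊗[k] W) ⊗[k] (V ⊗[k] W) →ₗ[k] V ⊗[k] W :=
  TensorProduct.map mX mY ∘ₗ midMap τ

/-- The componentwise product on `X ⊗ Y`. -/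
def tensorMul (mX : V ⊗[k] V →ₗ[k] V) (mY : W ⊗[k] W →ₗ[k] W) :
    (V ⊗[k] W) ⊗[k] (V ⊗[k] W) →ₗ[k] V ⊗[k] W :=
  twistMul mX mY (TensorProduct.comm k W V).toLinearMap

/-- The product `m` on `X` is associative, with two-sided unit `e`. -/
structure IsAlgebraProduct (m : V ⊗[k] V →ₗ[k] V) (e : V) : Prop where
  assoc : ∀ x y z : V, m (m (x ⊗ₜ y) ⊗ₜ z) = m (x ⊗ₜ m (y ⊗ₜ z))
  one_mul : ∀ x : V, m (e ⊗ₜ x) = x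
  mul_one : ∀ x : V, m (x ⊗ₜ e) = x

end Plumbing

/-! ## Comodules and comodule algebras in vector spaces -/

section Comodules

variable {k : Type*} [Field k]

/-- A left coaction of the coalgebra `A` on `V`. -/
structure LeftCoaction (k A V : Type*) [Field k] [Ring A] [Algebra k A] [Coalgebra k A]
    [AddCommGroup V] [Module k V] where
  /-- the map `v ↦ v₍₋₁₎ ⊗ v₍₀₎` -/
  coact : V →ₗ[k] A ⊗[k] V
  coassoc : (TensorProduct.assoc k A A V).toLinearMap ∘ₗ
      LinearMap.rTensor V Coalgebra.comul ∘ₗ coact = LinearMap.lTensor A coact ∘ₗ coact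
  counit : (TensorProduct.lid k V).toLinearMap ∘ₗ
      LinearMap.rTensor V Coalgebra.counit ∘ₗ coact = LinearMap.id

variable {A V W : Type*} [Ring A] [Algebra k A]
  [AddCommGroup V] [Module k V] [AddCommGroup W] [Module k W]

/-- The tensor product coaction `v ⊗ w ↦ v₍₋₁₎ w₍₋₁₎ ⊗ (v₍₀₎ ⊗ w₍₀₎)`. -/
def tensorCoact (δV : V →ₗ[k] A ⊗[k] V) (δW : W →ₗ[k] A ⊗[k] W) :
    V ⊗[k] W →ₗ[k] A ⊗[k] (V ⊗[k] W) :=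
  LinearMap.rTensor (V ⊗[k] W) (LinearMap.mul' k A) ∘ₗ
    (TensorProduct.tensorTensorTensorComm k A V A W).toLinearMap ∘ₗ TensorProduct.map δV δW

/-- `f` is a morphism of left `A`-comodules. -/
def IsColinear (δV : V →ₗ[k] A ⊗[k] V) (δW : W →ₗ[k] A ⊗[k] W) (f : V →ₗ[k] W) : Prop :=
  δW ∘ₗ f = LinearMap.lTensor A f ∘ₗ δV

/-- `V` is an algebra object in left `A`-comodules: product and unit are colinear. -/
structure IsComoduleAlgebra {V : Type*} [Ring V] [Algebra k V] (δV : V →ₗ[k] A ⊗[k] V) :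
    Prop where
  mul_colinear : IsColinear (tensorCoact δV δV) δV (LinearMap.mul' k V)
  one_coinvariant : δV 1 = 1 ⊗ₜ 1

/-- `(V, m, e)` with the left coaction `δ` of the bialgebra `A` is a left `A`-comodule algebra:
`δ` is multiplicative and unital. -/
structure IsCoactionMultiplicative (m : V ⊗[k] V →ₗ[k] V) (e : V) (δ : V →ₗ[k] A ⊗[k] V) :
    Prop where
  map_mul : ∀ x y : V, δ (m (x ⊗ₜ y)) = tensorMul (LinearMap.mul' k A) m (δ x ⊗ₜ δ y)
  map_one : δ e = 1 ⊗ₜ e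

end Comodules

/-! ## Weak quasitriangular pairs -/

section WeakQuasitriangular

variable {k A H : Type*} [Field k] [Ring A] [HopfAlgebra k A] [Ring H] [HopfAlgebra k H]

/-- `f` is a morphism of Hopf algebras from `A` to `H` with the opposite product: an
anti-multiplicative unital map which is a coalgebra map. -/
structure IsHopfMapToOp (f : A →ₗ[k] H) : Prop where
  map_mul : ∀ a b : A, f (a * b) = f b * f a
  map_one : f 1 = 1
  map_comul : Coalgebra.comul ∘ₗ f = TensorProduct.map f f ∘ₗ Coalgebra.comul
  map_counit : Coalgebra.counit ∘ₗ f = (Coalgebra.counit : A →ₗ[k] k)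

/-- The convolution product of `f` and `g` as maps from `A` to `H` with the opposite product:
`a ↦ g a₂ * f a₁`. -/
def convOp (f g : A →ₗ[k] H) : A →ₗ[k] H :=
  LinearMap.mul' k H ∘ₗ (TensorProduct.comm k H H).toLinearMap ∘ₗ
    TensorProduct.map f g ∘ₗ Coalgebra.comul

/-- `g` is the two-sided convolution inverse of `f`, as maps from `A` to `H` with the opposite
product. -/
structure IsConvInverseOp (f g : A →ₗ[k] H) : Prop where
  right_inv : convOp f g = Algebra.linearMap k H ∘ₗ Coalgebra.counit
  left_inv : convOp g f = Algebra.linearMap k H ∘ₗ Coalgebra.counit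

/-- A weak Hopf pairing `⟨ , ⟩ : H ⊗ A → k`, in the convention
`⟨h h', a⟩ = ⟨h', a₁⟩ ⟨h, a₂⟩` and `⟨h, a b⟩ = ⟨h₁, b⟩ ⟨h₂, a⟩`. -/
structure IsHopfPairing (p : H ⊗[k] A →ₗ[k] k) : Prop where
  mul_left : ∀ (h h' : H) (a : A),
    p ((h * h') ⊗ₜ a) = formSq p ((h ⊗ₜ h') ⊗ₜ Coalgebra.comul a)
  mul_right : ∀ (h : H) (a b : A),
    p (h ⊗ₜ (a * b)) = formSq p (Coalgebra.comul h ⊗ₜ (a ⊗ₜ b))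
  one_left : ∀ a : A, p (1 ⊗ₜ a) = Coalgebra.counit a
  one_right : ∀ h : H, p (h ⊗ₜ 1) = Coalgebra.counit h
  antipode : ∀ (h : H) (a : A),
    p (HopfAlgebra.antipode k h ⊗ₜ a) = p (h ⊗ₜ HopfAlgebra.antipode k a)

/-- `h ⊗ a ↦ h₁ f(a₁) ⟨h₂, a₂⟩`. -/
def compatLeft (p : H ⊗[k] A →ₗ[k] k) (f : A →ₗ[k] H) : H ⊗[k] A →ₗ[k] H :=
  (TensorProduct.rid k H).toLinearMap ∘ₗ
    TensorProduct.map (LinearMap.mul' k H ∘ₗ LinearMap.lTensor H f) p ∘ₗ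
    (TensorProduct.tensorTensorTensorComm k H H A A).toLinearMap ∘ₗ
    TensorProduct.map Coalgebra.comul Coalgebra.comul

/-- `h ⊗ a ↦ f(a₂) h₂ ⟨h₁, a₁⟩`. -/
def compatRight (p : H ⊗[k] A →ₗ[k] k) (f : A →ₗ[k] H) : H ⊗[k] A →ₗ[k] H :=
  (TensorProduct.lid k H).toLinearMap ∘ₗ
    TensorProduct.map p (LinearMap.mul' k H ∘ₗ (TensorProduct.comm k H H).toLinearMap ∘ₗ
      LinearMap.lTensor H f) ∘ₗ
    (TensorProduct.tensorTensorTensorComm k H H A A).toLinearMap ∘ₗ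
    TensorProduct.map Coalgebra.comul Coalgebra.comul

/-- A weak quasitriangular pair of Hopf algebras `A`, `H`: a weak Hopf pairing and
convolution-invertible Hopf algebra maps `R`, `Rbar` from `A` to `H` with the opposite product,
with `⟨Rbar a, b⟩ = ⟨R⁻¹ b, a⟩`, and with
`h₁ R(a₁) ⟨h₂, a₂⟩ = R(a₂) h₂ ⟨h₁, a₁⟩` and the same for `Rbar`. -/
structure WeakQuasitriangularPair (k A H : Type*) [Field k] [Ring A] [HopfAlgebra k A]
    [Ring H] [HopfAlgebra k H] where
  /-- the pairing `⟨h, a⟩` -/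
  pair : H ⊗[k] A →ₗ[k] k
  R : A →ₗ[k] H
  Rbar : A →ₗ[k] H
  /-- the convolution inverse of `R` -/
  Rinv : A →ₗ[k] H
  /-- the convolution inverse of `Rbar` -/
  Rbarinv : A →ₗ[k] H
  pairing : IsHopfPairing pair
  hopf_R : IsHopfMapToOp R
  hopf_Rbar : IsHopfMapToOp Rbar
  inverse_R : IsConvInverseOp R Rinv
  inverse_Rbar : IsConvInverseOp Rbar Rbarinv
  pair_Rbar : ∀ a b : A, pair (Rbar a ⊗ₜ b) = pair (Rinv b ⊗ₜ a)
  compat_R : compatLeft pair R = compatRight pair R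
  compat_Rbar : compatLeft pair Rbar = compatRight pair Rbar

variable {V W : Type*} [AddCommGroup V] [Module k V] [AddCommGroup W] [Module k W]

/-- The left `H`-action `h ▷ v = ⟨h, v₍₋₁₎⟩ v₍₀₎` induced by a left `A`-coaction. -/
def act (p : H ⊗[k] A →ₗ[k] k) (δV : V →ₗ[k] A ⊗[k] V) : H ⊗[k] V →ₗ[k] V :=
  (TensorProduct.lid k V).toLinearMap ∘ₗ LinearMap.rTensor V p ∘ₗ
    (TensorProduct.assoc k H A V).symm.toLinearMap ∘ₗ LinearMap.lTensor H δV

/-- `v ↦ f(v₍₋₁₎) ⊗ v₍₀₎`. -/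
def leg (f : A →ₗ[k] H) (δV : V →ₗ[k] A ⊗[k] V) : V →ₗ[k] H ⊗[k] V :=
  LinearMap.rTensor V f ∘ₗ δV

/-- `v ⊗ w ↦ (f(v₍₋₁₎) ▷ w) ⊗ v₍₀₎`. -/
def actLeg (p : H ⊗[k] A →ₗ[k] k) (f : A →ₗ[k] H) (δV : V →ₗ[k] A ⊗[k] V)
    (δW : W →ₗ[k] A ⊗[k] W) : V ⊗[k] W →ₗ[k] W ⊗[k] V :=
  LinearMap.rTensor V (act p δW) ∘ₗ (TensorProduct.rightComm k H V W).toLinearMap ∘ₗ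
    LinearMap.rTensor W (leg f δV)

/-- The braiding `Ψ : W ⊗ V → V ⊗ W`, `w ⊗ v ↦ v₍₀₎ ⊗ (R(v₍₋₁₎) ▷ w)`. -/
def braid (Q : WeakQuasitriangularPair k A H) (δW : W →ₗ[k] A ⊗[k] W) (δV : V →ₗ[k] A ⊗[k] V) :
    W ⊗[k] V →ₗ[k] V ⊗[k] W :=
  (TensorProduct.comm k W V).toLinearMap ∘ₗ actLeg Q.pair Q.R δV δW ∘ₗ
    (TensorProduct.comm k W V).toLinearMap

/-- The inverse braiding `V ⊗ W → W ⊗ V`, `v ⊗ w ↦ (R⁻¹(v₍₋₁₎) ▷ w) ⊗ v₍₀₎`. -/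
def braidInv (Q : WeakQuasitriangularPair k A H) (δV : V →ₗ[k] A ⊗[k] V)
    (δW : W →ₗ[k] A ⊗[k] W) : V ⊗[k] W →ₗ[k] W ⊗[k] V :=
  actLeg Q.pair Q.Rinv δV δW

/-- `h ⊗ v ↦ (h₂ ▷ v) ⊗ h₁`. -/
def smashTwist (p : H ⊗[k] A →ₗ[k] k) (δV : V →ₗ[k] A ⊗[k] V) : H ⊗[k] V →ₗ[k] V ⊗[k] H :=
  LinearMap.rTensor H (act p δV) ∘ₗ (TensorProduct.rightComm k H H V).toLinearMap ∘ₗ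
    LinearMap.rTensor V ((TensorProduct.comm k H H).toLinearMap ∘ₗ Coalgebra.comul)

end WeakQuasitriangular

/-! ## Braided bialgebras, pairings and comodule algebras in left `A`-comodules -/

section Braided

variable {k A H : Type*} [Field k] [Ring A] [HopfAlgebra k A] [Ring H] [HopfAlgebra k H]
variable (Q : WeakQuasitriangularPair k A H)
variable {B C D : Type*} [Ring B] [Algebra k B] [Coalgebra k B]
  [Ring C] [Algebra k C] [Coalgebra k C] [Ring D] [Algebra k D]

/-- `B`, with its product and coproduct, is a bialgebra object in left `A`-comodules. -/
structure IsBraidedBialgebra (δB : B →ₗ[k] A ⊗[k] B) : Prop where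
  algebra : IsComoduleAlgebra δB
  comul_colinear : IsColinear δB (tensorCoact δB δB) Coalgebra.comul
  counit_colinear : ∀ b : B, LinearMap.lTensor A Coalgebra.counit (δB b) =
    1 ⊗ₜ[k] (Coalgebra.counit b : k)
  comul_mul : Coalgebra.comul ∘ₗ LinearMap.mul' k B =
    TensorProduct.map (LinearMap.mul' k B) (LinearMap.mul' k B) ∘ₗ
      midMap (braid Q δB δB) ∘ₗ TensorProduct.map Coalgebra.comul Coalgebra.comul
  comul_one : Coalgebra.comul (R := k) (1 : B) = 1 ⊗ₜ 1
  counit_mul : ∀ b b' : B, Coalgebra.counit (R := k) (b * b') =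
    Coalgebra.counit (R := k) b * Coalgebra.counit (R := k) b'
  counit_one : Coalgebra.counit (R := k) (1 : B) = 1

/-- `S` is an antipode of the bialgebra object `B` in left `A`-comodules. -/
structure IsBraidedAntipode (δB : B →ₗ[k] A ⊗[k] B) (S : B →ₗ[k] B) : Prop where
  colinear : IsColinear δB δB S
  mul_id_left : LinearMap.mul' k B ∘ₗ LinearMap.lTensor B S ∘ₗ Coalgebra.comul =
    Algebra.linearMap k B ∘ₗ Coalgebra.counit
  mul_id_right : LinearMap.mul' k B ∘ₗ LinearMap.rTensor B S ∘ₗ Coalgebra.comul =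
    Algebra.linearMap k B ∘ₗ Coalgebra.counit

/-- `ev : C ⊗ B → k` is a weak bialgebra pairing in left `A`-comodules:
`ev(c c', b) = ev(c', b₁) ev(c, b₂)` and `ev(c, b b') = ev(c₂, b) ev(c₁, b')`. -/
structure IsBraidedPairing (δC : C →ₗ[k] A ⊗[k] C) (δB : B →ₗ[k] A ⊗[k] B)
    (ev : C ⊗[k] B →ₗ[k] k) : Prop where
  colinear : ∀ (c : C) (b : B),
    LinearMap.lTensor A ev (tensorCoact δC δB (c ⊗ₜ b)) = 1 ⊗ₜ ev (c ⊗ₜ b)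
  mul_left : ∀ (c c' : C) (b : B),
    ev ((c * c') ⊗ₜ b) = formSq ev ((c ⊗ₜ c') ⊗ₜ Coalgebra.comul b)
  mul_right : ∀ (c : C) (b b' : B),
    ev (c ⊗ₜ (b * b')) = formSq ev (Coalgebra.comul c ⊗ₜ (b ⊗ₜ b'))
  one_left : ∀ b : B, ev (1 ⊗ₜ b) = Coalgebra.counit b
  one_right : ∀ c : C, ev (c ⊗ₜ 1) = Coalgebra.counit c

/-- `D`, with `ρ : D → D ⊗ C`, is a right `C`-comodule algebra in left `A`-comodules. -/
structure IsBraidedRightComoduleAlgebra (δC : C →ₗ[k] A ⊗[k] C) (δD : D →ₗ[k] A ⊗[k] D)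
    (ρ : D →ₗ[k] D ⊗[k] C) : Prop where
  algebra : IsComoduleAlgebra δD
  colinear : IsColinear δD (tensorCoact δD δC) ρ
  coassoc : (TensorProduct.assoc k D C C).toLinearMap ∘ₗ LinearMap.rTensor C ρ ∘ₗ ρ =
    LinearMap.lTensor D Coalgebra.comul ∘ₗ ρ
  counit : (TensorProduct.rid k D).toLinearMap ∘ₗ LinearMap.lTensor D Coalgebra.counit ∘ₗ ρ =
    LinearMap.id
  map_mul : ρ ∘ₗ LinearMap.mul' k D =
    TensorProduct.map (LinearMap.mul' k D) (LinearMap.mul' k C) ∘ₗ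
      midMap (braid Q δC δD) ∘ₗ TensorProduct.map ρ ρ
  map_one : ρ 1 = 1 ⊗ₜ 1

/-- The left `B`-action on `D` induced by the right `C`-coaction:
`(id_D ⊗ ev) (ρ ⊗ id_B) Ψ_{B,D} (S ⊗ id_D)`. -/
def inducedAction (δB : B →ₗ[k] A ⊗[k] B) (S : B →ₗ[k] B) (ev : C ⊗[k] B →ₗ[k] k)
    (δD : D →ₗ[k] A ⊗[k] D) (ρ : D →ₗ[k] D ⊗[k] C) : B ⊗[k] D →ₗ[k] D :=
  (TensorProduct.rid k D).toLinearMap ∘ₗ LinearMap.lTensor D ev ∘ₗ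
    (TensorProduct.assoc k D C B).toLinearMap ∘ₗ LinearMap.rTensor B ρ ∘ₗ
    braid Q δB δD ∘ₗ LinearMap.rTensor D S

/-- `b ⊗ d ↦ (α ⊗ id_B) (b₁ ⊗ Ψ_{B,D} (b₂ ⊗ d))`, for an action `α : B ⊗ D → D`. -/
def crossTwist (δB : B →ₗ[k] A ⊗[k] B) (δD : D →ₗ[k] A ⊗[k] D) (α : B ⊗[k] D →ₗ[k] D) :
    B ⊗[k] D →ₗ[k] D ⊗[k] B :=
  LinearMap.rTensor B α ∘ₗ (TensorProduct.assoc k B D B).symm.toLinearMap ∘ₗ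
    LinearMap.lTensor B (braid Q δB δD) ∘ₗ (TensorProduct.assoc k B B D).toLinearMap ∘ₗ
    LinearMap.rTensor D Coalgebra.comul

/-- `α` makes `D` an algebra object in left modules over the bialgebra object `B`, in the
braided category of `H`-modules. -/
structure IsBraidedModuleAlgebra (δB : B →ₗ[k] A ⊗[k] B) (δD : D →ₗ[k] A ⊗[k] D)
    (α : B ⊗[k] D →ₗ[k] D) : Prop where
  linear : α ∘ₗ act Q.pair (tensorCoact δB δD) = act Q.pair δD ∘ₗ LinearMap.lTensor H α
  mul_act : ∀ (b b' : B) (d : D), α ((b * b') ⊗ₜ d) = α (b ⊗ₜ α (b' ⊗ₜ d))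
  one_act : ∀ d : D, α (1 ⊗ₜ d) = d
  act_mul : ∀ (b : B) (d d' : D), α (b ⊗ₜ (d * d')) =
    LinearMap.mul' k D (LinearMap.lTensor D α
      (TensorProduct.assoc k D B D (crossTwist Q δB δD α (b ⊗ₜ d) ⊗ₜ d')))
  act_one : ∀ b : B, α (b ⊗ₜ 1) = algebraMap k D (Coalgebra.counit b)

/-- The product of the braided crossed product `D ⋊ B` on `D ⊗ B`, for an action `α`. -/
def crossMul (δB : B →ₗ[k] A ⊗[k] B) (δD : D →ₗ[k] A ⊗[k] D) (α : B ⊗[k] D →ₗ[k] D) :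
    (D ⊗[k] B) ⊗[k] (D ⊗[k] B) →ₗ[k] D ⊗[k] B :=
  twistMul (LinearMap.mul' k D) (LinearMap.mul' k B) (crossTwist Q δB δD α)

/-- The product of the iterated crossed product `D ⋊ B ⋊ H` on `(D ⊗ B) ⊗ H`, where
`h x = (h₂ ▷ x) h₁` for `x` in `D ⋊ B`. -/
def crossSmashMul (δB : B →ₗ[k] A ⊗[k] B) (δD : D →ₗ[k] A ⊗[k] D) (α : B ⊗[k] D →ₗ[k] D) :
    ((D ⊗[k] B) ⊗[k] H) ⊗[k] ((D ⊗[k] B) ⊗[k] H) →ₗ[k] (D ⊗[k] B) ⊗[k] H :=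
  twistMul (crossMul Q δB δD α) (LinearMap.mul' k H) (smashTwist Q.pair (tensorCoact δD δB))

/-- The embedding of `D ⋊ B` into `D ⋊ B ⋊ H`. -/
def inclDB (k D B H : Type*) [Field k] [Ring D] [Algebra k D] [Ring B] [Algebra k B]
    [Ring H] [Algebra k H] : D ⊗[k] B →ₗ[k] (D ⊗[k] B) ⊗[k] H :=
  (TensorProduct.mk k (D ⊗[k] B) H).flip 1

/-- The embedding of `D` into `D ⋊ B ⋊ H`. -/
def inclD (k D B H : Type*) [Field k] [Ring D] [Algebra k D] [Ring B] [Algebra k B]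
    [Ring H] [Algebra k H] : D →ₗ[k] (D ⊗[k] B) ⊗[k] H :=
  inclDB k D B H ∘ₗ (TensorProduct.mk k D B).flip 1

/-- The embedding of `B` into `D ⋊ B ⋊ H`. -/
def inclB (k D B H : Type*) [Field k] [Ring D] [Algebra k D] [Ring B] [Algebra k B]
    [Ring H] [Algebra k H] : B →ₗ[k] (D ⊗[k] B) ⊗[k] H :=
  inclDB k D B H ∘ₗ TensorProduct.mk k D B 1

/-- The embedding of `H` into `D ⋊ B ⋊ H`. -/
def inclH (k D B H : Type*) [Field k] [Ring D] [Algebra k D] [Ring B] [Algebra k B]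
    [Ring H] [Algebra k H] : H →ₗ[k] (D ⊗[k] B) ⊗[k] H :=
  TensorProduct.mk k (D ⊗[k] B) H (1 ⊗ₜ 1)

end Braided

/-! ## The braided Drinfeld double -/

section Double

variable {k A H : Type*} [Field k] [Ring A] [HopfAlgebra k A] [Ring H] [HopfAlgebra k H]
variable (Q : WeakQuasitriangularPair k A H)
variable {B C V : Type*} [Ring B] [Algebra k B] [Coalgebra k B]
  [Ring C] [Algebra k C] [Coalgebra k C] [AddCommGroup V] [Module k V]

/-- `v ↦ R⁻¹(v₀₍₋₁₎) v₁ ⊗ v₀₍₀₎`, for a map `σ : v ↦ v₀ ⊗ v₁` from `V` to `V ⊗ C`, the product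
being taken in an algebra `E` that receives maps from `H` and `C`. -/
def rightLeg {E : Type*} [Ring E] [Algebra k E] (jH : H →ₗ[k] E) (jC : C →ₗ[k] E)
    (δV : V →ₗ[k] A ⊗[k] V) (σ : V →ₗ[k] V ⊗[k] C) : V →ₗ[k] E ⊗[k] V :=
  LinearMap.rTensor V (LinearMap.mul' k E ∘ₗ TensorProduct.map jH jC) ∘ₗ
    (TensorProduct.rightComm k H V C).toLinearMap ∘ₗ
    LinearMap.rTensor C (leg Q.Rinv δV) ∘ₗ σ

/-- `b ↦ b₁ Rbar⁻¹(b₂₍₋₁₎) ⊗ b₂₍₀₎`, the product being taken in an algebra `E` that receives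
maps from `H` and `B`. -/
def leftLeg {E : Type*} [Ring E] [Algebra k E] (jH : H →ₗ[k] E) (jB : B →ₗ[k] E)
    (δB : B →ₗ[k] A ⊗[k] B) : B →ₗ[k] E ⊗[k] B :=
  LinearMap.rTensor B (LinearMap.mul' k E ∘ₗ TensorProduct.map jB jH) ∘ₗ
    (TensorProduct.assoc k B H B).symm.toLinearMap ∘ₗ
    LinearMap.lTensor B (leg Q.Rbarinv δB) ∘ₗ Coalgebra.comul

/-- `c ⊗ b ↦ (R⁻¹(c₁₍₋₁₎) ▷ b₂) c₁₍₀₎ ev(c₂, b₁)`. -/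
def crossRelLeft {E : Type*} [Ring E] [Algebra k E] (jC : C →ₗ[k] E) (jB : B →ₗ[k] E)
    (δC : C →ₗ[k] A ⊗[k] C) (δB : B →ₗ[k] A ⊗[k] B) (ev : C ⊗[k] B →ₗ[k] k) :
    C ⊗[k] B →ₗ[k] E :=
  LinearMap.mul' k E ∘ₗ TensorProduct.map jB jC ∘ₗ braidInv Q δC δB ∘ₗ
    contract ev ∘ₗ TensorProduct.map Coalgebra.comul Coalgebra.comul

/-- `c ⊗ b ↦ R⁻¹(c₁₍₋₁₎) c₂ b₁ Rbar⁻¹(b₂₍₋₁₎) ev(c₁₍₀₎, b₂₍₀₎)`. -/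
def crossRelRight {E : Type*} [Ring E] [Algebra k E] (jH : H →ₗ[k] E) (jC : C →ₗ[k] E)
    (jB : B →ₗ[k] E) (δC : C →ₗ[k] A ⊗[k] C) (δB : B →ₗ[k] A ⊗[k] B)
    (ev : C ⊗[k] B →ₗ[k] k) : C ⊗[k] B →ₗ[k] E :=
  (TensorProduct.rid k E).toLinearMap ∘ₗ TensorProduct.map (LinearMap.mul' k E) ev ∘ₗ
    (TensorProduct.tensorTensorTensorComm k E C E B).toLinearMap ∘ₗ
    TensorProduct.map (rightLeg Q jH jC δC Coalgebra.comul) (leftLeg Q jH jB δB)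

/-- Inclusion of the generators from `C`. -/
def genC (k C H B : Type*) [Field k] [Ring C] [Algebra k C] [Ring H] [Algebra k H]
    [Ring B] [Algebra k B] : C →ₗ[k] TensorAlgebra k (C × H × B) :=
  TensorAlgebra.ι k ∘ₗ LinearMap.inl k C (H × B)

/-- Inclusion of the generators from `H`. -/
def genH (k C H B : Type*) [Field k] [Ring C] [Algebra k C] [Ring H] [Algebra k H]
    [Ring B] [Algebra k B] : H →ₗ[k] TensorAlgebra k (C × H × B) :=
  TensorAlgebra.ι k ∘ₗ LinearMap.inr k C (H × B) ∘ₗ LinearMap.inl k H B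

/-- Inclusion of the generators from `B`. -/
def genB (k C H B : Type*) [Field k] [Ring C] [Algebra k C] [Ring H] [Algebra k H]
    [Ring B] [Algebra k B] : B →ₗ[k] TensorAlgebra k (C × H × B) :=
  TensorAlgebra.ι k ∘ₗ LinearMap.inr k C (H × B) ∘ₗ LinearMap.inr k H B

/-- The defining relations of the braided Drinfeld double on the generators `C`, `H`, `B`: the
relations of the three algebras, `h b = (h₂ ▷ b) h₁`, `h c = (h₂ ▷ c) h₁`, and the cross
relation between `c` and `b`. -/
inductive DrinRel (δC : C →ₗ[k] A ⊗[k] C) (δB : B →ₗ[k] A ⊗[k] B) (ev : C ⊗[k] B →ₗ[k] k) :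
    TensorAlgebra k (C × H × B) → TensorAlgebra k (C × H × B) → Prop
  | mulC (c c' : C) : DrinRel δC δB ev (genC k C H B (c * c')) (genC k C H B c * genC k C H B c')
  | oneC : DrinRel δC δB ev (genC k C H B 1) 1
  | mulH (h h' : H) : DrinRel δC δB ev (genH k C H B (h * h')) (genH k C H B h * genH k C H B h')
  | oneH : DrinRel δC δB ev (genH k C H B 1) 1
  | mulB (b b' : B) : DrinRel δC δB ev (genB k C H B (b * b')) (genB k C H B b * genB k C H B b')
  | oneB : DrinRel δC δB ev (genB k C H B 1) 1
  | actB (h : H) (b : B) : DrinRel δC δB ev (genH k C H B h * genB k C H B b)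
      (LinearMap.mul' k _ (TensorProduct.map (genB k C H B) (genH k C H B)
        (smashTwist Q.pair δB (h ⊗ₜ b))))
  | actC (h : H) (c : C) : DrinRel δC δB ev (genH k C H B h * genC k C H B c)
      (LinearMap.mul' k _ (TensorProduct.map (genC k C H B) (genH k C H B)
        (smashTwist Q.pair δC (h ⊗ₜ c))))
  | cross (c : C) (b : B) : DrinRel δC δB ev
      (crossRelLeft Q (genC k C H B) (genB k C H B) δC δB ev (c ⊗ₜ b))
      (crossRelRight Q (genH k C H B) (genC k C H B) (genB k C H B) δC δB ev (c ⊗ₜ b))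

/-- The underlying algebra of the braided Drinfeld double `Drin_H(C, B)`. -/
abbrev Drin (δC : C →ₗ[k] A ⊗[k] C) (δB : B →ₗ[k] A ⊗[k] B) (ev : C ⊗[k] B →ₗ[k] k) :
    Type _ :=
  RingQuot (DrinRel Q δC δB ev)

variable (δC : C →ₗ[k] A ⊗[k] C) (δB : B →ₗ[k] A ⊗[k] B) (ev : C ⊗[k] B →ₗ[k] k)

/-- The canonical map from `C` to the double. -/
def Drin.inC : C →ₗ[k] Drin Q δC δB ev :=
  (RingQuot.mkAlgHom k (DrinRel Q δC δB ev)).toLinearMap ∘ₗ genC k C H B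

/-- The canonical map from `H` to the double. -/
def Drin.inH : H →ₗ[k] Drin Q δC δB ev :=
  (RingQuot.mkAlgHom k (DrinRel Q δC δB ev)).toLinearMap ∘ₗ genH k C H B

/-- The canonical map from `B` to the double. -/
def Drin.inB : B →ₗ[k] Drin Q δC δB ev :=
  (RingQuot.mkAlgHom k (DrinRel Q δC δB ev)).toLinearMap ∘ₗ genB k C H B

/-- The given coalgebra structure on the double is the one of the braided Drinfeld double:
coproduct and counit are algebra maps with the prescribed values on generators,
`Δ h = h₂ ⊗ h₁`, `Δ b = b₁ Rbar⁻¹(b₂₍₋₁₎) ⊗ b₂₍₀₎`, `Δ c = R⁻¹(c₁₍₋₁₎) c₂ ⊗ c₁₍₀₎`. -/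
structure IsDrinBialgebra [Coalgebra k (Drin Q δC δB ev)] : Prop where
  comul_mul : ∀ x y : Drin Q δC δB ev, Coalgebra.comul (R := k) (x * y) =
    Coalgebra.comul (R := k) x * Coalgebra.comul (R := k) y
  comul_one : Coalgebra.comul (R := k) (1 : Drin Q δC δB ev) = 1
  counit_mul : ∀ x y : Drin Q δC δB ev, Coalgebra.counit (R := k) (x * y) =
    Coalgebra.counit (R := k) x * Coalgebra.counit (R := k) y
  counit_one : Coalgebra.counit (R := k) (1 : Drin Q δC δB ev) = 1
  comul_H : ∀ h : H, Coalgebra.comul (R := k) (Drin.inH Q δC δB ev h) =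
    TensorProduct.map (Drin.inH Q δC δB ev) (Drin.inH Q δC δB ev)
      (TensorProduct.comm k H H (Coalgebra.comul h))
  comul_B : ∀ b : B, Coalgebra.comul (R := k) (Drin.inB Q δC δB ev b) =
    LinearMap.lTensor _ (Drin.inB Q δC δB ev)
      (leftLeg Q (Drin.inH Q δC δB ev) (Drin.inB Q δC δB ev) δB b)
  comul_C : ∀ c : C, Coalgebra.comul (R := k) (Drin.inC Q δC δB ev c) =
    LinearMap.lTensor _ (Drin.inC Q δC δB ev)
      (rightLeg Q (Drin.inH Q δC δB ev) (Drin.inC Q δC δB ev) δC Coalgebra.comul c)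
  counit_H : ∀ h : H, Coalgebra.counit (R := k) (Drin.inH Q δC δB ev h) =
    Coalgebra.counit (R := k) h
  counit_B : ∀ b : B, Coalgebra.counit (R := k) (Drin.inB Q δC δB ev b) =
    Coalgebra.counit (R := k) b
  counit_C : ∀ c : C, Coalgebra.counit (R := k) (Drin.inC Q δC δB ev c) =
    Coalgebra.counit (R := k) c

end Double

end BraidedDouble

end

open scoped TensorProduct

noncomputable section

namespace BraidedDouble

open TensorProduct

open LinearMap (rTensor lTensor mul' comp_apply rTensor_tmul lTensor_tmul)

/-! Instances that shorten the search for the classes below. -/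

-- The proof is organised around distributive laws. A map τ : W ⊗ V → V ⊗ W compatible with products
-- and units (`IsTwist`) makes V ⊗ W an associative algebra (`IsTwist.isAlgebraProduct`). Two
-- algebra maps f, g on V, W whose values τ exchanges (`TwistRel`) multiply to an algebra map on
-- that twisted product (`TwistRel.isAlgMap_pr`).
--
-- All braidings are instances of a single map `cbr`, x ⊗ y ↦ (x₍₋₁₎ ▷ y) ⊗ x₍₀₎, built from an
-- H-action on Y and a coaction on X of H with the opposite coproduct. The convolution inverses R⁻¹
-- and Rbar⁻¹ are bialgebra maps from A to H with the opposite coproduct, so they turn A-comodules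
-- into such coaction spaces: R⁻¹ yields Ψ⁻¹, and Rbar⁻¹ yields Ψ because ⟨Rbar⁻¹ a, b⟩ = ⟨R b, a⟩;
-- H coacting on itself yields the smash product with H. The hexagons and naturality are proved once
-- for `cbr`, and the compatibility of R, Rbar with the pairing becomes a Yetter–Drinfeld condition,
-- which gives H-linearity of Ψ.
--
-- The crossed product is reached through its inverse twist. Let d · b = d₀ ev(d₁, b), a right
-- action needing no antipode, and T(d ⊗ b) = Ψ⁻¹(d · b₁ ⊗ b₂). The comodule algebra axiom and the
-- pairing axioms show that T is a twist (`isTwist_invTwist`). The twist of D' ⋊ B is d ⊗ b ↦ d ·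
-- S(b₁) ⊗ b₂ precomposed with Ψ, and the antipode axioms say exactly that it is inverse to T;
-- inverses of twists are twists. Applying the counit of B recovers α from the twist
-- (`counit_crossTwist`), so the module algebra axioms follow from the twist axioms. Braided
-- antimultiplicativity of S is never needed. H-linearity then lets H be adjoined.
--
-- For the double, `DoubleMaps` records three maps into an algebra E satisfying the defining
-- relations. The formulas for the coproduct and the coaction factor inside E ⊗ X: b ↦ (b₁ ⊗
-- 1)(Rbar⁻¹(b₂₍₋₁₎) ⊗ b₂₍₀₎) and d ↦ (R⁻¹(d₀₍₋₁₎) ⊗ d₀₍₀₎)(d₁ ⊗ 1). Since Ψ exchanges the two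
-- factors in each formula, multiplicativity is that of Δ_B and of the C-coaction. The heart is
-- `DoubleMaps.fuse_invTwist`: the cross relation of the double makes these legs commute with T. For
-- D' = C this shows that the coproduct respects the cross relation; for general D' it makes the
-- coaction multiplicative on D' ⋊ B. Coassociativity and counit laws are equalities of algebra
-- maps, so they are checked on generators.

local instance moduleTensorProduct {k V W : Type*} [Field k] [AddCommGroup V] [Module k V]
    [AddCommGroup W] [Module k W] : Module k (V ⊗[k] W) := TensorProduct.leftModule

local instance zeroHomClassLinearMap {k V W : Type*} [Field k] [AddCommGroup V] [Module k V]
    [AddCommGroup W] [Module k W] : ZeroHomClass (V →ₗ[k] W) V W := inferInstance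

local instance zeroHomClassLinearEquiv {k V W : Type*} [Field k] [AddCommGroup V] [Module k V]
    [AddCommGroup W] [Module k W] : ZeroHomClass (V ≃ₗ[k] W) V W := inferInstance

/-! ### Twisted tensor products of algebras. -/

section Plumbing

variable {k : Type*} [Field k]
variable {U V W Z V₁ W₁ X Y X' Y' Z' M : Type*}
  [AddCommGroup U] [Module k U] [AddCommGroup V] [Module k V] [AddCommGroup W] [Module k W]
  [AddCommGroup Z] [Module k Z] [AddCommGroup V₁] [Module k V₁] [AddCommGroup W₁] [Module k W₁]
  [AddCommGroup X] [Module k X] [AddCommGroup Y] [Module k Y]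
  [AddCommGroup X'] [Module k X'] [AddCommGroup Y'] [Module k Y'] [AddCommGroup Z'] [Module k Z']

theorem eq_of_tmul {f g : V ⊗[k] W →ₗ[k] Z} (h : ∀ v w, f (v ⊗ₜ w) = g (v ⊗ₜ w))
    (t : V ⊗[k] W) : f t = g t :=
  LinearMap.congr_fun (TensorProduct.ext' h) t

/-- `x ⊗ (y ⊗ z) ↦ (id ⊗ f) (g (x ⊗ y) ⊗ z)`. -/
def liftL (g : X ⊗[k] Y →ₗ[k] Y' ⊗[k] X') (f : X' ⊗[k] Z →ₗ[k] Z') :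
    X ⊗[k] (Y ⊗[k] Z) →ₗ[k] Y' ⊗[k] Z' :=
  lTensor Y' f ∘ₗ (TensorProduct.assoc k Y' X' Z).toLinearMap ∘ₗ
    rTensor Z g ∘ₗ (TensorProduct.assoc k X Y Z).symm.toLinearMap

/-- `(x ⊗ y) ⊗ z ↦ (f ⊗ id) (x ⊗ g (y ⊗ z))`. -/
def liftR (g : Y ⊗[k] Z →ₗ[k] Y' ⊗[k] Z') (f : X ⊗[k] Y' →ₗ[k] X') :
    (X ⊗[k] Y) ⊗[k] Z →ₗ[k] X' ⊗[k] Z' :=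
  rTensor Z' f ∘ₗ (TensorProduct.assoc k X Y' Z').symm.toLinearMap ∘ₗ
    lTensor X g ∘ₗ (TensorProduct.assoc k X Y Z).toLinearMap

/-- The inner tensor `g (x ⊗ₜ y)` is deliberately left unexpanded: later proofs generalize such a
tensor and check pure tensors by induction, which is how Sweedler calculations are carried out
throughout. -/
theorem liftL_tmul (g : X ⊗[k] Y →ₗ[k] Y' ⊗[k] X') (f : X' ⊗[k] Z →ₗ[k] Z') (x : X) (y : Y)
    (z : Z) : liftL g f (x ⊗ₜ (y ⊗ₜ z)) =
      lTensor Y' (f ∘ₗ (TensorProduct.mk k X' Z).flip z) (g (x ⊗ₜ y)) := by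
  simp only [liftL, comp_apply, LinearEquiv.coe_coe, assoc_symm_tmul,
    rTensor_tmul]
  generalize g (x ⊗ₜ y) = t
  induction t with
  | zero => simp
  | tmul a b => simp
  | add a b ha hb => simp only [map_add, add_tmul, ha, hb]

theorem liftR_tmul (g : Y ⊗[k] Z →ₗ[k] Y' ⊗[k] Z') (f : X ⊗[k] Y' →ₗ[k] X') (x : X) (y : Y)
    (z : Z) : liftR g f ((x ⊗ₜ y) ⊗ₜ z) =
      rTensor Z' (f ∘ₗ TensorProduct.mk k X Y' x) (g (y ⊗ₜ z)) := by
  simp only [liftR, comp_apply, LinearEquiv.coe_coe, assoc_tmul,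
    lTensor_tmul]
  generalize g (y ⊗ₜ z) = t
  induction t with
  | zero => simp
  | tmul a b => simp
  | add a b ha hb => simp only [map_add, tmul_add, ha, hb]

theorem midMap_tmul (f : V ⊗[k] W →ₗ[k] W₁ ⊗[k] V₁) (u : U) (v : V) (w : W) (z : Z) :
    midMap f ((u ⊗ₜ v) ⊗ₜ (w ⊗ₜ z)) =
      TensorProduct.map (TensorProduct.mk k U W₁ u) ((TensorProduct.mk k V₁ Z).flip z)
        (f (v ⊗ₜ w)) := by
  simp only [midMap, comp_apply, LinearEquiv.coe_coe, assoc_tmul, assoc_symm_tmul,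
    lTensor_tmul, rTensor_tmul]
  generalize f (v ⊗ₜ w) = t
  induction t with
  | zero => simp
  | tmul a b => simp
  | add a b ha hb => simp only [map_add, tmul_add, add_tmul, ha, hb]

theorem contract_tmul (f : V ⊗[k] W →ₗ[k] k) (u : U) (v : V) (w : W) (z : Z) :
    contract f ((u ⊗ₜ v) ⊗ₜ (w ⊗ₜ z)) = f (v ⊗ₜ w) • (u ⊗ₜ[k] z) := by
  simp [contract]

theorem formSq_tmul (f : U ⊗[k] V →ₗ[k] k) (u u' : U) (v v' : V) :
    formSq f ((u ⊗ₜ u') ⊗ₜ (v ⊗ₜ v')) = f (u' ⊗ₜ v) * f (u ⊗ₜ v') := by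
  simp [formSq, contract_tmul]

theorem twistMul_tmul (mX : V ⊗[k] V →ₗ[k] V) (mY : W ⊗[k] W →ₗ[k] W)
    (τ : W ⊗[k] V →ₗ[k] V ⊗[k] W) (v v' : V) (w w' : W) :
    twistMul mX mY τ ((v ⊗ₜ w) ⊗ₜ (v' ⊗ₜ w')) =
      TensorProduct.map (mX ∘ₗ TensorProduct.mk k V V v) (mY ∘ₗ (TensorProduct.mk k W W).flip w')
        (τ (w ⊗ₜ v')) := by
  simp only [twistMul, comp_apply, midMap_tmul, TensorProduct.map_map]

/-- `τ` is compatible with products `mX`, `mY` with units `eX`, `eY`, so that it defines a twisted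
product on `X ⊗ Y`. -/
structure IsTwist (mV : V ⊗[k] V →ₗ[k] V) (eV : V) (mW : W ⊗[k] W →ₗ[k] W) (eW : W)
    (τ : W ⊗[k] V →ₗ[k] V ⊗[k] W) : Prop where
  mul_left : ∀ w w' v, τ (mW (w ⊗ₜ w') ⊗ₜ v) = liftL τ mW (w ⊗ₜ τ (w' ⊗ₜ v))
  mul_right : ∀ w v v', τ (w ⊗ₜ mV (v ⊗ₜ v')) = liftR τ mV (τ (w ⊗ₜ v) ⊗ₜ v')
  one_left : ∀ v, τ (eW ⊗ₜ v) = v ⊗ₜ eW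
  one_right : ∀ w, τ (w ⊗ₜ eV) = eV ⊗ₜ w

/-- A distributive law moves w past v', w' past v'', and the middle factors past each other; by the
two hexagons the order of these moves is irrelevant. -/
theorem IsTwist.isAlgebraProduct {mV : V ⊗[k] V →ₗ[k] V} {eV : V} {mW : W ⊗[k] W →ₗ[k] W} {eW : W}
    {τ : W ⊗[k] V →ₗ[k] V ⊗[k] W} (hτ : IsTwist mV eV mW eW τ) (hV : IsAlgebraProduct mV eV)
    (hW : IsAlgebraProduct mW eW) : IsAlgebraProduct (twistMul mV mW τ) (eV ⊗ₜ eW) where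
  one_mul x := by
    induction x with
    | zero => simp
    | tmul a b => simp [twistMul_tmul, hτ.one_left, hV.one_mul, hW.one_mul]
    | add a b ha hb => simp only [map_add, tmul_add, ha, hb]
  mul_one x := by
    induction x with
    | zero => simp
    | tmul a b => simp [twistMul_tmul, hτ.one_right, hV.mul_one, hW.mul_one]
    | add a b ha hb => simp only [map_add, add_tmul, ha, hb]
  assoc x y z := by
    induction x with
    | zero => simp
    | add a b ha hb => simp only [map_add, add_tmul, ha, hb]
    | tmul v w =>
    induction y with
    | zero => simp
    | add a b ha hb => simp only [map_add, add_tmul, tmul_add, ha, hb]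
    | tmul v' w' =>
    induction z with
    | zero => simp
    | add a b ha hb => simp only [map_add, tmul_add, ha, hb]
    | tmul v'' w'' =>
    rw [twistMul_tmul, twistMul_tmul]
    -- `h1` and `h2` bring the two bracketings to the same normal form, with both outer crossings τ
    -- (w ⊗ v') and τ (w' ⊗ v'') already performed and one middle crossing left to do.
    have h1 : ∀ s : V ⊗[k] W,
        twistMul mV mW τ (TensorProduct.map (mV ∘ₗ TensorProduct.mk k V V v)
          (mW ∘ₗ (TensorProduct.mk k W W).flip w') s ⊗ₜ (v'' ⊗ₜ w'')) =
        TensorProduct.map (mV ∘ₗ TensorProduct.mk k V V v)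
          (mW ∘ₗ (TensorProduct.mk k W W).flip w'')
          (rTensor W mV ((TensorProduct.assoc k V V W).symm (lTensor V
            (liftL τ mW) (TensorProduct.assoc k V W (V ⊗[k] W) (s ⊗ₜ τ (w' ⊗ₜ v'')))))) := by
      intro s
      induction s with
      | zero => simp
      | add a b ha hb => simp only [map_add, add_tmul, ha, hb]
      | tmul p q =>
        simp only [map_tmul, comp_apply, TensorProduct.mk_apply,
          LinearMap.flip_apply, twistMul_tmul, hτ.mul_left, assoc_tmul, lTensor_tmul]
        generalize liftL τ mW (q ⊗ₜ τ (w' ⊗ₜ v'')) = t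
        induction t with
        | zero => simp
        | add a b ha hb => simp only [map_add, tmul_add, ha, hb]
        | tmul c d => simp [hV.assoc]
    have h2 : ∀ t : V ⊗[k] W,
        twistMul mV mW τ ((v ⊗ₜ w) ⊗ₜ TensorProduct.map (mV ∘ₗ TensorProduct.mk k V V v')
          (mW ∘ₗ (TensorProduct.mk k W W).flip w'') t) =
        TensorProduct.map (mV ∘ₗ TensorProduct.mk k V V v)
          (mW ∘ₗ (TensorProduct.mk k W W).flip w'')
          (rTensor W mV ((TensorProduct.assoc k V V W).symm (lTensor V
            (liftL τ mW) (TensorProduct.assoc k V W (V ⊗[k] W) (τ (w ⊗ₜ v') ⊗ₜ t))))) := by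
      intro t
      induction t with
      | zero => simp
      | add a b ha hb => simp only [map_add, tmul_add, ha, hb]
      | tmul p q =>
        simp only [map_tmul, comp_apply, TensorProduct.mk_apply,
          LinearMap.flip_apply, twistMul_tmul, hτ.mul_right]
        generalize τ (w ⊗ₜ v') = s
        induction s with
        | zero => simp
        | add a b ha hb => simp only [map_add, add_tmul, ha, hb]
        | tmul c d =>
          simp only [liftR_tmul, assoc_tmul, lTensor_tmul, liftL_tmul]
          generalize τ (d ⊗ₜ p) = t
          induction t with
          | zero => simp
          | add a b ha hb => simp only [map_add, tmul_add, ha, hb]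
          | tmul a b => simp [hW.assoc]
    rw [h1, h2]

/-- The inverse of a twisting map is a twisting map. -/
theorem IsTwist.of_inverse {mV : V ⊗[k] V →ₗ[k] V} {eV : V} {mW : W ⊗[k] W →ₗ[k] W} {eW : W}
    {τ : W ⊗[k] V →ₗ[k] V ⊗[k] W} {T : V ⊗[k] W →ₗ[k] W ⊗[k] V} (hT : IsTwist mW eW mV eV T)
    (h₁ : ∀ t, τ (T t) = t) (h₂ : ∀ t, T (τ t) = t) : IsTwist mV eV mW eW τ where
  one_left v := by rw [← hT.one_right, h₁]
  one_right w := by rw [← hT.one_left, h₁]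
  mul_left w w' v := by
    -- T is injective, so the hexagon for τ may be tested after applying T, where it becomes the
    -- other hexagon for T.
    refine (Function.LeftInverse.injective h₁) ?_
    rw [h₂]
    have h : ∀ t, T (liftL τ mW (w ⊗ₜ t)) =
        rTensor V (mW ∘ₗ TensorProduct.mk k W W w) (T t) := by
      intro t
      induction t with
      | zero => simp
      | add a b ha hb => simp only [map_add, tmul_add, ha, hb]
      | tmul r s =>
        have h' : ∀ u : V ⊗[k] W, T (lTensor V (mW ∘ₗ (TensorProduct.mk k W W).flip s) u)
            = liftR T mW (T u ⊗ₜ s) := by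
          intro u
          induction u with
          | zero => simp
          | add a b ha hb => simp only [map_add, add_tmul, ha, hb]
          | tmul a b => simp [hT.mul_right]
        rw [liftL_tmul, h', h₂, liftR_tmul]
    rw [h, h₂]; simp
  mul_right w v v' := by
    refine (Function.LeftInverse.injective h₁) ?_
    rw [h₂]
    have h : ∀ t, T (liftR τ mV (t ⊗ₜ v')) =
        lTensor W (mV ∘ₗ (TensorProduct.mk k V V).flip v') (T t) := by
      intro t
      induction t with
      | zero => simp
      | add a b ha hb => simp only [map_add, add_tmul, ha, hb]
      | tmul r s =>
        have h' : ∀ u : V ⊗[k] W, T (rTensor W (mV ∘ₗ TensorProduct.mk k V V r) u)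
            = liftL T mV (r ⊗ₜ T u) := by
          intro u
          induction u with
          | zero => simp
          | add a b ha hb => simp only [map_add, tmul_add, ha, hb]
          | tmul a b => simp [hT.mul_left]
        rw [liftR_tmul, h', h₂, liftL_tmul]
    rw [h, h₂]; simp

end Plumbing

/-! ### The braiding of an H-action with a coaction of H with the opposite coproduct. -/

section Braidings

variable {k : Type*} [Field k] {H : Type*} [Ring H] [HopfAlgebra k H]
variable {U V W Z X Y X' Y' Z' : Type*}
  [AddCommGroup U] [Module k U] [AddCommGroup V] [Module k V] [AddCommGroup W] [Module k W]
  [AddCommGroup Z] [Module k Z]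
  [AddCommGroup X] [Module k X] [AddCommGroup Y] [Module k Y]
  [AddCommGroup X'] [Module k X'] [AddCommGroup Y'] [Module k Y'] [AddCommGroup Z'] [Module k Z']

/-- The opposite coproduct `h ↦ h₂ ⊗ h₁`. -/
def cop (k H : Type*) [Field k] [Ring H] [HopfAlgebra k H] : H →ₗ[k] H ⊗[k] H :=
  (TensorProduct.comm k H H).toLinearMap ∘ₗ Coalgebra.comul

/-- `a` is a left action of `H`. -/
structure IsHAction (a : H ⊗[k] V →ₗ[k] V) : Prop where
  one : ∀ v, a (1 ⊗ₜ v) = v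
  mul : ∀ h h' v, a ((h * h') ⊗ₜ v) = a (h ⊗ₜ a (h' ⊗ₜ v))

/-- `ℓ` is a left coaction of `H` with the opposite coproduct. -/
structure IsCopCoaction (ℓ : V →ₗ[k] H ⊗[k] V) : Prop where
  coassoc : ∀ v, TensorProduct.assoc k H H V (rTensor V (cop k H) (ℓ v)) =
    lTensor H ℓ (ℓ v)
  counit : ∀ v, TensorProduct.lid k V (rTensor V Coalgebra.counit (ℓ v)) = v

/-- The action `h ⊗ (v ⊗ w) ↦ (h₂ ▷ v) ⊗ (h₁ ▷ w)` on a tensor product. -/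
def tensAct (a : H ⊗[k] V →ₗ[k] V) (a' : H ⊗[k] W →ₗ[k] W) :
    H ⊗[k] (V ⊗[k] W) →ₗ[k] V ⊗[k] W :=
  TensorProduct.map a a' ∘ₗ (TensorProduct.tensorTensorTensorComm k H H V W).toLinearMap ∘ₗ
    rTensor (V ⊗[k] W) (cop k H)

/-- `f` is `H`-linear. -/
def IsHLinear (a : H ⊗[k] V →ₗ[k] V) (a' : H ⊗[k] W →ₗ[k] W) (f : V →ₗ[k] W) : Prop :=
  ∀ h v, f (a (h ⊗ₜ v)) = a' (h ⊗ₜ f v)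

/-- `x ⊗ y ↦ (x₍₋₁₎ ▷ y) ⊗ x₍₀₎`. -/
def cbr (ℓ : X →ₗ[k] H ⊗[k] X) (a : H ⊗[k] Y →ₗ[k] Y) : X ⊗[k] Y →ₗ[k] Y ⊗[k] X :=
  rTensor X a ∘ₗ (TensorProduct.rightComm k H X Y).toLinearMap ∘ₗ rTensor Y ℓ

/-- `h ↦ h ▷ y`. -/
def orbit (a : H ⊗[k] Y →ₗ[k] Y) (y : Y) : H →ₗ[k] Y := a ∘ₗ (TensorProduct.mk k H Y).flip y

@[simp] theorem orbit_apply (a : H ⊗[k] Y →ₗ[k] Y) (y : Y) (h : H) : orbit a y h = a (h ⊗ₜ y) := rfl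

theorem cbr_tmul (ℓ : X →ₗ[k] H ⊗[k] X) (a : H ⊗[k] Y →ₗ[k] Y) (x : X) (y : Y) :
    cbr ℓ a (x ⊗ₜ y) = rTensor X (orbit a y) (ℓ x) := by
  simp only [cbr, comp_apply, rTensor_tmul, LinearEquiv.coe_coe]
  generalize ℓ x = t
  induction t with
  | zero => simp
  | tmul a b => simp
  | add a b ha hb => simp only [map_add, add_tmul, ha, hb]

theorem tensAct_tmul (a : H ⊗[k] V →ₗ[k] V) (a' : H ⊗[k] W →ₗ[k] W) (h : H) (v : V) (w : W) :
    tensAct a a' (h ⊗ₜ (v ⊗ₜ w)) = TensorProduct.map (orbit a v) (orbit a' w) (cop k H h) := by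
  simp only [tensAct, comp_apply, rTensor_tmul, LinearEquiv.coe_coe]
  generalize cop k H h = t
  induction t with
  | zero => simp
  | tmul a b => simp
  | add a b ha hb => simp only [map_add, add_tmul, ha, hb]

theorem tensorCoact_tmul (ℓ : V →ₗ[k] H ⊗[k] V) (ℓ' : W →ₗ[k] H ⊗[k] W) (v : V) (w : W) :
    tensorCoact ℓ ℓ' (v ⊗ₜ w) = TensorProduct.map (mul' k H) LinearMap.id
      (TensorProduct.tensorTensorTensorComm k H V H W (ℓ v ⊗ₜ ℓ' w)) := rfl

theorem cop_mul (h h' : H) : cop k H (h * h') = cop k H h * cop k H h' := by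
  simp only [cop, comp_apply, Bialgebra.comul_mul, LinearEquiv.coe_coe]
  generalize Coalgebra.comul (R := k) h = s
  generalize Coalgebra.comul (R := k) h' = t
  exact map_mul (Algebra.TensorProduct.comm k H H) s t

theorem cop_one : cop k H 1 = 1 ⊗ₜ 1 := by
  simp [cop, Algebra.TensorProduct.one_def]

/-- With H coacting on itself in this way, the exchange rule of the smash product is another
instance of `cbr`. -/
theorem isCopCoaction_cop : IsCopCoaction (cop k H) where
  coassoc h := by
    have h1 := Coalgebra.coassoc_apply (R := k) h
    have h2 : ∀ t : H ⊗[k] H, TensorProduct.assoc k H H H (rTensor H (cop k H)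
        (TensorProduct.comm k H H t)) =
        (TensorProduct.comm k (H ⊗[k] H) H ≪≫ₗ TensorProduct.congr (.refl k H)
          (TensorProduct.comm k H H)) ((TensorProduct.assoc k H H H).symm
            (lTensor H Coalgebra.comul t)) := by
      intro t
      induction t with
      | zero => simp
      | add a b ha hb => simp only [map_add, ha, hb]
      | tmul a b =>
        simp only [comm_tmul, rTensor_tmul, cop, comp_apply,
          lTensor_tmul, LinearEquiv.coe_coe]
        generalize Coalgebra.comul (R := k) b = s
        induction s with
        | zero => simp
        | add a b ha hb => simp only [map_add, add_tmul, tmul_add, ha, hb]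
        | tmul c d => simp
    have h3 : ∀ t : H ⊗[k] H, lTensor H (cop k H) (TensorProduct.comm k H H t) =
        (TensorProduct.comm k (H ⊗[k] H) H ≪≫ₗ TensorProduct.congr (.refl k H)
          (TensorProduct.comm k H H)) (rTensor H Coalgebra.comul t) := by
      intro t
      induction t with
      | zero => simp
      | add a b ha hb => simp only [map_add, ha, hb]
      | tmul a b => simp [cop]
    nth_rw 2 [cop]
    nth_rw 3 [cop]
    simp only [comp_apply, LinearEquiv.coe_coe]
    rw [h2, h3, ← h1, LinearEquiv.symm_apply_apply]
  counit h := by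
    have h1 := Coalgebra.lTensor_counit_comul (R := k) h
    have h2 : ∀ t : H ⊗[k] H, TensorProduct.lid k H (rTensor H Coalgebra.counit
        (TensorProduct.comm k H H t)) = TensorProduct.rid k H
          (lTensor H Coalgebra.counit t) := by
      intro t
      induction t with
      | zero => simp
      | add a b ha hb => simp only [map_add, ha, hb]
      | tmul a b => simp
    simp only [cop, comp_apply, LinearEquiv.coe_coe]
    rw [h2, h1]; simp

/-- Naturality in the coacting variable. The hypothesis is pointwise in x, so that it can be used on
individual elements. -/
theorem cbr_map_left {ℓ : X →ₗ[k] H ⊗[k] X} {ℓ' : X' →ₗ[k] H ⊗[k] X'} (a : H ⊗[k] Y →ₗ[k] Y)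
    {f : X →ₗ[k] X'} {x : X} (hf : ℓ' (f x) = lTensor H f (ℓ x)) (y : Y) :
    cbr ℓ' a (f x ⊗ₜ y) = lTensor Y f (cbr ℓ a (x ⊗ₜ y)) := by
  rw [cbr_tmul, cbr_tmul, hf]
  exact (LinearMap.congr_fun (LinearMap.rTensor_comp_lTensor ..) _).trans
    (LinearMap.congr_fun (LinearMap.lTensor_comp_rTensor ..) _).symm

theorem cbr_map_right (ℓ : X →ₗ[k] H ⊗[k] X) {a : H ⊗[k] Y →ₗ[k] Y} {a' : H ⊗[k] Y' →ₗ[k] Y'}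
    {f : Y →ₗ[k] Y'} (hf : IsHLinear a a' f) (x : X) (y : Y) :
    cbr ℓ a' (x ⊗ₜ f y) = rTensor X f (cbr ℓ a (x ⊗ₜ y)) := by
  rw [cbr_tmul, cbr_tmul, ← LinearMap.rTensor_comp_apply]
  congr 2
  ext h
  exact (hf h y).symm

/-- First hexagon: the coaction on a product multiplies the H-legs, and acting by a product of
elements of H is acting twice. The map f allows both the bare tensor product and a multiplication.
-/
theorem cbr_tensor_left {ℓ : X →ₗ[k] H ⊗[k] X} {ℓ' : X' →ₗ[k] H ⊗[k] X'}
    {ℓ'' : Z →ₗ[k] H ⊗[k] Z} {a : H ⊗[k] Y →ₗ[k] Y} (ha : IsHAction a) {f : X ⊗[k] X' →ₗ[k] Z}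
    {x : X} {x' : X'}
    (hf : ℓ'' (f (x ⊗ₜ x')) = lTensor H f (tensorCoact ℓ ℓ' (x ⊗ₜ x'))) (y : Y) :
    cbr ℓ'' a (f (x ⊗ₜ x') ⊗ₜ y) = liftL (cbr ℓ a) f (x ⊗ₜ cbr ℓ' a (x' ⊗ₜ y)) := by
  rw [cbr_tmul, hf, tensorCoact_tmul, cbr_tmul]
  generalize ℓ' x' = t
  induction t with
  | zero => simp
  | add a b ha hb => simp only [map_add, tmul_add, ha, hb]
  | tmul h' z =>
    simp only [rTensor_tmul, liftL_tmul, cbr_tmul]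
    generalize ℓ x = s
    induction s with
    | zero => simp
    | add a b ha hb => simp only [map_add, add_tmul, ha, hb]
    | tmul h w => simp [ha.mul]

/-- Second hexagon: H acts on a tensor product through its opposite coproduct, and coassociativity
of ℓ distributes the two legs to successive crossings. -/
theorem cbr_tensor_right {ℓ : X →ₗ[k] H ⊗[k] X} (hℓ : IsCopCoaction ℓ) {a : H ⊗[k] Y →ₗ[k] Y}
    {a' : H ⊗[k] Y' →ₗ[k] Y'} {a'' : H ⊗[k] Z →ₗ[k] Z} {g : Y ⊗[k] Y' →ₗ[k] Z}
    (hg : IsHLinear (tensAct a a') a'' g) (x : X) (y : Y) (y' : Y') :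
    cbr ℓ a'' (x ⊗ₜ g (y ⊗ₜ y')) = liftR (cbr ℓ a') g (cbr ℓ a (x ⊗ₜ y) ⊗ₜ y') := by
  have h1 : ∀ s : H ⊗[k] X, liftR (cbr ℓ a') g (rTensor X (orbit a y) s ⊗ₜ y') =
      rTensor X (g ∘ₗ TensorProduct.map (orbit a y) (orbit a' y'))
        ((TensorProduct.assoc k H H X).symm (lTensor H ℓ s)) := by
    intro s
    induction s with
    | zero => simp
    | add a b ha hb => simp only [map_add, add_tmul, ha, hb]
    | tmul h w =>
      simp only [rTensor_tmul, lTensor_tmul, liftR_tmul, cbr_tmul]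
      generalize ℓ w = s
      induction s with
      | zero => simp
      | add a b ha hb => simp only [map_add, tmul_add, ha, hb]
      | tmul h w => simp
  rw [cbr_tmul ℓ a, h1, ← hℓ.coassoc, LinearEquiv.symm_apply_apply, cbr_tmul,
    ← LinearMap.rTensor_comp_apply]
  congr 2
  ext h
  simp only [orbit_apply, ← hg h, tensAct_tmul, comp_apply]

/-- The braiding of a comodule algebra with a module algebra is a twisting map. -/
theorem isTwist_cbr {mX : X ⊗[k] X →ₗ[k] X} {eX : X} {mY : Y ⊗[k] Y →ₗ[k] Y} {eY : Y}
    {ℓ : X →ₗ[k] H ⊗[k] X} {a : H ⊗[k] Y →ₗ[k] Y} (hℓ : IsCopCoaction ℓ) (ha : IsHAction a)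
    (hmX : ∀ t, ℓ (mX t) = lTensor H mX (tensorCoact ℓ ℓ t)) (heX : ℓ eX = 1 ⊗ₜ eX)
    (hmY : IsHLinear (tensAct a a) a mY)
    (heY : ∀ h, a (h ⊗ₜ eY) = Coalgebra.counit (R := k) h • eY) :
    IsTwist mY eY mX eX (cbr ℓ a) where
  mul_left w w' v := cbr_tensor_left ha (hmX _) v
  mul_right w v v' := cbr_tensor_right hℓ hmY w v v'
  one_left v := by simp [cbr_tmul, heX, ha.one]
  one_right w := by
    have h1 : ∀ s : H ⊗[k] X, rTensor X (orbit a eY) s =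
        eY ⊗ₜ TensorProduct.lid k X (rTensor X Coalgebra.counit s) := by
      intro s
      induction s with
      | zero => simp
      | add a b ha hb => simp only [map_add, tmul_add, ha, hb]
      | tmul h w => simp [heY, TensorProduct.smul_tmul]
    rw [cbr_tmul, h1, hℓ.counit]

/-- The compatibility `h₂ v₍₋₁₎ ⊗ (h₁ ▷ v₍₀₎) = (h₂ ▷ v)₍₋₁₎ h₁ ⊗ (h₂ ▷ v)₍₀₎` of an action
and a coaction. -/
def IsYetterDrinfeld (a : H ⊗[k] V →ₗ[k] V) (ℓ : V →ₗ[k] H ⊗[k] V) : Prop :=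
  ∀ h v, TensorProduct.map (mul' k H) a
      (TensorProduct.tensorTensorTensorComm k H H H V (cop k H h ⊗ₜ ℓ v)) =
    rTensor V (mul' k H) (TensorProduct.rightComm k H V H
      (rTensor H ℓ (cbr (cop k H) a (h ⊗ₜ v))))

/-- Acting with h after the crossing produces h₂ x₍₋₁₎ and h₁ ▷ x₍₀₎, and acting before it produces
the coaction of h₂ ▷ x; the Yetter–Drinfeld condition identifies them before anything is applied to
y. -/
theorem IsYetterDrinfeld.isHLinear_cbr {aX : H ⊗[k] X →ₗ[k] X} {ℓ : X →ₗ[k] H ⊗[k] X}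
    (hX : IsYetterDrinfeld aX ℓ) {aY : H ⊗[k] Y →ₗ[k] Y} (hY : IsHAction aY) :
    IsHLinear (tensAct aX aY) (tensAct aY aX) (cbr ℓ aY) := by
  intro h t
  induction t with
  | zero => simp
  | add a b ha hb => simp only [map_add, tmul_add, ha, hb]
  | tmul x y =>
    have h1 : ∀ s : H ⊗[k] X, tensAct aY aX (h ⊗ₜ rTensor X (orbit aY y) s) =
        rTensor X (orbit aY y) (TensorProduct.map (mul' k H) aX
          (TensorProduct.tensorTensorTensorComm k H H H X (cop k H h ⊗ₜ s))) := by
      intro s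
      induction s with
      | zero => simp
      | add a b ha hb => simp only [map_add, tmul_add, ha, hb]
      | tmul h' w =>
        simp only [rTensor_tmul, tensAct_tmul]
        generalize cop k H h = s
        induction s with
        | zero => simp
        | add a b ha hb => simp only [map_add, add_tmul, ha, hb]
        | tmul h w => simp [hY.mul]
    rw [cbr_tmul, h1, hX h x, tensAct_tmul, cbr_tmul]
    generalize cop k H h = s
    induction s with
    | zero => simp
    | add a b ha hb => simp only [map_add, ha, hb]
    | tmul h h' =>
      simp only [map_tmul, orbit_apply, rTensor_tmul, cbr_tmul]
      generalize ℓ (aX (h ⊗ₜ x)) = s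
      induction s with
      | zero => simp
      | add a b ha hb => simp only [map_add, add_tmul, ha, hb]
      | tmul h w => simp [hY.mul]

theorem isHAction_tensAct {a : H ⊗[k] V →ₗ[k] V} {a' : H ⊗[k] W →ₗ[k] W} (ha : IsHAction a)
    (ha' : IsHAction a') : IsHAction (tensAct a a') where
  one t := by
    induction t with
    | zero => simp
    | add a b ha hb => simp only [map_add, tmul_add, ha, hb]
    | tmul v w => simp [tensAct_tmul, cop_one, ha.one, ha'.one]
  mul h h' t := by
    induction t with
    | zero => simp
    | add a b ha hb => simp only [map_add, tmul_add, ha, hb]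
    | tmul v w =>
      rw [tensAct_tmul, cop_mul, tensAct_tmul]
      generalize cop k H h' = s
      induction s with
      | zero => simp
      | add a b ha hb => simp only [map_add, mul_add, tmul_add, ha, hb]
      | tmul b c =>
        simp only [map_tmul, tensAct_tmul, orbit_apply]
        generalize cop k H h = s
        induction s with
        | zero => simp
        | add a b ha hb => simp only [map_add, add_mul, ha, hb]
        | tmul d e => simp [ha.mul, ha'.mul]

theorem IsHLinear.comp {a : H ⊗[k] V →ₗ[k] V} {a' : H ⊗[k] W →ₗ[k] W} {a'' : H ⊗[k] Z →ₗ[k] Z}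
    {g : W →ₗ[k] Z} {f : V →ₗ[k] W} (hg : IsHLinear a' a'' g) (hf : IsHLinear a a' f) :
    IsHLinear a a'' (g ∘ₗ f) := fun h v => by
  simp only [comp_apply, hf h v, hg h]

theorem isHLinear_id (a : H ⊗[k] V →ₗ[k] V) : IsHLinear a a LinearMap.id := fun _ _ => rfl

theorem IsHLinear.map {a : H ⊗[k] V →ₗ[k] V} {a' : H ⊗[k] W →ₗ[k] W} {b : H ⊗[k] X →ₗ[k] X}
    {b' : H ⊗[k] Y →ₗ[k] Y} {f : V →ₗ[k] X} {g : W →ₗ[k] Y} (hf : IsHLinear a b f)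
    (hg : IsHLinear a' b' g) : IsHLinear (tensAct a a') (tensAct b b') (TensorProduct.map f g) := by
  intro h t
  induction t with
  | zero => simp
  | add a b ha hb => simp only [map_add, tmul_add, ha, hb]
  | tmul v w =>
    simp only [tensAct_tmul, map_tmul, TensorProduct.map_map]
    congr 2
    · ext h; exact hf h v
    · ext h; exact hg h w

theorem IsHLinear.lTensor {a : H ⊗[k] V →ₗ[k] V} {a' : H ⊗[k] W →ₗ[k] W}
    {b' : H ⊗[k] Y →ₗ[k] Y} {g : W →ₗ[k] Y}
    (hg : IsHLinear a' b' g) : IsHLinear (tensAct a a') (tensAct a b') (lTensor V g) :=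
  (isHLinear_id a).map hg

theorem IsHLinear.rTensor {a : H ⊗[k] V →ₗ[k] V} {a' : H ⊗[k] W →ₗ[k] W}
    {b' : H ⊗[k] Y →ₗ[k] Y} {g : W →ₗ[k] Y}
    (hg : IsHLinear a' b' g) : IsHLinear (tensAct a' a) (tensAct b' a) (rTensor V g) :=
  hg.map (isHLinear_id a)

theorem IsHLinear.symm {a : H ⊗[k] V →ₗ[k] V} {a' : H ⊗[k] W →ₗ[k] W}
    {e : V ≃ₗ[k] W} (he : IsHLinear a a' e.toLinearMap) : IsHLinear a' a e.symm.toLinearMap := by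
  intro h v
  apply e.injective
  have := he h (e.symm v)
  simp only [LinearEquiv.coe_coe, LinearEquiv.apply_symm_apply] at this ⊢
  exact this.symm

/-- This is coassociativity of the opposite coproduct. -/
theorem isHLinear_assoc (a : H ⊗[k] V →ₗ[k] V) (a' : H ⊗[k] W →ₗ[k] W) (a'' : H ⊗[k] Z →ₗ[k] Z) :
    IsHLinear (tensAct (tensAct a a') a'') (tensAct a (tensAct a' a''))
      (TensorProduct.assoc k V W Z).toLinearMap := by
  intro h t
  induction t with
  | zero => simp
  | add a b ha hb => simp only [map_add, tmul_add, ha, hb]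
  | tmul t z =>
  induction t with
  | zero => simp
  | add a b ha hb => simp only [map_add, tmul_add, add_tmul, ha, hb]
  | tmul v w =>
    have hc := (isCopCoaction_cop (k := k) (H := H)).coassoc h
    simp only [LinearEquiv.coe_coe, assoc_tmul, tensAct_tmul]
    have h1 : ∀ s : H ⊗[k] H, TensorProduct.assoc k V W Z (TensorProduct.map
        (orbit (tensAct a a') (v ⊗ₜ w)) (orbit a'' z) s) = TensorProduct.map (orbit a v)
          (TensorProduct.map (orbit a' w) (orbit a'' z)) (TensorProduct.assoc k H H H
            (rTensor H (cop k H) s)) := by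
      intro s
      induction s with
      | zero => simp
      | add a b ha hb => simp only [map_add, ha, hb]
      | tmul h h' =>
        simp only [map_tmul, rTensor_tmul, orbit_apply, tensAct_tmul]
        generalize cop k H h = s
        induction s with
        | zero => simp
        | add a b ha hb => simp only [map_add, add_tmul, ha, hb]
        | tmul d e => simp
    have h2 : ∀ s : H ⊗[k] H, TensorProduct.map (orbit a v)
        (orbit (tensAct a' a'') (w ⊗ₜ z)) s = TensorProduct.map (orbit a v)
          (TensorProduct.map (orbit a' w) (orbit a'' z)) (lTensor H (cop k H) s) := by
      intro s
      induction s with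
      | zero => simp
      | add a b ha hb => simp only [map_add, ha, hb]
      | tmul h h' => simp [tensAct_tmul]
    rw [h1, h2, hc]

theorem IsHLinear.midMap {aU : H ⊗[k] U →ₗ[k] U} {aV : H ⊗[k] V →ₗ[k] V} {aW : H ⊗[k] W →ₗ[k] W}
    {aZ : H ⊗[k] Z →ₗ[k] Z} {aX : H ⊗[k] X →ₗ[k] X} {aY : H ⊗[k] Y →ₗ[k] Y}
    {f : V ⊗[k] W →ₗ[k] X ⊗[k] Y} (hf : IsHLinear (tensAct aV aW) (tensAct aX aY) f) :
    IsHLinear (tensAct (tensAct aU aV) (tensAct aW aZ)) (tensAct (tensAct aU aX) (tensAct aY aZ))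
      (midMap f) :=
  (isHLinear_assoc aU aX (tensAct aY aZ)).symm.comp
    ((((isHLinear_assoc aX aY aZ).comp
      ((hf.rTensor (a := aZ)).comp (isHLinear_assoc aV aW aZ).symm)).lTensor (a := aU)).comp
        (isHLinear_assoc aU aV (tensAct aW aZ)))

end Braidings

/-! ### The opposite convolution algebra of maps out of A. -/

section Convolution

variable {k : Type*} [Field k] {A E F : Type*} [Ring A] [HopfAlgebra k A]
  [Ring E] [Algebra k E] [Ring F] [Algebra k F]

/-- The opposite convolution product `a ↦ g a₂ * f a₁`. -/
def opConv (f g : A →ₗ[k] E) : A →ₗ[k] E :=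
  mul' k E ∘ₗ (TensorProduct.comm k E E).toLinearMap ∘ₗ
    TensorProduct.map f g ∘ₗ Coalgebra.comul

/-- The unit of the convolution product. -/
def convUnit (k A E : Type*) [Field k] [Ring A] [HopfAlgebra k A] [Ring E] [Algebra k E] :
    A →ₗ[k] E := Algebra.linearMap k E ∘ₗ Coalgebra.counit

theorem opConv_unit_right (f : A →ₗ[k] E) : opConv f (convUnit k A E) = f := by
  ext a
  have h := Coalgebra.lTensor_counit_comul (R := k) a
  have h1 : ∀ t : A ⊗[k] A, mul' k E (TensorProduct.comm k E E
      (TensorProduct.map f (convUnit k A E) t)) =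
      f (TensorProduct.rid k A (lTensor A Coalgebra.counit t)) := by
    intro t
    induction t with
    | zero => simp
    | add a b ha hb => simp only [map_add, ha, hb]
    | tmul a b => simp [convUnit, Algebra.algebraMap_eq_smul_one]
  simp only [opConv, comp_apply, LinearEquiv.coe_coe, h1, h]
  simp

theorem opConv_unit_left (f : A →ₗ[k] E) : opConv (convUnit k A E) f = f := by
  ext a
  have h := Coalgebra.rTensor_counit_comul (R := k) a
  have h1 : ∀ t : A ⊗[k] A, mul' k E (TensorProduct.comm k E E
      (TensorProduct.map (convUnit k A E) f t)) =
      f (TensorProduct.lid k A (rTensor A Coalgebra.counit t)) := by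
    intro t
    induction t with
    | zero => simp
    | add a b ha hb => simp only [map_add, ha, hb]
    | tmul a b => simp [convUnit, Algebra.algebraMap_eq_smul_one]
  simp only [opConv, comp_apply, LinearEquiv.coe_coe, h1, h]
  simp

theorem opConv_assoc (f g h : A →ₗ[k] E) :
    opConv (opConv f g) h = opConv f (opConv g h) := by
  ext a
  have hc := Coalgebra.coassoc_apply (R := k) a
  let Φ : A ⊗[k] (A ⊗[k] A) →ₗ[k] E := mul' k E ∘ₗ
    (TensorProduct.comm k E E).toLinearMap ∘ₗ TensorProduct.map f
      (mul' k E ∘ₗ (TensorProduct.comm k E E).toLinearMap ∘ₗ TensorProduct.map g h)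
  have h1 : ∀ t : A ⊗[k] A, mul' k E (TensorProduct.comm k E E
      (TensorProduct.map (opConv f g) h t)) =
      Φ (TensorProduct.assoc k A A A (rTensor A Coalgebra.comul t)) := by
    intro t
    induction t with
    | zero => simp
    | add a b ha hb => simp only [map_add, ha, hb]
    | tmul a b =>
      simp only [opConv, comp_apply, LinearEquiv.coe_coe, map_tmul,
        rTensor_tmul]
      generalize Coalgebra.comul (R := k) a = s
      induction s with
      | zero => simp
      | add a b ha hb => simp only [map_add, add_tmul, ha, hb]
      | tmul c d => simp [Φ, mul_assoc]
  have h2 : ∀ t : A ⊗[k] A, mul' k E (TensorProduct.comm k E E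
      (TensorProduct.map f (opConv g h) t)) =
      Φ (lTensor A Coalgebra.comul t) := by
    intro t
    induction t with
    | zero => simp
    | add a b ha hb => simp only [map_add, ha, hb]
    | tmul a b => simp [Φ, opConv]
  conv_lhs => rw [opConv]
  conv_rhs => rw [opConv]
  simp only [comp_apply, LinearEquiv.coe_coe, h1, h2, hc]

theorem opConv_inverse_unique {f g g' : A →ₗ[k] E} (h : opConv f g = convUnit k A E)
    (h' : opConv g' f = convUnit k A E) : g = g' := by
  rw [← opConv_unit_left g, ← h', opConv_assoc, h, opConv_unit_right]

theorem opConv_comp (φ : E →ₐ[k] F) (f g : A →ₗ[k] E) :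
    opConv (φ.toLinearMap ∘ₗ f) (φ.toLinearMap ∘ₗ g) = φ.toLinearMap ∘ₗ opConv f g := by
  ext a
  simp only [opConv, comp_apply, LinearEquiv.coe_coe]
  generalize Coalgebra.comul (R := k) a = s
  induction s with
  | zero => simp
  | add a b ha hb => simp only [map_add, ha, hb]
  | tmul c d => simp

/-- Rebracketing the fourfold coproduct so that its two middle factors come from a single coproduct;
an inner convolution product can then be cancelled first. -/
theorem map_comul_comul (a : A) :
    TensorProduct.map Coalgebra.comul Coalgebra.comul (Coalgebra.comul (R := k) a) =
      TensorProduct.assoc k (A ⊗[k] A) A A (rTensor A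
        ((TensorProduct.assoc k A A A).symm.toLinearMap ∘ₗ lTensor A Coalgebra.comul ∘ₗ
          Coalgebra.comul) (Coalgebra.comul (R := k) a)) := by
  have h1 : ∀ t : A ⊗[k] A,
      TensorProduct.map (Coalgebra.comul (R := k)) (Coalgebra.comul (R := k)) t =
      TensorProduct.assoc k (A ⊗[k] A) A A (rTensor A
        (rTensor A Coalgebra.comul) ((TensorProduct.assoc k A A A).symm
          (lTensor A Coalgebra.comul t))) := by
    intro t
    induction t with
    | zero => simp
    | add a b ha hb => simp only [map_add, ha, hb]
    | tmul a b =>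
      simp only [map_tmul, lTensor_tmul]
      generalize Coalgebra.comul (R := k) b = s
      induction s with
      | zero => simp
      | add a b ha hb => simp only [map_add, tmul_add, ha, hb]
      | tmul c d => simp
  rw [h1, ← Coalgebra.coassoc_apply, LinearEquiv.symm_apply_apply, ← LinearMap.rTensor_comp_apply]
  congr 3
  ext a
  simp

end Convolution

/-! ### The inverses of R and Rbar as bialgebra maps to H with the opposite coproduct. -/

section CopHopfMap

variable {k A H : Type*} [Field k] [Ring A] [HopfAlgebra k A] [Ring H] [HopfAlgebra k H]

/-- `f` is a bialgebra map from `A` to `H` with the opposite coproduct, compatible with the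
pairing `p`: `h₂ f(a₁) ⟨h₁, a₂⟩ = f(a₂) h₁ ⟨h₂, a₁⟩`. -/
structure IsCopBialgMap (p : H ⊗[k] A →ₗ[k] k) (f : A →ₗ[k] H) : Prop where
  map_mul : ∀ a b : A, f (a * b) = f a * f b
  map_one : f 1 = 1
  map_cop : ∀ a, cop k H (f a) = TensorProduct.map f f (Coalgebra.comul a)
  map_counit : ∀ a, Coalgebra.counit (R := k) (f a) = Coalgebra.counit (R := k) a
  compat : ∀ h a, TensorProduct.rid k H
    (TensorProduct.map (mul' k H ∘ₗ lTensor H f) p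
      (TensorProduct.tensorTensorTensorComm k H H A A (cop k H h ⊗ₜ Coalgebra.comul a))) =
    TensorProduct.lid k H (TensorProduct.map p (mul' k H ∘ₗ
      (TensorProduct.comm k H H).toLinearMap ∘ₗ lTensor H f)
      (TensorProduct.tensorTensorTensorComm k H H A A (cop k H h ⊗ₜ Coalgebra.comul a)))

/-- Since f reverses products, f(a₂) f(S a₁) = f(S(a₁) a₂) = ε(a), so f ∘ S is a left convolution
inverse and uniqueness applies. -/
theorem IsConvInverseOp.eq_comp_antipode {f g : A →ₗ[k] H} (hf : IsHopfMapToOp f)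
    (hg : IsConvInverseOp f g) : g = f ∘ₗ HopfAlgebra.antipode k := by
  refine opConv_inverse_unique (f := f) hg.right_inv ?_
  ext a
  have h := HopfAlgebra.mul_antipode_rTensor_comul_apply (R := k) a
  have h1 : ∀ t : A ⊗[k] A, mul' k H (TensorProduct.comm k H H
      (TensorProduct.map (f ∘ₗ HopfAlgebra.antipode k) f t)) =
      f (mul' k A (rTensor A (HopfAlgebra.antipode k) t)) := by
    intro t
    induction t with
    | zero => simp
    | add a b ha hb => simp only [map_add, ha, hb]
    | tmul a b => simp [hf.map_mul]
  simp only [opConv, comp_apply, LinearEquiv.coe_coe, h1, h, convUnit]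
  simp [Algebra.algebraMap_eq_smul_one, hf.map_one]

/-- Both Δ ∘ g and the flipped (g ⊗ g) ∘ Δ are convolution inverses of Δ ∘ f, with values in H ⊗ H.
-/
theorem IsConvInverseOp.map_cop {f g : A →ₗ[k] H} (hf : IsHopfMapToOp f)
    (hg : IsConvInverseOp f g) (a : A) :
    cop k H (g a) = TensorProduct.map g g (Coalgebra.comul a) := by
  have key : Coalgebra.comul ∘ₗ g = TensorProduct.map g g ∘ₗ
      (TensorProduct.comm k A A).toLinearMap ∘ₗ Coalgebra.comul := by
    refine opConv_inverse_unique (f := Coalgebra.comul ∘ₗ f) ?_ ?_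
    · have := opConv_comp (Bialgebra.comulAlgHom k H) f g
      refine this.trans ?_
      rw [show opConv f g = convUnit k A H from hg.right_inv]
      ext a
      simp [convUnit]
    · rw [hf.map_comul]
      ext a
      have hl : ∀ b, mul' k H (TensorProduct.comm k H H
          (TensorProduct.map g f (Coalgebra.comul b))) =
            algebraMap k H (Coalgebra.counit b) := fun b => LinearMap.congr_fun hg.left_inv b
      have hr := hl a
      -- Ξ sends a₁ ⊗ a₂ ⊗ a₃ ⊗ a₄ to f(a₃) g(a₂) ⊗ f(a₄) g(a₁). The middle pair cancels first,
      -- which leaves 1 ⊗ f(a₂) g(a₁), and this cancels in turn.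
      let Ξ : (A ⊗[k] A) ⊗[k] (A ⊗[k] A) →ₗ[k] H ⊗[k] H :=
        mul' k (H ⊗[k] H) ∘ₗ (TensorProduct.comm k (H ⊗[k] H) (H ⊗[k] H)).toLinearMap ∘ₗ
          TensorProduct.map (TensorProduct.map g g ∘ₗ (TensorProduct.comm k A A).toLinearMap)
            (TensorProduct.map f f)
      have h1 : opConv (TensorProduct.map g g ∘ₗ (TensorProduct.comm k A A).toLinearMap ∘ₗ
          Coalgebra.comul) (TensorProduct.map f f ∘ₗ Coalgebra.comul) a =
          Ξ (TensorProduct.map Coalgebra.comul Coalgebra.comul (Coalgebra.comul (R := k) a)) := by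
        simp only [opConv, comp_apply, LinearEquiv.coe_coe, Ξ, TensorProduct.map_map,
          ← LinearMap.comp_assoc]
      have h2 : ∀ t : A ⊗[k] A, Ξ (TensorProduct.assoc k (A ⊗[k] A) A A (rTensor A
          ((TensorProduct.assoc k A A A).symm.toLinearMap ∘ₗ lTensor A Coalgebra.comul ∘ₗ
          Coalgebra.comul) t)) = 1 ⊗ₜ mul' k H (TensorProduct.comm k H H
          (TensorProduct.map g f t)) := by
        intro t
        induction t with
        | zero => simp
        | add a b ha hb => simp only [map_add, tmul_add, ha, hb]
        | tmul x y =>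
          have h3 : ∀ s : A ⊗[k] A, Ξ (TensorProduct.assoc k (A ⊗[k] A) A A
              ((TensorProduct.assoc k A A A).symm (lTensor A Coalgebra.comul s) ⊗ₜ y)) =
              1 ⊗ₜ (f y * g (TensorProduct.rid k A (lTensor A Coalgebra.counit s))) := by
            intro s
            induction s with
            | zero => simp
            | add a b ha hb => simp only [map_add, add_tmul, mul_add, tmul_add, ha, hb]
            | tmul p q =>
              have h4 : ∀ r : A ⊗[k] A, Ξ (TensorProduct.assoc k (A ⊗[k] A) A A
                  ((TensorProduct.assoc k A A A).symm (p ⊗ₜ r) ⊗ₜ y)) =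
                  (mul' k H (TensorProduct.comm k H H (TensorProduct.map g f r))) ⊗ₜ
                    (f y * g p) := by
                intro r
                induction r with
                | zero => simp
                | add a b ha hb => simp only [map_add, add_tmul, tmul_add, ha, hb]
                | tmul c d => simp [Ξ]
              rw [lTensor_tmul, h4, hl]
              simp [Algebra.algebraMap_eq_smul_one, TensorProduct.smul_tmul]
          simp only [rTensor_tmul, comp_apply, LinearEquiv.coe_coe, h3,
            Coalgebra.lTensor_counit_comul]
          simp
      rw [h1, map_comul_comul, h2, hr]
      simp [convUnit, Algebra.algebraMap_eq_smul_one, Algebra.TensorProduct.one_def]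
  have h1 := LinearMap.congr_fun key a
  simp only [comp_apply, LinearEquiv.coe_coe] at h1
  rw [cop, comp_apply, h1]
  generalize Coalgebra.comul (R := k) a = s
  induction s with
  | zero => simp
  | add a b ha hb => simp only [map_add, ha, hb]
  | tmul c d => simp

/-- `a ↦ h ⟨h', a⟩`, for `t = h ⊗ h'`. -/
def pairLeg (p : H ⊗[k] A →ₗ[k] k) (t : H ⊗[k] H) : A →ₗ[k] H :=
  (TensorProduct.rid k H).toLinearMap ∘ₗ lTensor H p ∘ₗ
    (TensorProduct.assoc k H H A).toLinearMap ∘ₗ TensorProduct.mk k (H ⊗[k] H) A t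

/-- With `pairLeg_comm_opConv`, this reads each side of the compatibility condition as a convolution
product with f, so the condition can be manipulated in the convolution algebra. -/
theorem opConv_pairLeg (p : H ⊗[k] A →ₗ[k] k) (f : A →ₗ[k] H) (t : H ⊗[k] H) (a : A) :
    opConv f (pairLeg p t) a = TensorProduct.rid k H
      (TensorProduct.map (mul' k H ∘ₗ lTensor H f) p
        (TensorProduct.tensorTensorTensorComm k H H A A (t ⊗ₜ Coalgebra.comul a))) := by
  simp only [opConv, comp_apply, LinearEquiv.coe_coe]
  generalize Coalgebra.comul (R := k) a = s
  induction s with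
  | zero => simp
  | add a b ha hb => simp only [map_add, tmul_add, ha, hb]
  | tmul c d =>
    induction t with
    | zero => simp [pairLeg]
    | add a b ha hb =>
      simp only [map_add, add_tmul, ← ha, ← hb]
      simp [pairLeg, add_tmul]
    | tmul a b => simp [pairLeg]

theorem pairLeg_comm_opConv (p : H ⊗[k] A →ₗ[k] k) (f : A →ₗ[k] H) (t : H ⊗[k] H) (a : A) :
    opConv (pairLeg p (TensorProduct.comm k H H t)) f a = TensorProduct.lid k H
      (TensorProduct.map p (mul' k H ∘ₗ (TensorProduct.comm k H H).toLinearMap ∘ₗ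
        lTensor H f)
        (TensorProduct.tensorTensorTensorComm k H H A A (t ⊗ₜ Coalgebra.comul a))) := by
  simp only [opConv, comp_apply, LinearEquiv.coe_coe]
  generalize Coalgebra.comul (R := k) a = s
  induction s with
  | zero => simp
  | add a b ha hb => simp only [map_add, tmul_add, ha, hb]
  | tmul c d =>
    induction t with
    | zero => simp [pairLeg]
    | add a b ha hb =>
      simp only [map_add, add_tmul, ← ha, ← hb]
      simp [pairLeg, add_tmul]
    | tmul a b => simp [pairLeg]

/-- Multiplicativity and the counit come from g = f ∘ S, two order reversals cancelling. For the
pairing condition, the hypothesis on f says f * P = P' * f for two pairing legs of h; multiplying by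
g on both sides gives P * g = g * P'. -/
theorem IsConvInverseOp.isCopBialgMap {p : H ⊗[k] A →ₗ[k] k} {f g : A →ₗ[k] H}
    (hf : IsHopfMapToOp f) (hg : IsConvInverseOp f g) (hp : compatLeft p f = compatRight p f) :
    IsCopBialgMap p g where
  map_mul a b := by
    simp [hg.eq_comp_antipode hf, HopfAlgebra.antipode_mul_antidistrib, hf.map_mul]
  map_one := by simp [hg.eq_comp_antipode hf, hf.map_one]
  map_cop := hg.map_cop hf
  map_counit a := by
    have := LinearMap.congr_fun hf.map_counit (HopfAlgebra.antipode k a)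
    simpa [hg.eq_comp_antipode hf] using this
  compat h a := by
    have h1 : opConv f (pairLeg p (Coalgebra.comul h)) = opConv (pairLeg p (cop k H h)) f := by
      ext a
      have := LinearMap.congr_fun hp (h ⊗ₜ a)
      simp only [compatLeft, compatRight, comp_apply, LinearEquiv.coe_coe,
        map_tmul] at this
      rw [opConv_pairLeg, this]
      exact (pairLeg_comm_opConv p f _ a).symm
    have h2 : opConv (pairLeg p (Coalgebra.comul h)) g = opConv g (pairLeg p (cop k H h)) := by
      have hl : opConv g f = convUnit k A H := hg.left_inv
      have hr : opConv f g = convUnit k A H := hg.right_inv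
      set P := pairLeg p (Coalgebra.comul h)
      set P' := pairLeg p (cop k H h)
      calc opConv P g = opConv (opConv (opConv g f) P) g := by rw [hl, opConv_unit_left]
        _ = opConv (opConv g (opConv f P)) g := by rw [opConv_assoc g f P]
        _ = opConv (opConv g (opConv P' f)) g := by rw [h1]
        _ = opConv (opConv g P') (opConv f g) := by rw [← opConv_assoc g P' f, opConv_assoc _ f g]
        _ = opConv g P' := by rw [hr, opConv_unit_right]
    have h3 := LinearMap.congr_fun h2 a
    rw [opConv_pairLeg] at h3
    rw [← h3, ← pairLeg_comm_opConv]
    congr 2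
    simp [cop]

/-- As R⁻¹ is a coalgebra map to H with the opposite coproduct, composing it with the antipode of H
inverts it under convolution; R inverts it too. -/
theorem WeakQuasitriangularPair.antipode_Rinv (Q : WeakQuasitriangularPair k A H) (a : A) :
    HopfAlgebra.antipode k (Q.Rinv a) = Q.R a := by
  have h : HopfAlgebra.antipode k ∘ₗ Q.Rinv = Q.R := by
    refine opConv_inverse_unique (f := Q.Rinv) ?_ Q.inverse_R.right_inv
    ext a
    have h1 := Q.inverse_R.map_cop Q.hopf_R a
    have h2 := HopfAlgebra.mul_antipode_rTensor_comul_apply (R := k) (Q.Rinv a)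
    have h3 : ∀ t : A ⊗[k] A, mul' k H (TensorProduct.comm k H H
        (TensorProduct.map Q.Rinv (HopfAlgebra.antipode k ∘ₗ Q.Rinv) t)) =
        mul' k H (rTensor H (HopfAlgebra.antipode k) (TensorProduct.comm k H H
          (TensorProduct.map Q.Rinv Q.Rinv t))) := by
      intro t
      induction t with
      | zero => simp
      | add a b ha hb => simp only [map_add, ha, hb]
      | tmul c d => simp
    simp only [opConv, comp_apply, LinearEquiv.coe_coe, h3, ← h1]
    have h4 : TensorProduct.comm k H H (cop k H (Q.Rinv a)) = Coalgebra.comul (Q.Rinv a) := by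
      simp [cop]
    rw [h4, h2, convUnit, comp_apply]
    exact congrArg (algebraMap k H)
      ((Q.inverse_R.isCopBialgMap Q.hopf_R Q.compat_R).map_counit a)
  exact LinearMap.congr_fun h a

/-- ⟨Rbar⁻¹ a, b⟩ = ⟨Rbar(S a), b⟩ = ⟨R⁻¹ b, S a⟩ = ⟨S R⁻¹ b, a⟩ = ⟨R b, a⟩. This is what lets Ψ be
written through the coaction of its other argument. -/
theorem WeakQuasitriangularPair.pair_Rbarinv (Q : WeakQuasitriangularPair k A H) (a b : A) :
    Q.pair (Q.Rbarinv a ⊗ₜ b) = Q.pair (Q.R b ⊗ₜ a) := by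
  rw [Q.inverse_Rbar.eq_comp_antipode Q.hopf_Rbar, comp_apply, Q.pair_Rbar,
    ← Q.pairing.antipode, Q.antipode_Rinv]

theorem WeakQuasitriangularPair.isCopBialgMap_Rinv (Q : WeakQuasitriangularPair k A H) :
    IsCopBialgMap Q.pair Q.Rinv := Q.inverse_R.isCopBialgMap Q.hopf_R Q.compat_R

theorem WeakQuasitriangularPair.isCopBialgMap_Rbarinv (Q : WeakQuasitriangularPair k A H) :
    IsCopBialgMap Q.pair Q.Rbarinv := Q.inverse_Rbar.isCopBialgMap Q.hopf_Rbar Q.compat_Rbar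

end CopHopfMap

/-! ### From A-comodules to actions and coactions of H. -/

section Comodules

variable {k A H : Type*} [Field k] [Ring A] [HopfAlgebra k A] [Ring H] [HopfAlgebra k H]
  {V W : Type*} [AddCommGroup V] [Module k V] [AddCommGroup W] [Module k W]
  {p : H ⊗[k] A →ₗ[k] k} {f : A →ₗ[k] H}

theorem act_tmul (p : H ⊗[k] A →ₗ[k] k) (δV : V →ₗ[k] A ⊗[k] V) (h : H) (v : V) :
    act p δV (h ⊗ₜ v) = TensorProduct.lid k V
      (rTensor V (p ∘ₗ TensorProduct.mk k H A h) (δV v)) := by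
  simp only [act, comp_apply, lTensor_tmul, LinearEquiv.coe_coe]
  generalize δV v = t
  induction t with
  | zero => simp
  | add a b ha hb => simp only [map_add, tmul_add, ha, hb]
  | tmul c d => simp

/-- In ⟨h h', a⟩ = ⟨h', a₁⟩⟨h, a₂⟩ the factor h' meets the outer coaction leg, as a left action
requires; coassociativity does the rest. -/
theorem IsHopfPairing.isHAction_act (hp : IsHopfPairing p) (δ : LeftCoaction k A V) :
    IsHAction (act p δ.coact) where
  one v := by
    have h := LinearMap.congr_fun δ.counit v
    have h1 : p ∘ₗ TensorProduct.mk k H A 1 = Coalgebra.counit := by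
      ext a; exact hp.one_left a
    rw [act_tmul, h1]
    exact h
  mul h h' v := by
    have hc := LinearMap.congr_fun δ.coassoc v
    simp only [comp_apply, LinearEquiv.coe_coe] at hc
    let Φ : A ⊗[k] (A ⊗[k] V) →ₗ[k] V := (TensorProduct.lid k V).toLinearMap ∘ₗ TensorProduct.map
      (p ∘ₗ TensorProduct.mk k H A h') ((TensorProduct.lid k V).toLinearMap ∘ₗ
        rTensor V (p ∘ₗ TensorProduct.mk k H A h))
    have h1 : ∀ t : A ⊗[k] V, TensorProduct.lid k V
        (rTensor V (p ∘ₗ TensorProduct.mk k H A (h * h')) t) =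
        Φ (TensorProduct.assoc k A A V (rTensor V Coalgebra.comul t)) := by
      intro t
      induction t with
      | zero => simp
      | add a b ha hb => simp only [map_add, ha, hb]
      | tmul a w =>
        simp only [rTensor_tmul, comp_apply, TensorProduct.mk_apply,
          hp.mul_left]
        generalize Coalgebra.comul (R := k) a = s
        induction s with
        | zero => simp
        | add a b ha hb => simp only [map_add, add_tmul, tmul_add, ha, hb]
        | tmul c d => simp [Φ, formSq_tmul, mul_smul, smul_comm (p (h ⊗ₜ d))]
    have h2 : ∀ t : A ⊗[k] V, act p δ.coact (h ⊗ₜ TensorProduct.lid k V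
        (rTensor V (p ∘ₗ TensorProduct.mk k H A h') t)) =
        Φ (lTensor A δ.coact t) := by
      intro t
      induction t with
      | zero => simp
      | add a b ha hb => simp only [map_add, tmul_add, ha, hb]
      | tmul a w => simp [act_tmul, Φ]
    rw [act_tmul, act_tmul (h := h'), h1, h2, hc]

/-- The convention ⟨h, a b⟩ = ⟨h₁, b⟩⟨h₂, a⟩ is the reason why H acts on tensor products through its
opposite coproduct. -/
theorem IsHopfPairing.act_tensorCoact (hp : IsHopfPairing p) (δV : V →ₗ[k] A ⊗[k] V)
    (δW : W →ₗ[k] A ⊗[k] W) :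
    act p (tensorCoact δV δW) = tensAct (act p δV) (act p δW) := by
  ext h v w
  simp only [TensorProduct.AlgebraTensorModule.curry_apply, TensorProduct.curry_apply,
    LinearMap.coe_restrictScalars, act_tmul, tensAct_tmul]
  have h1 : ∀ s t, TensorProduct.lid k (V ⊗[k] W) (rTensor (V ⊗[k] W)
      (p ∘ₗ TensorProduct.mk k H A h) (rTensor (V ⊗[k] W) (mul' k A)
        (TensorProduct.tensorTensorTensorComm k A V A W (s ⊗ₜ t)))) =
      TensorProduct.map ((TensorProduct.lid k V).toLinearMap ∘ₗ rTensor V p ∘ₗ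
        (TensorProduct.assoc k H A V).symm.toLinearMap ∘ₗ (TensorProduct.mk k H (A ⊗[k] V)).flip s)
        ((TensorProduct.lid k W).toLinearMap ∘ₗ rTensor W p ∘ₗ
        (TensorProduct.assoc k H A W).symm.toLinearMap ∘ₗ (TensorProduct.mk k H (A ⊗[k] W)).flip t)
        (cop k H h) := by
    intro s t
    induction s with
    | zero => simp
    | add a b ha hb =>
      simp only [map_add, add_tmul, ha, hb, LinearMap.comp_add, TensorProduct.map_add_left,
        LinearMap.add_apply]
    | tmul a v =>
    induction t with
    | zero => simp
    | add a b ha hb =>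
      simp only [map_add, tmul_add, ha, hb, LinearMap.comp_add, TensorProduct.map_add_right,
        LinearMap.add_apply]
    | tmul b w =>
      simp only [tensorTensorTensorComm_tmul, rTensor_tmul, comp_apply,
        LinearMap.mul'_apply, TensorProduct.mk_apply, hp.mul_right, cop, LinearEquiv.coe_coe]
      generalize Coalgebra.comul (R := k) h = s
      induction s with
      | zero => simp
      | add a b ha hb => simp only [map_add, add_tmul, ha, hb]
      | tmul c d =>
        simp only [formSq_tmul, comm_tmul, map_tmul,
          rTensor_tmul, lid_tmul, comp_apply, LinearMap.flip_apply,
          TensorProduct.mk_apply, LinearEquiv.coe_coe, assoc_symm_tmul]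
        rw [TensorProduct.smul_tmul_smul]
  exact h1 (δV v) (δW w)

theorem IsColinear.isHLinear {δV : V →ₗ[k] A ⊗[k] V} {δW : W →ₗ[k] A ⊗[k] W} {g : V →ₗ[k] W}
    (hg : IsColinear δV δW g) (p : H ⊗[k] A →ₗ[k] k) : IsHLinear (act p δV) (act p δW) g := by
  intro h v
  have h1 := LinearMap.congr_fun hg v
  simp only [comp_apply] at h1
  rw [act_tmul, act_tmul, h1]
  generalize δV v = t
  induction t with
  | zero => simp
  | add a b ha hb => simp only [map_add, ha, hb]
  | tmul c d => simp

theorem IsColinear.leg {δV : V →ₗ[k] A ⊗[k] V} {δW : W →ₗ[k] A ⊗[k] W} {g : V →ₗ[k] W}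
    (hg : IsColinear δV δW g) (f : A →ₗ[k] H) (v : V) :
    leg f δW (g v) = lTensor H g (leg f δV v) := by
  have h1 := LinearMap.congr_fun hg v
  simp only [comp_apply] at h1
  simp only [BraidedDouble.leg, comp_apply, h1]
  generalize δV v = t
  induction t with
  | zero => simp
  | add a b ha hb => simp only [map_add, ha, hb]
  | tmul c d => simp

/-- Multiplicativity of f is essential here: it holds for R⁻¹ and Rbar⁻¹, whereas R and Rbar reverse
products. -/
theorem IsCopBialgMap.leg_tensorCoact (hf : IsCopBialgMap p f) (δV : V →ₗ[k] A ⊗[k] V)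
    (δW : W →ₗ[k] A ⊗[k] W) :
    leg f (tensorCoact δV δW) = tensorCoact (leg f δV) (leg f δW) := by
  ext v w
  simp only [TensorProduct.AlgebraTensorModule.curry_apply, TensorProduct.curry_apply,
    LinearMap.coe_restrictScalars, leg, tensorCoact, comp_apply, map_tmul,
    LinearEquiv.coe_coe]
  generalize δV v = s
  generalize δW w = t
  induction s with
  | zero => simp
  | add a b ha hb => simp only [map_add, add_tmul, ha, hb]
  | tmul a v =>
  induction t with
  | zero => simp
  | add a b ha hb => simp only [map_add, tmul_add, ha, hb]
  | tmul b w => simp [hf.map_mul]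

theorem IsCopBialgMap.isCopCoaction (hf : IsCopBialgMap p f) (δ : LeftCoaction k A V) :
    IsCopCoaction (leg f δ.coact) where
  coassoc v := by
    have hc := LinearMap.congr_fun δ.coassoc v
    simp only [comp_apply, LinearEquiv.coe_coe] at hc
    have h1 : ∀ t : A ⊗[k] V, TensorProduct.assoc k H H V (rTensor V (cop k H)
        (rTensor V f t)) = TensorProduct.map f (rTensor V f)
          (TensorProduct.assoc k A A V (rTensor V Coalgebra.comul t)) := by
      intro t
      induction t with
      | zero => simp
      | add a b ha hb => simp only [map_add, ha, hb]
      | tmul a w =>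
        simp only [rTensor_tmul, hf.map_cop]
        generalize Coalgebra.comul (R := k) a = s
        induction s with
        | zero => simp
        | add a b ha hb => simp only [map_add, add_tmul, ha, hb]
        | tmul c d => simp
    have h2 : ∀ t : A ⊗[k] V, lTensor H (leg f δ.coact) (rTensor V f t) =
        TensorProduct.map f (rTensor V f) (lTensor A δ.coact t) := by
      intro t
      induction t with
      | zero => simp
      | add a b ha hb => simp only [map_add, ha, hb]
      | tmul a w => simp [leg]
    simp only [leg, comp_apply] at h2 ⊢
    rw [h1, hc, ← h2]
  counit v := by
    have hc := LinearMap.congr_fun δ.counit v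
    have h1 : (Coalgebra.counit (R := k)) ∘ₗ f = Coalgebra.counit := by
      ext a; exact hf.map_counit a
    rw [leg, comp_apply, ← LinearMap.rTensor_comp_apply, h1]
    exact hc

/-- The action and the coaction come from the same A-coaction, so coassociativity puts both sides in
the form of a map A → H applied to v₍₋₁₎; these two maps agree by the compatibility of f with the
pairing. -/
theorem IsCopBialgMap.isYetterDrinfeld (hf : IsCopBialgMap p f) (δ : LeftCoaction k A V) :
    IsYetterDrinfeld (act p δ.coact) (leg f δ.coact) := by
  intro h v
  have hc := LinearMap.congr_fun δ.coassoc v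
  simp only [comp_apply, LinearEquiv.coe_coe] at hc
  let L : A ⊗[k] A →ₗ[k] H := (TensorProduct.rid k H).toLinearMap ∘ₗ
    TensorProduct.map (mul' k H ∘ₗ lTensor H f) p ∘ₗ
      (TensorProduct.tensorTensorTensorComm k H H A A).toLinearMap ∘ₗ
        TensorProduct.mk k (H ⊗[k] H) (A ⊗[k] A) (cop k H h)
  let L' : A ⊗[k] A →ₗ[k] H := (TensorProduct.lid k H).toLinearMap ∘ₗ
    TensorProduct.map p (mul' k H ∘ₗ (TensorProduct.comm k H H).toLinearMap ∘ₗ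
        lTensor H f) ∘ₗ
      (TensorProduct.tensorTensorTensorComm k H H A A).toLinearMap ∘ₗ
        TensorProduct.mk k (H ⊗[k] H) (A ⊗[k] A) (cop k H h)
  have hL : L ∘ₗ Coalgebra.comul = L' ∘ₗ Coalgebra.comul := by
    ext a; exact hf.compat h a
  have h1 : ∀ t : A ⊗[k] V, TensorProduct.map (mul' k H) (act p δ.coact)
      (TensorProduct.tensorTensorTensorComm k H H H V (cop k H h ⊗ₜ rTensor V f t)) =
      rTensor V L ((TensorProduct.assoc k A A V).symm
        (lTensor A δ.coact t)) := by
    intro t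
    induction t with
    | zero => simp
    | add a b ha hb => simp only [map_add, tmul_add, ha, hb]
    | tmul a w =>
      simp only [rTensor_tmul, lTensor_tmul, L]
      generalize cop k H h = s
      induction s with
      | zero => simp
      | add a b ha hb =>
        simp only [map_add, add_tmul, ha, hb, LinearMap.comp_add, LinearMap.rTensor_add,
          LinearMap.add_apply]
      | tmul c d =>
        simp only [tensorTensorTensorComm_tmul, map_tmul, act_tmul]
        generalize δ.coact w = r
        induction r with
        | zero => simp
        | add a b ha hb => simp only [map_add, tmul_add, ha, hb]
        | tmul x y => simp [TensorProduct.smul_tmul']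
  -- The coaction `δ.coact v` is replaced by an arbitrary tensor t, so that the induction does not
  -- interfere with its second occurrence inside the coaction on v₍₀₎.
  have h2 : ∀ s : H ⊗[k] H, ∀ t : A ⊗[k] V, rTensor V (mul' k H)
      (TensorProduct.rightComm k H V H (rTensor H (leg f δ.coact)
        (rTensor H ((TensorProduct.lid k V).toLinearMap ∘ₗ rTensor V p ∘ₗ
        (TensorProduct.assoc k H A V).symm.toLinearMap ∘ₗ
          (TensorProduct.mk k H (A ⊗[k] V)).flip t) s))) =
      rTensor V ((TensorProduct.lid k H).toLinearMap ∘ₗ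
    TensorProduct.map p (mul' k H ∘ₗ (TensorProduct.comm k H H).toLinearMap ∘ₗ
        lTensor H f) ∘ₗ
      (TensorProduct.tensorTensorTensorComm k H H A A).toLinearMap ∘ₗ
        TensorProduct.mk k (H ⊗[k] H) (A ⊗[k] A) s) ((TensorProduct.assoc k A A V).symm
        (lTensor A δ.coact t)) := by
    intro s t
    induction s with
    | zero => simp
    | add a b ha hb =>
      simp only [map_add, ha, hb, LinearMap.comp_add, LinearMap.rTensor_add,
        LinearMap.add_apply]
    | tmul c d =>
    induction t with
    | zero => simp
    | add a b ha hb =>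
      simp only [map_add, LinearMap.comp_add, LinearMap.rTensor_add,
          LinearMap.add_apply, ha, hb]
    | tmul a w =>
      simp only [rTensor_tmul, lTensor_tmul, comp_apply,
        LinearMap.flip_apply, TensorProduct.mk_apply, LinearEquiv.coe_coe, assoc_symm_tmul,
        TensorProduct.lid_tmul, leg, map_smul]
      generalize δ.coact w = r
      induction r with
      | zero => simp
      | add a b ha hb => simp only [map_add, add_tmul, tmul_add, smul_add, ha, hb]
      | tmul x y => simp [TensorProduct.smul_tmul']
  have h3 := h2 (cop k H h) (δ.coact v)
  rw [← hc, LinearEquiv.symm_apply_apply] at h3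
  have h4 := h1 (δ.coact v)
  rw [← hc, LinearEquiv.symm_apply_apply, ← LinearMap.rTensor_comp_apply, hL] at h4
  refine h4.trans ?_
  rw [LinearMap.rTensor_comp_apply]
  refine h3.symm.trans ?_
  rw [cbr_tmul]
  rfl

end Comodules

/-! ### The braiding and its inverse as instances of `cbr`. -/

section Braid

variable {k A H : Type*} [Field k] [Ring A] [HopfAlgebra k A] [Ring H] [HopfAlgebra k H]
  (Q : WeakQuasitriangularPair k A H)
  {V W : Type*} [AddCommGroup V] [Module k V] [AddCommGroup W] [Module k W]

theorem braidInv_eq_cbr (δV : V →ₗ[k] A ⊗[k] V) (δW : W →ₗ[k] A ⊗[k] W) :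
    braidInv Q δV δW = cbr (leg Q.Rinv δV) (act Q.pair δW) := rfl

theorem smashTwist_eq_cbr (p : H ⊗[k] A →ₗ[k] k) (δV : V →ₗ[k] A ⊗[k] V) :
    smashTwist p δV = cbr (cop k H) (act p δV) := rfl

/-- By definition Ψ feeds R(v₍₋₁₎) into the action on w; `pair_Rbarinv` rewrites the scalar as
Rbar⁻¹(w₍₋₁₎) paired with v₍₋₁₎, turning it into an action on v. -/
theorem braid_eq_cbr (δW : W →ₗ[k] A ⊗[k] W) (δV : V →ₗ[k] A ⊗[k] V) :
    braid Q δW δV = cbr (leg Q.Rbarinv δW) (act Q.pair δV) := by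
  ext w v
  have h1 : ∀ s : A ⊗[k] V, ∀ t : A ⊗[k] W, TensorProduct.comm k W V
      (rTensor V ((TensorProduct.lid k W).toLinearMap ∘ₗ rTensor W Q.pair ∘ₗ
        (TensorProduct.assoc k H A W).symm.toLinearMap ∘ₗ
          (TensorProduct.mk k H (A ⊗[k] W)).flip t) (rTensor V Q.R s)) =
      rTensor W ((TensorProduct.lid k V).toLinearMap ∘ₗ rTensor V Q.pair ∘ₗ
        (TensorProduct.assoc k H A V).symm.toLinearMap ∘ₗ
          (TensorProduct.mk k H (A ⊗[k] V)).flip s) (rTensor W Q.Rbarinv t) := by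
    intro s t
    induction s with
    | zero => simp
    | add a b ha hb =>
      simp only [map_add, ha, hb, LinearMap.comp_add, LinearMap.rTensor_add, LinearMap.add_apply]
    | tmul a v =>
    induction t with
    | zero => simp
    | add a b ha hb =>
      simp only [map_add, LinearMap.comp_add, LinearMap.rTensor_add, LinearMap.add_apply,
        ← ha, ← hb]
    | tmul b w => simp [Q.pair_Rbarinv, TensorProduct.smul_tmul']
  have h2 := h1 (δV v) (δW w)
  have h3 : actLeg Q.pair Q.R δV δW (v ⊗ₜ w) = _ := cbr_tmul (leg Q.R δV) (act Q.pair δW) v w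
  simp only [TensorProduct.AlgebraTensorModule.curry_apply, TensorProduct.curry_apply,
    LinearMap.coe_restrictScalars, braid, comp_apply, LinearEquiv.coe_coe, comm_tmul, h3]
  rw [cbr_tmul]
  exact h2

/-- Both crossings use the legs of v, so by coassociativity w is acted on by the convolution product
of g and f at v₍₋₁₎, which is the counit. Taking (f, g) = (R, R⁻¹) or (R⁻¹, R) inverts the braiding
on either side. -/
theorem cbr_comm_cbr {p : H ⊗[k] A →ₗ[k] k} (hp : IsHopfPairing p) {f g : A →ₗ[k] H}
    (hfg : opConv g f = convUnit k A H) (δV : LeftCoaction k A V) (δW : LeftCoaction k A W)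
    (v : V) (w : W) : cbr (leg f δV.coact) (act p δW.coact) (TensorProduct.comm k W V
      (cbr (leg g δV.coact) (act p δW.coact) (v ⊗ₜ w))) = w ⊗ₜ v := by
  have hc := LinearMap.congr_fun δV.coassoc v
  have hu := LinearMap.congr_fun δV.counit v
  have ha := hp.isHAction_act δW
  simp only [comp_apply, LinearEquiv.coe_coe, LinearMap.id_apply] at hc hu
  set a := act p δW.coact
  let Φ : (A ⊗[k] A) ⊗[k] V →ₗ[k] W ⊗[k] V := rTensor V (orbit a w ∘ₗ
    mul' k H ∘ₗ (TensorProduct.comm k H H).toLinearMap ∘ₗ TensorProduct.map g f)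
  have h1 : ∀ t : A ⊗[k] V, cbr (leg f δV.coact) a (TensorProduct.comm k W V
      (rTensor V (orbit a w) (rTensor V g t))) =
      Φ ((TensorProduct.assoc k A A V).symm (lTensor A δV.coact t)) := by
    intro t
    induction t with
    | zero => simp
    | add a b ha hb => simp only [map_add, ha, hb]
    | tmul b v =>
      simp only [rTensor_tmul, comm_tmul, cbr_tmul, leg, comp_apply,
        lTensor_tmul]
      generalize δV.coact v = s
      induction s with
      | zero => simp
      | add a b ha hb => simp only [map_add, tmul_add, ha, hb]
      | tmul c d => simp [Φ, ha.mul]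
  rw [cbr_tmul, show leg g δV.coact v = rTensor V g (δV.coact v) from rfl, h1, ← hc,
    LinearEquiv.symm_apply_apply,
    ← LinearMap.rTensor_comp_apply]
  have h2 : (orbit a w ∘ₗ mul' k H ∘ₗ (TensorProduct.comm k H H).toLinearMap ∘ₗ
      TensorProduct.map g f) ∘ₗ Coalgebra.comul = orbit a w ∘ₗ convUnit k A H := by
    rw [← hfg]; rfl
  rw [h2]
  conv_rhs => rw [← hu]
  generalize δV.coact v = s
  induction s with
  | zero => simp
  | add a b ha hb => simp only [map_add, tmul_add, ha, hb]
  | tmul c d =>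
    simp [convUnit, Algebra.algebraMap_eq_smul_one, ha.one,
      ← TensorProduct.smul_tmul' (Coalgebra.counit c)]

theorem braid_braidInv (δV : LeftCoaction k A V) (δW : LeftCoaction k A W) (t : V ⊗[k] W) :
    braid Q δW.coact δV.coact (braidInv Q δV.coact δW.coact t) = t := by
  induction t with
  | zero => simp
  | add a b ha hb => simp only [map_add, ha, hb]
  | tmul v w =>
    have := cbr_comm_cbr Q.pairing (f := Q.R) (g := Q.Rinv) Q.inverse_R.left_inv δV δW v w
    rw [braid, comp_apply, comp_apply]
    exact congrArg (TensorProduct.comm k W V) this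

theorem braidInv_braid (δV : LeftCoaction k A V) (δW : LeftCoaction k A W) (t : W ⊗[k] V) :
    braidInv Q δV.coact δW.coact (braid Q δW.coact δV.coact t) = t := by
  induction t with
  | zero => simp
  | add a b ha hb => simp only [map_add, ha, hb]
  | tmul w v =>
    exact cbr_comm_cbr Q.pairing (f := Q.Rinv) (g := Q.R) Q.inverse_R.right_inv δV δW v w

/-- The trivial coaction on the ground field. -/
def trivCoact (k A : Type*) [Field k] [Ring A] [HopfAlgebra k A] : k →ₗ[k] A ⊗[k] k :=
  TensorProduct.mk k A k 1

theorem act_trivCoact {p : H ⊗[k] A →ₗ[k] k} (hp : IsHopfPairing p) (h : H) (r : k) :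
    act p (trivCoact k A) (h ⊗ₜ r) = Coalgebra.counit (R := k) h * r := by
  simp [act_tmul, trivCoact, hp.one_right]

/-- A strand crosses the unit object trivially. Together with naturality this lets strands slide
past `ev` and past counits. -/
theorem cbr_trivCoact {p : H ⊗[k] A →ₗ[k] k} (hp : IsHopfPairing p) {ℓ : V →ₗ[k] H ⊗[k] V}
    (hℓ : IsCopCoaction ℓ) (v : V) (r : k) :
    cbr ℓ (act p (trivCoact k A)) (v ⊗ₜ r) = r ⊗ₜ v := by
  rw [cbr_tmul]
  conv_rhs => rw [← hℓ.counit v]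
  generalize ℓ v = s
  induction s with
  | zero => simp
  | add a b ha hb => simp only [map_add, tmul_add, ha, hb]
  | tmul c d =>
    simp only [rTensor_tmul, orbit_apply, act_trivCoact hp, lid_tmul]
    rw [← smul_eq_mul, TensorProduct.smul_tmul]

theorem act_one_of_coinvariant {p : H ⊗[k] A →ₗ[k] k} (hp : IsHopfPairing p)
    {δV : V →ₗ[k] A ⊗[k] V} {v : V} (hv : δV v = 1 ⊗ₜ v) (h : H) :
    act p δV (h ⊗ₜ v) = Coalgebra.counit (R := k) h • v := by
  simp [act_tmul, hv, hp.one_right]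

theorem IsCopBialgMap.leg_of_coinvariant {p : H ⊗[k] A →ₗ[k] k} {f : A →ₗ[k] H}
    (hf : IsCopBialgMap p f) {δV : V →ₗ[k] A ⊗[k] V} {v : V} (hv : δV v = 1 ⊗ₜ v) :
    leg f δV v = 1 ⊗ₜ v := by
  simp [leg, hv, hf.map_one]

end Braid

/-! ### Braidings of comodule algebras are twists. -/

section ComoduleAlgebras

variable {k A H : Type*} [Field k] [Ring A] [HopfAlgebra k A] [Ring H] [HopfAlgebra k H]
  {p : H ⊗[k] A →ₗ[k] k} {B D : Type*} [Ring B] [Algebra k B] [Ring D] [Algebra k D]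

theorem IsComoduleAlgebra.isHLinear_mul {δB : B →ₗ[k] A ⊗[k] B} (hB : IsComoduleAlgebra δB)
    (hp : IsHopfPairing p) :
    IsHLinear (tensAct (act p δB) (act p δB)) (act p δB) (mul' k B) := by
  rw [← hp.act_tensorCoact]
  exact hB.mul_colinear.isHLinear p

theorem IsComoduleAlgebra.leg_mul {δB : B →ₗ[k] A ⊗[k] B} (hB : IsComoduleAlgebra δB)
    {f : A →ₗ[k] H} (hf : IsCopBialgMap p f) (t : B ⊗[k] B) :
    leg f δB (mul' k B t) =
      lTensor H (mul' k B) (tensorCoact (leg f δB) (leg f δB) t) := by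
  rw [← hf.leg_tensorCoact]
  exact hB.mul_colinear.leg f t

theorem isTwist_leg {δB : LeftCoaction k A B} (hB : IsComoduleAlgebra δB.coact)
    {δD : LeftCoaction k A D} (hD : IsComoduleAlgebra δD.coact) (hp : IsHopfPairing p)
    {f : A →ₗ[k] H} (hf : IsCopBialgMap p f) :
    IsTwist (mul' k B) 1 (mul' k D) 1
      (cbr (leg f δD.coact) (act p δB.coact)) :=
  isTwist_cbr (hf.isCopCoaction δD) (hp.isHAction_act δB) (hD.leg_mul hf)
    (hf.leg_of_coinvariant hD.one_coinvariant) (hB.isHLinear_mul hp)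
    (act_one_of_coinvariant hp hB.one_coinvariant)

end ComoduleAlgebras

/-! ### Closure properties of colinear maps. -/

section Colinear

variable {k A : Type*} [Field k] [Ring A] [HopfAlgebra k A]
  {U V W Z : Type*} [AddCommGroup U] [Module k U] [AddCommGroup V] [Module k V]
  [AddCommGroup W] [Module k W] [AddCommGroup Z] [Module k Z]
  {δU : U →ₗ[k] A ⊗[k] U} {δV : V →ₗ[k] A ⊗[k] V} {δW : W →ₗ[k] A ⊗[k] W} {δZ : Z →ₗ[k] A ⊗[k] Z}

theorem IsColinear.comp {g : W →ₗ[k] Z} {f : V →ₗ[k] W} (hg : IsColinear δW δZ g)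
    (hf : IsColinear δV δW f) : IsColinear δV δZ (g ∘ₗ f) := by
  ext v
  have h1 := LinearMap.congr_fun hg (f v)
  have h2 := LinearMap.congr_fun hf v
  simp only [comp_apply] at h1 h2 ⊢
  rw [h1, h2, LinearMap.lTensor_comp_apply]

theorem isColinear_id : IsColinear δV δV LinearMap.id := by
  simp [IsColinear]

theorem IsColinear.map {f : U →ₗ[k] V} {g : W →ₗ[k] Z} (hf : IsColinear δU δV f)
    (hg : IsColinear δW δZ g) :
    IsColinear (tensorCoact δU δW) (tensorCoact δV δZ) (TensorProduct.map f g) := by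
  ext u w
  have h1 := LinearMap.congr_fun hf u
  have h2 := LinearMap.congr_fun hg w
  simp only [tensorCoact, comp_apply, map_tmul, LinearEquiv.coe_coe,
    TensorProduct.AlgebraTensorModule.curry_apply, TensorProduct.curry_apply,
    LinearMap.coe_restrictScalars] at h1 h2 ⊢
  rw [h1, h2]
  generalize δU u = s
  generalize δW w = t
  induction s with
  | zero => simp
  | add a b ha hb => simp only [map_add, add_tmul, ha, hb]
  | tmul a v =>
  induction t with
  | zero => simp
  | add a b ha hb => simp only [map_add, tmul_add, ha, hb]
  | tmul b w => simp

theorem isColinear_assoc : IsColinear (tensorCoact (tensorCoact δU δV) δW)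
    (tensorCoact δU (tensorCoact δV δW)) (TensorProduct.assoc k U V W).toLinearMap := by
  ext u v w
  simp only [tensorCoact, comp_apply, map_tmul, LinearEquiv.coe_coe,
    TensorProduct.AlgebraTensorModule.curry_apply, TensorProduct.curry_apply,
    LinearMap.coe_restrictScalars, assoc_tmul]
  generalize δU u = r
  generalize δV v = s
  generalize δW w = t
  induction r with
  | zero => simp
  | add a b ha hb => simp only [map_add, add_tmul, ha, hb]
  | tmul a v =>
  induction s with
  | zero => simp
  | add a b ha hb => simp only [map_add, add_tmul, tmul_add, ha, hb]
  | tmul b w =>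
  induction t with
  | zero => simp
  | add a b ha hb => simp only [map_add, tmul_add, ha, hb]
  | tmul c x => simp [mul_assoc]

theorem isColinear_rid : IsColinear (tensorCoact δV (trivCoact k A)) δV
    (TensorProduct.rid k V).toLinearMap := by
  ext v
  simp only [tensorCoact, comp_apply, map_tmul, LinearEquiv.coe_coe,
    TensorProduct.AlgebraTensorModule.curry_apply, TensorProduct.curry_apply,
    LinearMap.coe_restrictScalars, rid_tmul, trivCoact, one_smul]
  generalize δV v = s
  induction s with
  | zero => simp
  | add a b ha hb => simp only [map_add, add_tmul, ← ha, ← hb]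
  | tmul b w => simp

end Colinear

/-! ### The right action of B obtained by evaluating the C-coaction. -/

section RightAction

variable {k : Type*} [Field k] {B C D : Type*} [AddCommGroup B] [Module k B]
  [AddCommGroup C] [Module k C] [AddCommGroup D] [Module k D]

/-- The right action `d ⊗ b ↦ d₀ ev(d₁, b)`. -/
def coactEval (ev : C ⊗[k] B →ₗ[k] k) (ρ : D →ₗ[k] D ⊗[k] C) : D ⊗[k] B →ₗ[k] D :=
  (TensorProduct.rid k D).toLinearMap ∘ₗ lTensor D ev ∘ₗ
    (TensorProduct.assoc k D C B).toLinearMap ∘ₗ rTensor B ρ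

theorem coactEval_tmul (ev : C ⊗[k] B →ₗ[k] k) (ρ : D →ₗ[k] D ⊗[k] C) (d : D) (b : B) :
    coactEval ev ρ (d ⊗ₜ b) = TensorProduct.rid k D
      (lTensor D (ev ∘ₗ (TensorProduct.mk k C B).flip b) (ρ d)) := by
  simp only [coactEval, comp_apply, rTensor_tmul, LinearEquiv.coe_coe]
  generalize ρ d = t
  induction t with
  | zero => simp
  | add a b ha hb => simp only [map_add, add_tmul, ha, hb]
  | tmul c d => simp

/-- Contracting ρ d with a tensor in B ⊗ Z is acting on d by its first factor; this turns the
defining formula of T into one for the right action. -/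
theorem contract_coact {Z : Type*} [AddCommGroup Z] [Module k Z] (ev : C ⊗[k] B →ₗ[k] k)
    (ρ : D →ₗ[k] D ⊗[k] C) (d : D) (s : B ⊗[k] Z) :
    contract ev (ρ d ⊗ₜ s) = rTensor Z (coactEval ev ρ)
      ((TensorProduct.assoc k D B Z).symm (d ⊗ₜ s)) := by
  induction s with
  | zero => simp
  | add a b ha hb => simp only [map_add, tmul_add, ha, hb]
  | tmul x y =>
    simp only [assoc_symm_tmul, rTensor_tmul, coactEval_tmul]
    generalize ρ d = t
    induction t with
    | zero => simp
    | add a b ha hb => simp only [map_add, add_tmul, ha, hb]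
    | tmul c d => simp [contract_tmul, TensorProduct.smul_tmul']

end RightAction

/-! ### The antipode-free inverse twist T and the right action of B on D. -/

section Induced

variable {k A H : Type*} [Field k] [Ring A] [HopfAlgebra k A] [Ring H] [HopfAlgebra k H]
  (Q : WeakQuasitriangularPair k A H)
  {B C D : Type*} [Ring B] [Algebra k B] [Coalgebra k B]
  [Ring C] [Algebra k C] [Coalgebra k C] [Ring D] [Algebra k D]

/-- `d ⊗ b ↦ ev(d₁, b₁) Ψ⁻¹ (d₀ ⊗ b₂)`, the inverse of the twisting map of the braided crossed
product. -/
def invTwist (δB : B →ₗ[k] A ⊗[k] B) (δD : D →ₗ[k] A ⊗[k] D) (ev : C ⊗[k] B →ₗ[k] k)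
    (ρ : D →ₗ[k] D ⊗[k] C) : D ⊗[k] B →ₗ[k] B ⊗[k] D :=
  braidInv Q δD δB ∘ₗ contract ev ∘ₗ TensorProduct.map ρ Coalgebra.comul

/-- `d ⊗ (b ⊗ b') ↦ Ψ⁻¹ (d₀ ev(d₁, b) ⊗ b')`. -/
def invTwistAux (δB : B →ₗ[k] A ⊗[k] B) (δD : D →ₗ[k] A ⊗[k] D) (ev : C ⊗[k] B →ₗ[k] k)
    (ρ : D →ₗ[k] D ⊗[k] C) : D ⊗[k] (B ⊗[k] B) →ₗ[k] B ⊗[k] D :=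
  braidInv Q δD δB ∘ₗ rTensor B (coactEval ev ρ) ∘ₗ
    (TensorProduct.assoc k D B B).symm.toLinearMap

theorem invTwist_tmul (δB : B →ₗ[k] A ⊗[k] B) (δD : D →ₗ[k] A ⊗[k] D) (ev : C ⊗[k] B →ₗ[k] k)
    (ρ : D →ₗ[k] D ⊗[k] C) (d : D) (b : B) :
    invTwist Q δB δD ev ρ (d ⊗ₜ b) = invTwistAux Q δB δD ev ρ (d ⊗ₜ Coalgebra.comul b) := by
  simp only [invTwist, invTwistAux, comp_apply, map_tmul,
    contract_coact, LinearEquiv.coe_coe]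

theorem invTwistAux_tmul (δB : B →ₗ[k] A ⊗[k] B) (δD : D →ₗ[k] A ⊗[k] D) (ev : C ⊗[k] B →ₗ[k] k)
    (ρ : D →ₗ[k] D ⊗[k] C) (d : D) (b b' : B) :
    invTwistAux Q δB δD ev ρ (d ⊗ₜ (b ⊗ₜ b')) =
      braidInv Q δD δB (coactEval ev ρ (d ⊗ₜ b) ⊗ₜ b') := by
  simp [invTwistAux]

variable {Q} {δB : LeftCoaction k A B} {δC : LeftCoaction k A C} {δD : LeftCoaction k A D}
  {ev : C ⊗[k] B →ₗ[k] k} {ρ : D →ₗ[k] D ⊗[k] C}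

theorem IsBraidedPairing.isColinear (hev : IsBraidedPairing δC.coact δB.coact ev) :
    IsColinear (tensorCoact δC.coact δB.coact) (trivCoact k A) ev := by
  ext c b
  exact (hev.colinear c b).symm

theorem IsBraidedPairing.isHLinear (hev : IsBraidedPairing δC.coact δB.coact ev)
    {p : H ⊗[k] A →ₗ[k] k} (hp : IsHopfPairing p) :
    IsHLinear (tensAct (act p δC.coact) (act p δB.coact)) (act p (trivCoact k A)) ev := by
  rw [← hp.act_tensorCoact]
  exact hev.isColinear.isHLinear p

theorem coactEval_isColinear (hev : IsBraidedPairing δC.coact δB.coact ev)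
    (hD : IsBraidedRightComoduleAlgebra Q δC.coact δD.coact ρ) :
    IsColinear (tensorCoact δD.coact δB.coact) δD.coact (coactEval ev ρ) :=
  isColinear_rid.comp ((isColinear_id.map hev.isColinear).comp
    (isColinear_assoc.comp (hD.colinear.map isColinear_id)))

/-- The nested convention ev(c, b b') = ev(c₂, b) ev(c₁, b') pairs b with the outer leg of the
iterated coaction, so evaluation gives a right action. -/
theorem coactEval_mul (hev : IsBraidedPairing δC.coact δB.coact ev)
    (hD : IsBraidedRightComoduleAlgebra Q δC.coact δD.coact ρ) (d : D) (b b' : B) :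
    coactEval ev ρ (d ⊗ₜ (b * b')) = coactEval ev ρ (coactEval ev ρ (d ⊗ₜ b) ⊗ₜ b') := by
  have hc := LinearMap.congr_fun hD.coassoc d
  simp only [comp_apply, LinearEquiv.coe_coe] at hc
  let Φ : D ⊗[k] (C ⊗[k] C) →ₗ[k] D := (TensorProduct.rid k D).toLinearMap ∘ₗ
    lTensor D (formSq ev ∘ₗ (TensorProduct.mk k (C ⊗[k] C) (B ⊗[k] B)).flip (b ⊗ₜ b'))
  have h1 : ∀ t : D ⊗[k] C, TensorProduct.rid k D
      (lTensor D (ev ∘ₗ (TensorProduct.mk k C B).flip (b * b')) t) =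
      Φ (lTensor D Coalgebra.comul t) := by
    intro t
    induction t with
    | zero => simp
    | add a b ha hb => simp only [map_add, ha, hb]
    | tmul x c => simp [Φ, hev.mul_right]
  have h2 : ∀ t : D ⊗[k] C, coactEval ev ρ (TensorProduct.rid k D
      (lTensor D (ev ∘ₗ (TensorProduct.mk k C B).flip b) t) ⊗ₜ b') =
      Φ (TensorProduct.assoc k D C C (rTensor C ρ t)) := by
    intro t
    induction t with
    | zero => simp
    | add a b ha hb => simp only [map_add, add_tmul, ha, hb]
    | tmul x c =>
      simp only [lTensor_tmul, rid_tmul, rTensor_tmul,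
        ← TensorProduct.smul_tmul', map_smul, coactEval_tmul]
      generalize ρ x = s
      induction s with
      | zero => simp
      | add a b ha hb => simp only [map_add, add_tmul, smul_add, ha, hb]
      | tmul y z => simp [Φ, formSq_tmul, mul_smul]
  rw [coactEval_tmul, coactEval_tmul (d := d), h1, h2, hc]

theorem coactEval_one (hev : IsBraidedPairing δC.coact δB.coact ev)
    (hD : IsBraidedRightComoduleAlgebra Q δC.coact δD.coact ρ) (d : D) :
    coactEval ev ρ (d ⊗ₜ 1) = d := by
  have h1 : ev ∘ₗ (TensorProduct.mk k C B).flip 1 = Coalgebra.counit := by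
    ext c; exact hev.one_right c
  rw [coactEval_tmul, h1]
  exact LinearMap.congr_fun hD.counit d

theorem coactEval_one_left (hev : IsBraidedPairing δC.coact δB.coact ev)
    (hD : IsBraidedRightComoduleAlgebra Q δC.coact δD.coact ρ) (b : B) :
    coactEval ev ρ (1 ⊗ₜ b) = Coalgebra.counit (R := k) b • (1 : D) := by
  simp [coactEval_tmul, hD.map_one, hev.one_left]

end Induced

/-! ### T is compatible with products, coproducts and units. -/

section Induced

variable {k A H : Type*} [Field k] [Ring A] [HopfAlgebra k A] [Ring H] [HopfAlgebra k H]
  {Q : WeakQuasitriangularPair k A H}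
  {B C D : Type*} [Ring B] [Algebra k B] [Coalgebra k B]
  [Ring C] [Algebra k C] [Coalgebra k C] [Ring D] [Algebra k D]
  {δB : LeftCoaction k A B} {δC : LeftCoaction k A C} {δD : LeftCoaction k A D}
  {ev : C ⊗[k] B →ₗ[k] k} {ρ : D →ₗ[k] D ⊗[k] C}

/-- Sliding a strand under the evaluation. -/
theorem liftR_braidInv_ev (hev : IsBraidedPairing δC.coact δB.coact ev) (c : C) (d : D) (b : B) :
    liftR (braidInv Q δD.coact δB.coact) ev ((c ⊗ₜ d) ⊗ₜ b) = TensorProduct.comm k D k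
      (lTensor D (ev ∘ₗ (TensorProduct.mk k C B).flip b)
        (braid Q δC.coact δD.coact (c ⊗ₜ d))) := by
  have h : ∀ t : D ⊗[k] C,
      liftR (braidInv Q δD.coact δB.coact) ev (braidInv Q δD.coact δC.coact t ⊗ₜ b) =
      TensorProduct.comm k D k
        (lTensor D (ev ∘ₗ (TensorProduct.mk k C B).flip b) t) := by
    intro t
    induction t with
    | zero => simp
    | add a b ha hb => simp only [map_add, add_tmul, ha, hb]
    | tmul x c =>
      -- The hexagon for the strand x crossing c ⊗ b, followed by naturality along `ev`, which is
      -- H-linear into the unit object: crossing both is crossing nothing.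
      rw [braidInv_eq_cbr, braidInv_eq_cbr,
        ← cbr_tensor_right (Q.isCopBialgMap_Rinv.isCopCoaction δD) (hev.isHLinear Q.pairing),
        cbr_trivCoact Q.pairing (Q.isCopBialgMap_Rinv.isCopCoaction δD)]
      rfl
  rw [← h, braidInv_braid]

/-- The right action is colinear, so a strand b' crosses the result of the action by crossing b and
then d. -/
theorem braidInv_coactEval (hev : IsBraidedPairing δC.coact δB.coact ev)
    (hD : IsBraidedRightComoduleAlgebra Q δC.coact δD.coact ρ) (d : D) (b b' : B) :
    braidInv Q δD.coact δB.coact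
      (coactEval ev ρ (d ⊗ₜ b) ⊗ₜ b') = liftL (braidInv Q δD.coact δB.coact) (coactEval ev ρ)
        (d ⊗ₜ braidInv Q δB.coact δB.coact (b ⊗ₜ b')) := by
  refine cbr_tensor_left (Q.pairing.isHAction_act δB) ?_ b'
  rw [← Q.isCopBialgMap_Rinv.leg_tensorCoact]
  exact (coactEval_isColinear hev hD).leg Q.Rinv _

/-- The previous slide with the crossing of the two B-strands undone. It removes the Ψ that
multiplicativity of Δ_B introduces in T(d ⊗ b b'). -/
theorem braidInv_coactEval_braid (hev : IsBraidedPairing δC.coact δB.coact ev)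
    (hD : IsBraidedRightComoduleAlgebra Q δC.coact δD.coact ρ) (d : D) (b b' : B) :
    braidInv Q δD.coact δB.coact (rTensor B
      (coactEval ev ρ ∘ₗ TensorProduct.mk k D B d) (braid Q δB.coact δB.coact (b ⊗ₜ b'))) =
    lTensor B (coactEval ev ρ ∘ₗ (TensorProduct.mk k D B).flip b')
      (braidInv Q δD.coact δB.coact (d ⊗ₜ b)) := by
  have h : ∀ t : B ⊗[k] B, braidInv Q δD.coact δB.coact (rTensor B
      (coactEval ev ρ ∘ₗ TensorProduct.mk k D B d) t) =
      liftL (braidInv Q δD.coact δB.coact) (coactEval ev ρ)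
        (d ⊗ₜ braidInv Q δB.coact δB.coact t) := by
    intro t
    induction t with
    | zero => simp
    | add a b ha hb => simp only [map_add, tmul_add, ha, hb]
    | tmul x y => exact braidInv_coactEval hev hD d x y
  rw [h, braidInv_braid, liftL_tmul]

theorem braidInv_mul_left (hB : IsBraidedBialgebra Q δB.coact)
    (hD : IsBraidedRightComoduleAlgebra Q δC.coact δD.coact ρ) (d d' : D) (b : B) :
    braidInv Q δD.coact δB.coact ((d * d') ⊗ₜ b) = liftL (braidInv Q δD.coact δB.coact)
      (mul' k D) (d ⊗ₜ braidInv Q δD.coact δB.coact (d' ⊗ₜ b)) :=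
  (isTwist_leg hB.algebra hD.algebra Q.pairing Q.isCopBialgMap_Rinv).mul_left d d' b

theorem braidInv_mul_right (hB : IsBraidedBialgebra Q δB.coact)
    (hD : IsBraidedRightComoduleAlgebra Q δC.coact δD.coact ρ) (d : D) (b b' : B) :
    braidInv Q δD.coact δB.coact (d ⊗ₜ (b * b')) = liftR (braidInv Q δD.coact δB.coact)
      (mul' k B) (braidInv Q δD.coact δB.coact (d ⊗ₜ b) ⊗ₜ b') :=
  (isTwist_leg hB.algebra hD.algebra Q.pairing Q.isCopBialgMap_Rinv).mul_right d b b'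

/-- The right action of a product. -/
theorem coactEval_mul_left (hev : IsBraidedPairing δC.coact δB.coact ev)
    (hD : IsBraidedRightComoduleAlgebra Q δC.coact δD.coact ρ) (d d' : D) (b : B) :
    coactEval ev ρ ((d * d') ⊗ₜ b) = mul' k D (rTensor D (coactEval ev ρ)
      ((TensorProduct.assoc k D B D).symm
        (d ⊗ₜ invTwist Q δB.coact δD.coact ev ρ (d' ⊗ₜ b)))) := by
  have hm := LinearMap.congr_fun hD.map_mul (d ⊗ₜ d')
  simp only [comp_apply, LinearMap.mul'_apply, map_tmul] at hm
  have hl : ∀ c c', ev ∘ₗ TensorProduct.mk k C B (c * c') =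
      formSq ev ∘ₗ TensorProduct.mk k (C ⊗[k] C) (B ⊗[k] B) (c ⊗ₜ c') ∘ₗ Coalgebra.comul := by
    intro c c'; ext b; exact hev.mul_left c c' b
  rw [← contract_coact, coactEval_tmul, hm, invTwist, comp_apply, comp_apply,
    map_tmul]
  have hq : ∀ (r : B ⊗[k] B) (x : D) (c : C) (x' : D) (c' : C),
      TensorProduct.rid k D (TensorProduct.map (mul' k D ∘ₗ TensorProduct.mk k D D x)
        (formSq ev ∘ₗ (TensorProduct.mk k (C ⊗[k] C) (B ⊗[k] B)).flip r ∘ₗ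
          (TensorProduct.mk k C C).flip c') (braid Q δC.coact δD.coact (c ⊗ₜ x'))) =
      x * TensorProduct.lid k D (rTensor D (ev ∘ₗ TensorProduct.mk k C B c)
        (braidInv Q δD.coact δB.coact (contract ev ((x' ⊗ₜ c') ⊗ₜ r)))) := by
    intro r x c x' c'
    induction r with
    | zero => simp
    | add a b ha hb =>
      simp only [map_add, tmul_add, mul_add, ← ha, ← hb, LinearMap.add_comp, LinearMap.comp_add,
        TensorProduct.map_add_right, LinearMap.add_apply]
    | tmul b₁ b₂ =>
      -- The crossing of C with D, coming from multiplicativity of ρ, is exchanged for an inverse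
      -- crossing of D with B; that is the one built into T.
      have hS := liftR_braidInv_ev (Q := Q) (δD := δD) hev c x' b₂
      rw [liftR_tmul] at hS
      have hS' : TensorProduct.lid k D (rTensor D (ev ∘ₗ TensorProduct.mk k C B c)
          (braidInv Q δD.coact δB.coact (x' ⊗ₜ b₂))) = TensorProduct.rid k D
          (lTensor D (ev ∘ₗ (TensorProduct.mk k C B).flip b₂)
          (braid Q δC.coact δD.coact (c ⊗ₜ x'))) := by
        rw [hS]
        exact eq_of_tmul (f := (TensorProduct.lid k D).toLinearMap ∘ₗ
          (TensorProduct.comm k D k).toLinearMap) (g := (TensorProduct.rid k D).toLinearMap)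
            (by simp) _
      rw [contract_tmul, map_smul, map_smul, map_smul, hS']
      generalize braid Q δC.coact δD.coact (c ⊗ₜ x') = w
      induction w with
      | zero => simp
      | add a b ha hb => simp only [map_add, smul_add, mul_add, ha, hb]
      | tmul y z => simp [formSq_tmul, mul_smul]
  generalize ρ d = s
  generalize ρ d' = s'
  induction s with
  | zero => simp
  | add a b ha hb => simp only [map_add, add_tmul, ha, hb]
  | tmul x c =>
  induction s' with
  | zero => simp
  | add a b ha hb => simp only [map_add, tmul_add, add_tmul, ha, hb]
  | tmul x' c' =>
    have hr := hq (Coalgebra.comul b) x c x' c'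
    rw [midMap_tmul]
    have h1 : ∀ w : D ⊗[k] C, TensorProduct.rid k D (lTensor D
        (ev ∘ₗ (TensorProduct.mk k C B).flip b) (TensorProduct.map (mul' k D)
          (mul' k C) (TensorProduct.map (TensorProduct.mk k D D x)
            ((TensorProduct.mk k C C).flip c') w))) =
        TensorProduct.rid k D (TensorProduct.map (mul' k D ∘ₗ TensorProduct.mk k D D x)
        (formSq ev ∘ₗ (TensorProduct.mk k (C ⊗[k] C) (B ⊗[k] B)).flip (Coalgebra.comul b) ∘ₗ
          (TensorProduct.mk k C C).flip c') w) := by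
      intro w
      induction w with
      | zero => simp
      | add a b ha hb => simp only [map_add, ha, hb]
      | tmul y z => simp [hev.mul_left]
    rw [h1, hr]
    generalize braidInv Q δD.coact δB.coact
      (contract ev ((x' ⊗ₜ c') ⊗ₜ Coalgebra.comul (R := k) b)) = w
    induction w with
    | zero => simp
    | add a b ha hb => simp only [map_add, tmul_add, mul_add, ha, hb]
    | tmul y z => simp [contract_tmul]

/-- T only uses b₁ for the action, so by coassociativity the coproduct of its B-output splits b₂
alone; Ψ⁻¹ then crosses the two pieces one after the other because Δ_B is H-linear. -/
theorem invTwist_comul (hB : IsBraidedBialgebra Q δB.coact) (d : D) (b : B) :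
    rTensor D Coalgebra.comul (invTwist Q δB.coact δD.coact ev ρ (d ⊗ₜ b)) =
      liftR (braidInv Q δD.coact δB.coact) LinearMap.id (rTensor B
        (invTwist Q δB.coact δD.coact ev ρ ∘ₗ TensorProduct.mk k D B d) (Coalgebra.comul b)) := by
  have hc := Coalgebra.coassoc_apply (R := k) b
  have hl : IsHLinear (act Q.pair δB.coact) (tensAct (act Q.pair δB.coact) (act Q.pair δB.coact))
      (Coalgebra.comul (R := k) (A := B)) := by
    rw [← Q.pairing.act_tensorCoact]
    exact hB.comul_colinear.isHLinear Q.pair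
  have h1 : ∀ s : B ⊗[k] B, rTensor D Coalgebra.comul
      (invTwistAux Q δB.coact δD.coact ev ρ (d ⊗ₜ s)) = liftR (braidInv Q δD.coact δB.coact)
        LinearMap.id (rTensor B (invTwistAux Q δB.coact δD.coact ev ρ ∘ₗ
          TensorProduct.mk k D (B ⊗[k] B) d)
          ((TensorProduct.assoc k B B B).symm (lTensor B Coalgebra.comul s))) := by
    intro s
    induction s with
    | zero => simp
    | add a b ha hb => simp only [map_add, tmul_add, ha, hb]
    | tmul x y =>
      rw [invTwistAux_tmul, braidInv_eq_cbr, ← cbr_map_right _ hl, lTensor_tmul]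
      generalize Coalgebra.comul (R := k) y = r
      induction r with
      | zero => simp
      | add a b ha hb => simp only [map_add, tmul_add, ha, hb]
      | tmul y z =>
        rw [assoc_symm_tmul, rTensor_tmul, comp_apply, TensorProduct.mk_apply,
          invTwistAux_tmul, braidInv_eq_cbr]
        exact cbr_tensor_right (g := LinearMap.id) (Q.isCopBialgMap_Rinv.isCopCoaction δD)
          (isHLinear_id _) _ y z
  rw [invTwist_tmul, h1, ← hc, LinearEquiv.symm_apply_apply, ← LinearMap.rTensor_comp_apply]
  congr 3
  ext x
  simp [invTwist_tmul]

/-- The product d d' is acted on by b₁ through T(d' ⊗ b₁), then crossed by b₂ through the hexagon.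
The right-hand side unfolds to the same expression once the coproduct of the B-output of T(d' ⊗ b)
is known. -/
theorem invTwist_mul_left (hB : IsBraidedBialgebra Q δB.coact)
    (hev : IsBraidedPairing δC.coact δB.coact ev)
    (hD : IsBraidedRightComoduleAlgebra Q δC.coact δD.coact ρ) (d d' : D) (b : B) :
    invTwist Q δB.coact δD.coact ev ρ ((d * d') ⊗ₜ b) = liftL (invTwist Q δB.coact δD.coact ev ρ)
      (mul' k D) (d ⊗ₜ invTwist Q δB.coact δD.coact ev ρ (d' ⊗ₜ b)) := by
  let c := braidInv Q δD.coact δB.coact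
  let T := invTwist Q δB.coact δD.coact ev ρ
  let n := coactEval ev ρ
  -- Ω lets the first B-factor act on d, crosses the second past the result, and multiplies the
  -- D-factors; both sides are Ω of an element of (B ⊗ B) ⊗ D.
  let Ω : (B ⊗[k] B) ⊗[k] D →ₗ[k] B ⊗[k] D := liftL c (mul' k D) ∘ₗ
    rTensor (B ⊗[k] D) (n ∘ₗ TensorProduct.mk k D B d) ∘ₗ
      (TensorProduct.assoc k B B D).toLinearMap
  have h1 : ∀ t : B ⊗[k] D, liftL T (mul' k D) (d ⊗ₜ t) =
      Ω (rTensor D Coalgebra.comul t) := by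
    intro t
    induction t with
    | zero => simp
    | add a b ha hb => simp only [map_add, tmul_add, ha, hb]
    | tmul x y =>
      simp only [liftL_tmul, T, invTwist_tmul, rTensor_tmul]
      generalize Coalgebra.comul (R := k) x = r
      induction r with
      | zero => simp
      | add a b ha hb => simp only [map_add, tmul_add, add_tmul, ha, hb]
      | tmul z w => simp [Ω, invTwistAux_tmul, liftL_tmul, c, n]
  have h2 : ∀ r : B ⊗[k] B, invTwistAux Q δB.coact δD.coact ev ρ ((d * d') ⊗ₜ r) =
      Ω (liftR c LinearMap.id (rTensor B (T ∘ₗ TensorProduct.mk k D B d') r)) := by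
    intro r
    induction r with
    | zero => simp
    | add a b ha hb => simp only [map_add, tmul_add, ha, hb]
    | tmul x y =>
      rw [invTwistAux_tmul, coactEval_mul_left hev hD, rTensor_tmul]
      simp only [comp_apply, TensorProduct.mk_apply, T]
      generalize invTwist Q δB.coact δD.coact ev ρ (d' ⊗ₜ x) = t
      induction t with
      | zero => simp
      | add a b ha hb => simp only [map_add, tmul_add, add_tmul, ha, hb]
      | tmul z w =>
        rw [liftR_tmul, assoc_symm_tmul, rTensor_tmul, LinearMap.mul'_apply,
          braidInv_mul_left hB hD]
        simp only [c]
        generalize braidInv Q δD.coact δB.coact (w ⊗ₜ y) = u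
        induction u with
        | zero => simp
        | add a b ha hb => simp only [map_add, tmul_add, ha, hb]
        | tmul p q => simp [Ω, n, c]
  rw [h1, invTwist_comul hB, invTwist_tmul, h2]

/-- Expanding Δ(b b') yields d · b₁ acted on by part of a crossing of b₂ with b'₁; sliding the
crossing under the action turns this into two successive applications of T. -/
theorem invTwist_mul_right (hB : IsBraidedBialgebra Q δB.coact)
    (hev : IsBraidedPairing δC.coact δB.coact ev)
    (hD : IsBraidedRightComoduleAlgebra Q δC.coact δD.coact ρ) (d : D) (b b' : B) :
    invTwist Q δB.coact δD.coact ev ρ (d ⊗ₜ (b * b')) = liftR (invTwist Q δB.coact δD.coact ev ρ)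
      (mul' k B) (invTwist Q δB.coact δD.coact ev ρ (d ⊗ₜ b) ⊗ₜ b') := by
  have hm := LinearMap.congr_fun hB.comul_mul (b ⊗ₜ b')
  simp only [comp_apply, LinearMap.mul'_apply, map_tmul] at hm
  have h1 : ∀ t : B ⊗[k] D, liftR (invTwist Q δB.coact δD.coact ev ρ) (mul' k B)
      (t ⊗ₜ b') = liftR (invTwistAux Q δB.coact δD.coact ev ρ) (mul' k B)
      (t ⊗ₜ Coalgebra.comul b') := by
    intro t
    induction t with
    | zero => simp
    | add a b ha hb => simp only [map_add, add_tmul, ha, hb]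
    | tmul x y => simp only [liftR_tmul, invTwist_tmul]
  rw [h1, invTwist_tmul, invTwist_tmul, hm]
  generalize Coalgebra.comul (R := k) b = s
  generalize Coalgebra.comul (R := k) b' = s'
  induction s with
  | zero => simp
  | add a b ha hb => simp only [map_add, tmul_add, add_tmul, ha, hb]
  | tmul b₁ b₂ =>
  induction s' with
  | zero => simp
  | add a b ha hb => simp only [map_add, tmul_add, ha, hb]
  | tmul c₁ c₂ =>
    have h2 : ∀ w : B ⊗[k] B, invTwistAux Q δB.coact δD.coact ev ρ (d ⊗ₜ
        TensorProduct.map (mul' k B) (mul' k B) (TensorProduct.map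
          (TensorProduct.mk k B B b₁) ((TensorProduct.mk k B B).flip c₂) w)) =
        liftR (braidInv Q δD.coact δB.coact) (mul' k B) (braidInv Q δD.coact δB.coact
          (rTensor B (coactEval ev ρ ∘ₗ
            TensorProduct.mk k D B (coactEval ev ρ (d ⊗ₜ b₁))) w) ⊗ₜ c₂) := by
      intro w
      induction w with
      | zero => simp
      | add a b ha hb => simp only [map_add, tmul_add, add_tmul, ha, hb]
      | tmul x y =>
        simp only [map_tmul, TensorProduct.mk_apply, LinearMap.flip_apply,
          LinearMap.mul'_apply, invTwistAux_tmul, coactEval_mul hev hD, braidInv_mul_right hB hD,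
          rTensor_tmul, comp_apply]
    rw [midMap_tmul, h2, braidInv_coactEval_braid hev hD, invTwistAux_tmul]
    generalize braidInv Q δD.coact δB.coact (coactEval ev ρ (d ⊗ₜ b₁) ⊗ₜ b₂) = t
    induction t with
    | zero => simp
    | add a b ha hb => simp only [map_add, add_tmul, ha, hb]
    | tmul x y => simp [liftR_tmul, invTwistAux_tmul]

theorem isTwist_invTwist (hB : IsBraidedBialgebra Q δB.coact)
    (hev : IsBraidedPairing δC.coact δB.coact ev)
    (hD : IsBraidedRightComoduleAlgebra Q δC.coact δD.coact ρ) :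
    IsTwist (mul' k B) 1 (mul' k D) 1
      (invTwist Q δB.coact δD.coact ev ρ) where
  mul_left := invTwist_mul_left hB hev hD
  mul_right := invTwist_mul_right hB hev hD
  one_left b := by
    have h := isTwist_leg hB.algebra hD.algebra Q.pairing Q.isCopBialgMap_Rinv
    rw [invTwist_tmul]
    conv_rhs => rw [← one_smul k b, ← TensorProduct.lid_tmul,
      ← Coalgebra.rTensor_counit_comul (R := k) b]
    generalize Coalgebra.comul (R := k) b = s
    induction s with
    | zero => simp
    | add a b ha hb => simp only [map_add, tmul_add, add_tmul, ha, hb]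
    | tmul x y =>
      rw [invTwistAux_tmul, coactEval_one_left hev hD, ← TensorProduct.smul_tmul', map_smul,
        braidInv_eq_cbr, h.one_left]
      simp [TensorProduct.smul_tmul']
  one_right d := by
    have h := isTwist_leg hB.algebra hD.algebra Q.pairing Q.isCopBialgMap_Rinv
    rw [invTwist_tmul, hB.comul_one, invTwistAux_tmul, coactEval_one hev hD, braidInv_eq_cbr,
      h.one_right]

/-! ### The crossed product -/

/-- The twisting map of the crossed product is `d ⊗ b ↦ d₀ ev(d₁, S b₁) ⊗ b₂` after the
braiding. -/
theorem crossTwist_inducedAction (hB : IsBraidedBialgebra Q δB.coact) {S : B →ₗ[k] B}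
    (hS : IsBraidedAntipode δB.coact S) (b : B) (d : D) :
    crossTwist Q δB.coact δD.coact (inducedAction Q δB.coact S ev δD.coact ρ) (b ⊗ₜ d) =
      rTensor B (coactEval ev ρ) ((TensorProduct.assoc k D B B).symm
        (lTensor D (rTensor B S ∘ₗ Coalgebra.comul)
          (braid Q δB.coact δD.coact (b ⊗ₜ d)))) := by
  have hcol := hB.comul_colinear.leg Q.Rbarinv b
  rw [Q.isCopBialgMap_Rbarinv.leg_tensorCoact] at hcol
  have h1 : lTensor D Coalgebra.comul (braid Q δB.coact δD.coact (b ⊗ₜ d)) =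
      cbr (tensorCoact (leg Q.Rbarinv δB.coact) (leg Q.Rbarinv δB.coact)) (act Q.pair δD.coact)
        (Coalgebra.comul b ⊗ₜ d) := by
    rw [braid_eq_cbr, ← cbr_map_left _ hcol]
  rw [LinearMap.lTensor_comp_apply, h1]
  simp only [crossTwist, comp_apply, rTensor_tmul, LinearEquiv.coe_coe]
  generalize Coalgebra.comul (R := k) b = s
  induction s with
  | zero => simp
  | add a b ha hb => simp only [map_add, add_tmul, ha, hb]
  | tmul x y =>
    have h2 := cbr_tensor_left (f := LinearMap.id) (x := x) (x' := y)
      (ℓ := leg Q.Rbarinv δB.coact) (ℓ' := leg Q.Rbarinv δB.coact)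
      (ℓ'' := tensorCoact (leg Q.Rbarinv δB.coact) (leg Q.Rbarinv δB.coact))
      (Q.pairing.isHAction_act δD) (by simp) d
    rw [LinearMap.id_apply] at h2
    rw [h2, assoc_tmul, lTensor_tmul, ← braid_eq_cbr]
    generalize braid Q δB.coact δD.coact (y ⊗ₜ d) = t
    induction t with
    | zero => simp
    | add a b ha hb => simp only [map_add, tmul_add, ha, hb]
    | tmul z w =>
      have h3 : braid Q δB.coact δD.coact (S x ⊗ₜ z) =
          lTensor D S (braid Q δB.coact δD.coact (x ⊗ₜ z)) := by
        rw [braid_eq_cbr]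
        exact cbr_map_left _ (hS.colinear.leg Q.Rbarinv x) z
      rw [show inducedAction Q δB.coact S ev δD.coact ρ = coactEval ev ρ ∘ₗ
        braid Q δB.coact δD.coact ∘ₗ rTensor D S from rfl]
      simp only [assoc_symm_tmul, rTensor_tmul, comp_apply,
        liftL_tmul, h3]
      generalize braid Q δB.coact δD.coact (x ⊗ₜ z) = t
      induction t with
      | zero => simp
      | add a b ha hb => simp only [map_add, add_tmul, ha, hb]
      | tmul p q => simp

end Induced

/-! ### The crossed product twist, the module algebra D, and the smash product with H. -/

section CrossedProduct

variable {k A H : Type*} [Field k] [Ring A] [HopfAlgebra k A] [Ring H] [HopfAlgebra k H]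
  {Q : WeakQuasitriangularPair k A H}
  {B C D : Type*} [Ring B] [Algebra k B] [Coalgebra k B]
  [Ring C] [Algebra k C] [Coalgebra k C] [Ring D] [Algebra k D]
  {δB : LeftCoaction k A B} {δC : LeftCoaction k A C} {δD : LeftCoaction k A D}
  {ev : C ⊗[k] B →ₗ[k] k} {ρ : D →ₗ[k] D ⊗[k] C}

/-- Write N_f(d ⊗ b) = d · f(b₁) ⊗ b₂. Coassociativity and the action law give N_g N_f = N_{f * g},
which is the identity when f * g is the convolution unit. -/
theorem rTensor_coactEval_comp (hev : IsBraidedPairing δC.coact δB.coact ev)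
    (hD : IsBraidedRightComoduleAlgebra Q δC.coact δD.coact ρ) {f g : B →ₗ[k] B}
    (hfg : mul' k B ∘ₗ TensorProduct.map f g ∘ₗ Coalgebra.comul =
      Algebra.linearMap k B ∘ₗ Coalgebra.counit) (t : D ⊗[k] B) :
    rTensor B (coactEval ev ρ) ((TensorProduct.assoc k D B B).symm
      (lTensor D (rTensor B g ∘ₗ Coalgebra.comul)
        (rTensor B (coactEval ev ρ) ((TensorProduct.assoc k D B B).symm
          (lTensor D (rTensor B f ∘ₗ Coalgebra.comul) t))))) = t := by
  induction t with
  | zero => simp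
  | add a b ha hb => simp only [map_add, ha, hb]
  | tmul d b =>
    have hc := Coalgebra.coassoc_apply (R := k) b
    have h1 : ∀ s : B ⊗[k] B, rTensor B (coactEval ev ρ)
        ((TensorProduct.assoc k D B B).symm (lTensor D
          (rTensor B g ∘ₗ Coalgebra.comul) (rTensor B (coactEval ev ρ)
            ((TensorProduct.assoc k D B B).symm (d ⊗ₜ rTensor B f s))))) =
        rTensor B (coactEval ev ρ ∘ₗ TensorProduct.mk k D B d ∘ₗ
          mul' k B ∘ₗ TensorProduct.map f g)
          ((TensorProduct.assoc k B B B).symm (lTensor B Coalgebra.comul s)) := by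
      intro s
      induction s with
      | zero => simp
      | add a b ha hb => simp only [map_add, tmul_add, ha, hb]
      | tmul x y =>
        simp only [rTensor_tmul, assoc_symm_tmul, lTensor_tmul,
          comp_apply]
        generalize Coalgebra.comul (R := k) y = r
        induction r with
        | zero => simp
        | add a b ha hb => simp only [map_add, tmul_add, ha, hb]
        | tmul z w => simp [coactEval_mul hev hD]
    rw [lTensor_tmul, comp_apply, h1, ← hc, LinearEquiv.symm_apply_apply,
      ← LinearMap.rTensor_comp_apply]
    have h2 : (coactEval ev ρ ∘ₗ TensorProduct.mk k D B d ∘ₗ mul' k B ∘ₗ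
        TensorProduct.map f g) ∘ₗ Coalgebra.comul = coactEval ev ρ ∘ₗ TensorProduct.mk k D B d ∘ₗ
          (Algebra.linearMap k B ∘ₗ Coalgebra.counit) := by
      rw [← hfg]; rfl
    have h3 := Coalgebra.rTensor_counit_comul (R := k) b
    rw [h2, ← LinearMap.comp_assoc, ← LinearMap.comp_assoc, LinearMap.rTensor_comp_apply, h3]
    simp [coactEval_one hev hD]

/-- The crossed product twist is N_S ∘ Ψ and T is Ψ⁻¹ ∘ N_id, in the notation N_f(d ⊗ b) = d · f(b₁)
⊗ b₂; so one antipode axiom gives this composite and the other gives the opposite one. -/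
theorem crossTwist_invTwist (hB : IsBraidedBialgebra Q δB.coact)
    (hev : IsBraidedPairing δC.coact δB.coact ev)
    (hD : IsBraidedRightComoduleAlgebra Q δC.coact δD.coact ρ) {S : B →ₗ[k] B}
    (hS : IsBraidedAntipode δB.coact S) (t : D ⊗[k] B) :
    crossTwist Q δB.coact δD.coact (inducedAction Q δB.coact S ev δD.coact ρ)
      (invTwist Q δB.coact δD.coact ev ρ t) = t := by
  have h1 : ∀ t, crossTwist Q δB.coact δD.coact (inducedAction Q δB.coact S ev δD.coact ρ) t =
      rTensor B (coactEval ev ρ) ((TensorProduct.assoc k D B B).symm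
        (lTensor D (rTensor B S ∘ₗ Coalgebra.comul)
          (braid Q δB.coact δD.coact t))) := by
    intro t
    induction t with
    | zero => simp
    | add a b ha hb => simp only [map_add, ha, hb]
    | tmul b d => exact crossTwist_inducedAction hB hS b d
  have h2 : invTwist Q δB.coact δD.coact ev ρ t = braidInv Q δD.coact δB.coact
      (rTensor B (coactEval ev ρ) ((TensorProduct.assoc k D B B).symm
        (lTensor D (rTensor B LinearMap.id ∘ₗ Coalgebra.comul) t))) := by
    induction t with
    | zero => simp
    | add a b ha hb => simp only [map_add, ha, hb]
    | tmul d b => simp [invTwist_tmul, invTwistAux]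
  rw [h1, h2, braid_braidInv]
  exact rTensor_coactEval_comp hev hD hS.mul_id_left t

theorem invTwist_crossTwist (hB : IsBraidedBialgebra Q δB.coact)
    (hev : IsBraidedPairing δC.coact δB.coact ev)
    (hD : IsBraidedRightComoduleAlgebra Q δC.coact δD.coact ρ) {S : B →ₗ[k] B}
    (hS : IsBraidedAntipode δB.coact S) (t : B ⊗[k] D) :
    invTwist Q δB.coact δD.coact ev ρ (crossTwist Q δB.coact δD.coact
      (inducedAction Q δB.coact S ev δD.coact ρ) t) = t := by
  have h2 : ∀ t, invTwist Q δB.coact δD.coact ev ρ t = braidInv Q δD.coact δB.coact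
      (rTensor B (coactEval ev ρ) ((TensorProduct.assoc k D B B).symm
        (lTensor D (rTensor B LinearMap.id ∘ₗ Coalgebra.comul) t))) := by
    intro t
    induction t with
    | zero => simp
    | add a b ha hb => simp only [map_add, ha, hb]
    | tmul d b => simp [invTwist_tmul, invTwistAux]
  induction t with
  | zero => simp
  | add a b ha hb => simp only [map_add, ha, hb]
  | tmul b d =>
    rw [crossTwist_inducedAction hB hS, h2, rTensor_coactEval_comp hev hD hS.mul_id_right,
      braidInv_braid]

/-- The antipode enters only as the inverse of T, so no multiplicativity property of S has to be
established. -/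
theorem isTwist_crossTwist (hB : IsBraidedBialgebra Q δB.coact)
    (hev : IsBraidedPairing δC.coact δB.coact ev)
    (hD : IsBraidedRightComoduleAlgebra Q δC.coact δD.coact ρ) {S : B →ₗ[k] B}
    (hS : IsBraidedAntipode δB.coact S) :
    IsTwist (mul' k D) 1 (mul' k B) 1
      (crossTwist Q δB.coact δD.coact (inducedAction Q δB.coact S ev δD.coact ρ)) :=
  (isTwist_invTwist hB hev hD).of_inverse (crossTwist_invTwist hB hev hD hS)
    (invTwist_crossTwist hB hev hD hS)

theorem isAlgebraProduct_mul' (k B : Type*) [Field k] [Ring B] [Algebra k B] :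
    IsAlgebraProduct (mul' k B) 1 where
  assoc x y z := by simp [mul_assoc]
  one_mul x := by simp
  mul_one x := by simp

theorem IsBraidedBialgebra.isColinear_counit (hB : IsBraidedBialgebra Q δB.coact) :
    IsColinear δB.coact (trivCoact k A) Coalgebra.counit := by
  ext b
  exact (hB.counit_colinear b).symm

theorem counit_braid (hB : IsBraidedBialgebra Q δB.coact) (b : B) (d : D) :
    lTensor D Coalgebra.counit (braid Q δB.coact δD.coact (b ⊗ₜ d)) =
      d ⊗ₜ (Coalgebra.counit b : k) := by
  rw [braid_eq_cbr, ← cbr_map_left _ (hB.isColinear_counit.leg Q.Rbarinv b), cbr_tmul]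
  simp [leg, trivCoact, Q.isCopBialgMap_Rbarinv.map_one, (Q.pairing.isHAction_act δD).one]

/-- The counit of B is colinear and hence passes through Ψ, leaving α(b₁ ε(b₂) ⊗ d). The action can
therefore be read off from the twist. -/
theorem counit_crossTwist (hB : IsBraidedBialgebra Q δB.coact) (α : B ⊗[k] D →ₗ[k] D)
    (t : B ⊗[k] D) : TensorProduct.rid k D (lTensor D Coalgebra.counit
      (crossTwist Q δB.coact δD.coact α t)) = α t := by
  induction t with
  | zero => simp
  | add a b ha hb => simp only [map_add, ha, hb]
  | tmul b d =>
    have h := Coalgebra.lTensor_counit_comul (R := k) b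
    have hb : α (b ⊗ₜ d) = α (TensorProduct.rid k B (b ⊗ₜ (1 : k)) ⊗ₜ d) := by simp
    rw [hb, ← h]
    simp only [crossTwist, comp_apply, rTensor_tmul, LinearEquiv.coe_coe]
    generalize Coalgebra.comul (R := k) b = s
    induction s with
    | zero => simp
    | add a b ha hb => simp only [map_add, add_tmul, ha, hb]
    | tmul x y =>
      have h1 : ∀ t : D ⊗[k] B, TensorProduct.rid k D (lTensor D Coalgebra.counit
          (rTensor B α ((TensorProduct.assoc k B D B).symm (x ⊗ₜ t)))) =
          α (x ⊗ₜ TensorProduct.rid k D (lTensor D Coalgebra.counit t)) := by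
        intro t
        induction t with
        | zero => simp
        | add a b ha hb => simp only [map_add, tmul_add, ha, hb]
        | tmul p q => simp
      rw [assoc_tmul, lTensor_tmul, h1, counit_braid hB]
      simp [TensorProduct.smul_tmul]

theorem IsCopBialgMap.isHLinear_cbr {p : H ⊗[k] A →ₗ[k] k} (hp : IsHopfPairing p) {f : A →ₗ[k] H}
    (hf : IsCopBialgMap p f) (δB : LeftCoaction k A B) (δD : LeftCoaction k A D) :
    IsHLinear (tensAct (act p δB.coact) (act p δD.coact)) (tensAct (act p δD.coact)
      (act p δB.coact)) (cbr (leg f δB.coact) (act p δD.coact)) :=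
  (hf.isYetterDrinfeld δB).isHLinear_cbr (hp.isHAction_act δD)

theorem isHLinear_braid : IsHLinear (tensAct (act Q.pair δB.coact) (act Q.pair δD.coact))
    (tensAct (act Q.pair δD.coact) (act Q.pair δB.coact)) (braid Q δB.coact δD.coact) := by
  rw [braid_eq_cbr]
  exact Q.isCopBialgMap_Rbarinv.isHLinear_cbr Q.pairing δB δD

theorem isHLinear_inducedAction (hev : IsBraidedPairing δC.coact δB.coact ev)
    (hD : IsBraidedRightComoduleAlgebra Q δC.coact δD.coact ρ) {S : B →ₗ[k] B}
    (hS : IsBraidedAntipode δB.coact S) :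
    IsHLinear (tensAct (act Q.pair δB.coact) (act Q.pair δD.coact)) (act Q.pair δD.coact)
      (inducedAction Q δB.coact S ev δD.coact ρ) := by
  have h1 := (coactEval_isColinear hev hD).isHLinear Q.pair
  rw [Q.pairing.act_tensorCoact] at h1
  exact h1.comp (isHLinear_braid.comp ((hS.colinear.isHLinear Q.pair).rTensor))

/-- Δ_B, Ψ and the action are all H-linear; this is what makes the product of D ⋊ B H-linear, so
that H can be adjoined. -/
theorem isHLinear_crossTwist (hB : IsBraidedBialgebra Q δB.coact) {α : B ⊗[k] D →ₗ[k] D}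
    (hα : IsHLinear (tensAct (act Q.pair δB.coact) (act Q.pair δD.coact)) (act Q.pair δD.coact) α) :
    IsHLinear (tensAct (act Q.pair δB.coact) (act Q.pair δD.coact))
      (tensAct (act Q.pair δD.coact) (act Q.pair δB.coact))
      (crossTwist Q δB.coact δD.coact α) := by
  have h1 := hB.comul_colinear.isHLinear Q.pair
  rw [Q.pairing.act_tensorCoact] at h1
  exact hα.rTensor.comp ((isHLinear_assoc _ _ _).symm.comp (isHLinear_braid.lTensor.comp
    ((isHLinear_assoc _ _ _).comp h1.rTensor)))

theorem isHLinear_crossMul (hB : IsBraidedBialgebra Q δB.coact)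
    (hD : IsComoduleAlgebra δD.coact) {α : B ⊗[k] D →ₗ[k] D}
    (hα : IsHLinear (tensAct (act Q.pair δB.coact) (act Q.pair δD.coact)) (act Q.pair δD.coact) α) :
    IsHLinear (tensAct (act Q.pair (tensorCoact δD.coact δB.coact))
      (act Q.pair (tensorCoact δD.coact δB.coact))) (act Q.pair (tensorCoact δD.coact δB.coact))
      (crossMul Q δB.coact δD.coact α) := by
  rw [Q.pairing.act_tensorCoact]
  exact ((hD.isHLinear_mul Q.pairing).map (hB.algebra.isHLinear_mul Q.pairing)).comp
    (isHLinear_crossTwist hB hα).midMap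

theorem cop_mul' (t : H ⊗[k] H) : cop k H (mul' k H t) =
    lTensor H (mul' k H) (tensorCoact (cop k H) (cop k H) t) := by
  induction t with
  | zero => simp
  | add a b ha hb => simp only [map_add, ha, hb]
  | tmul x y =>
    rw [LinearMap.mul'_apply, cop_mul, tensorCoact_tmul]
    generalize cop k H x = s
    generalize cop k H y = t
    induction s with
    | zero => simp
    | add a b ha hb => simp only [map_add, add_tmul, add_mul, ha, hb]
    | tmul a v =>
    induction t with
    | zero => simp
    | add a b ha hb => simp only [map_add, tmul_add, mul_add, ha, hb]
    | tmul b w => simp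

theorem isTwist_smashTwist {V : Type*} [AddCommGroup V] [Module k V] {δV : V →ₗ[k] A ⊗[k] V}
    {m : V ⊗[k] V →ₗ[k] V} {e : V} (ha : IsHAction (act Q.pair δV))
    (hm : IsHLinear (tensAct (act Q.pair δV) (act Q.pair δV)) (act Q.pair δV) m)
    (he : δV e = 1 ⊗ₜ e) :
    IsTwist m e (mul' k H) 1 (smashTwist Q.pair δV) :=
  isTwist_cbr isCopCoaction_cop ha cop_mul' cop_one hm (act_one_of_coinvariant Q.pairing he)

/-- Each action axiom is a twist axiom of the crossed product with the counit of B applied to the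
B-factor. -/
theorem isBraidedModuleAlgebra_inducedAction (hB : IsBraidedBialgebra Q δB.coact)
    (hev : IsBraidedPairing δC.coact δB.coact ev)
    (hD : IsBraidedRightComoduleAlgebra Q δC.coact δD.coact ρ) {S : B →ₗ[k] B}
    (hS : IsBraidedAntipode δB.coact S) :
    IsBraidedModuleAlgebra Q δB.coact δD.coact (inducedAction Q δB.coact S ev δD.coact ρ) := by
  have hτ := isTwist_crossTwist hB hev hD hS
  have hε := counit_crossTwist (δD := δD) hB (inducedAction Q δB.coact S ev δD.coact ρ)
  have hl := isHLinear_inducedAction hev hD hS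
  -- From here on only the twist axioms, recovery by the counit and H-linearity are used, not the
  -- formula for α.
  generalize inducedAction Q δB.coact S ev δD.coact ρ = α at *
  refine ⟨?_, ?_, ?_, ?_, ?_⟩
  · rw [Q.pairing.act_tensorCoact]
    exact TensorProduct.ext' hl
  · intro b b' d
    rw [← hε, ← LinearMap.mul'_apply (R := k), hτ.mul_left, ← hε (b' ⊗ₜ d)]
    generalize crossTwist Q δB.coact δD.coact α (b' ⊗ₜ d) = t
    induction t with
    | zero => simp
    | add a b ha hb => simp only [map_add, tmul_add, ha, hb]
    | tmul p q =>
      rw [liftL_tmul, lTensor_tmul, rid_tmul, TensorProduct.tmul_smul, map_smul,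
        ← hε (b ⊗ₜ p)]
      generalize crossTwist Q δB.coact δD.coact α (b ⊗ₜ p) = t
      induction t with
      | zero => simp
      | add a b ha hb => simp only [map_add, smul_add, ha, hb]
      | tmul x y => simp [hB.counit_mul, mul_comm, mul_smul]
  · intro d
    rw [← hε, hτ.one_left]
    simp [hB.counit_one]
  · intro b d d'
    rw [← hε, ← LinearMap.mul'_apply (R := k), hτ.mul_right]
    generalize crossTwist Q δB.coact δD.coact α (b ⊗ₜ d) = t
    induction t with
    | zero => simp
    | add a b ha hb => simp only [map_add, add_tmul, ha, hb]
    | tmul p q =>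
      rw [liftR_tmul, assoc_tmul, lTensor_tmul, ← hε (q ⊗ₜ d')]
      generalize crossTwist Q δB.coact δD.coact α (q ⊗ₜ d') = t
      induction t with
      | zero => simp
      | add a b ha hb => simp only [map_add, tmul_add, ha, hb]
      | tmul x y => simp
  · intro b
    rw [← hε, hτ.one_right]
    simp [Algebra.algebraMap_eq_smul_one]

theorem isAlgebraProduct_crossMul (hB : IsBraidedBialgebra Q δB.coact)
    (hev : IsBraidedPairing δC.coact δB.coact ev)
    (hD : IsBraidedRightComoduleAlgebra Q δC.coact δD.coact ρ) {S : B →ₗ[k] B}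
    (hS : IsBraidedAntipode δB.coact S) :
    IsAlgebraProduct (crossMul Q δB.coact δD.coact (inducedAction Q δB.coact S ev δD.coact ρ))
      (1 ⊗ₜ 1) :=
  (isTwist_crossTwist hB hev hD hS).isAlgebraProduct (isAlgebraProduct_mul' k D)
    (isAlgebraProduct_mul' k B)

theorem isTwist_crossSmash (hB : IsBraidedBialgebra Q δB.coact)
    (hev : IsBraidedPairing δC.coact δB.coact ev)
    (hD : IsBraidedRightComoduleAlgebra Q δC.coact δD.coact ρ) {S : B →ₗ[k] B}
    (hS : IsBraidedAntipode δB.coact S) :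
    IsTwist (crossMul Q δB.coact δD.coact (inducedAction Q δB.coact S ev δD.coact ρ)) (1 ⊗ₜ 1)
      (mul' k H) 1 (smashTwist Q.pair (tensorCoact δD.coact δB.coact)) := by
  refine isTwist_smashTwist ?_
    (isHLinear_crossMul hB hD.algebra (isHLinear_inducedAction hev hD hS)) ?_
  · rw [Q.pairing.act_tensorCoact]
    exact isHAction_tensAct (Q.pairing.isHAction_act δD) (Q.pairing.isHAction_act δB)
  · simp [tensorCoact, hD.algebra.one_coinvariant, hB.algebra.one_coinvariant]

theorem isAlgebraProduct_crossSmashMul (hB : IsBraidedBialgebra Q δB.coact)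
    (hev : IsBraidedPairing δC.coact δB.coact ev)
    (hD : IsBraidedRightComoduleAlgebra Q δC.coact δD.coact ρ) {S : B →ₗ[k] B}
    (hS : IsBraidedAntipode δB.coact S) :
    IsAlgebraProduct (crossSmashMul Q δB.coact δD.coact
      (inducedAction Q δB.coact S ev δD.coact ρ)) ((1 ⊗ₜ 1) ⊗ₜ 1) :=
  (isTwist_crossSmash hB hev hD hS).isAlgebraProduct (isAlgebraProduct_crossMul hB hev hD hS)
    (isAlgebraProduct_mul' k H)

end CrossedProduct

/-! ### Exchange relations and algebra maps out of twisted products. -/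

section TwistRelations

variable {k : Type*} [Field k] {M N V W Z : Type*} [Ring M] [Algebra k M] [Ring N] [Algebra k N]
  [AddCommGroup V] [Module k V] [AddCommGroup W] [Module k W] [AddCommGroup Z] [Module k Z]

/-- `v ⊗ w ↦ f v * g w`. -/
def pr (f : V →ₗ[k] M) (g : W →ₗ[k] M) : V ⊗[k] W →ₗ[k] M :=
  mul' k M ∘ₗ TensorProduct.map f g

@[simp] theorem pr_tmul (f : V →ₗ[k] M) (g : W →ₗ[k] M) (v : V) (w : W) :
    pr f g (v ⊗ₜ w) = f v * g w := by simp [pr]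

theorem pr_map {V' W' : Type*} [AddCommGroup V'] [Module k V'] [AddCommGroup W'] [Module k W']
    (f : V →ₗ[k] M) (g : W →ₗ[k] M) (φ : V' →ₗ[k] V) (ψ : W' →ₗ[k] W) (t : V' ⊗[k] W') :
    pr f g (TensorProduct.map φ ψ t) = pr (f ∘ₗ φ) (g ∘ₗ ψ) t := by
  simp [pr, TensorProduct.map_map]

theorem algHom_pr (φ : M →ₐ[k] N) (f : V →ₗ[k] M) (g : W →ₗ[k] M) (t : V ⊗[k] W) :
    φ (pr f g t) = pr (φ.toLinearMap ∘ₗ f) (φ.toLinearMap ∘ₗ g) t := by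
  induction t with
  | zero => simp
  | add a b ha hb => simp only [map_add, ha, hb]
  | tmul v w => simp

/-- `f` is multiplicative and unital, for the product `m` with unit `e` on its domain. -/
structure IsAlgMap (m : V ⊗[k] V →ₗ[k] V) (e : V) (f : V →ₗ[k] M) : Prop where
  map_mul : ∀ x y, f (m (x ⊗ₜ y)) = f x * f y
  map_one : f e = 1

/-- The values of `g` and `f` are exchanged by the twisting map `τ`. -/
def TwistRel (f : V →ₗ[k] M) (g : W →ₗ[k] M) (τ : W ⊗[k] V →ₗ[k] V ⊗[k] W) : Prop :=
  ∀ w v, g w * f v = pr f g (τ (w ⊗ₜ v))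

theorem TwistRel.pr_eq {f : V →ₗ[k] M} {g : W →ₗ[k] M} {τ : W ⊗[k] V →ₗ[k] V ⊗[k] W}
    (h : TwistRel f g τ) (t : W ⊗[k] V) : pr g f t = pr f g (τ t) := by
  induction t with
  | zero => simp
  | add a b ha hb => simp only [map_add, ha, hb]
  | tmul w v => rw [pr_tmul, h]

theorem TwistRel.inv {f : V →ₗ[k] M} {g : W →ₗ[k] M} {τ : W ⊗[k] V →ₗ[k] V ⊗[k] W}
    (h : TwistRel f g τ) {T : V ⊗[k] W →ₗ[k] W ⊗[k] V} (hT : ∀ t, τ (T t) = t) :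
    TwistRel g f T := fun v w => by
  rw [h.pr_eq, hT, pr_tmul]

theorem TwistRel.algHom_comp {f : V →ₗ[k] M} {g : W →ₗ[k] M} {τ : W ⊗[k] V →ₗ[k] V ⊗[k] W}
    (h : TwistRel f g τ) (φ : M →ₐ[k] N) :
    TwistRel (φ.toLinearMap ∘ₗ f) (φ.toLinearMap ∘ₗ g) τ := fun w v => by
  rw [← algHom_pr, ← h w v]; simp

theorem IsAlgMap.algHom_comp {m : V ⊗[k] V →ₗ[k] V} {e : V} {f : V →ₗ[k] M} (hf : IsAlgMap m e f)
    (φ : M →ₐ[k] N) : IsAlgMap m e (φ.toLinearMap ∘ₗ f) where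
  map_mul x y := by simp [hf.map_mul]
  map_one := by simp [hf.map_one]

/-- The only reordering needed in f v g w f v' g w' is that of g w with f v', which the exchange
relation supplies. This is the universal property by which coactions are constructed below. -/
theorem TwistRel.isAlgMap_pr {f : V →ₗ[k] M} {g : W →ₗ[k] M} {τ : W ⊗[k] V →ₗ[k] V ⊗[k] W}
    (h : TwistRel f g τ) {mV : V ⊗[k] V →ₗ[k] V} {eV : V} {mW : W ⊗[k] W →ₗ[k] W} {eW : W}
    (hf : IsAlgMap mV eV f) (hg : IsAlgMap mW eW g) :
    IsAlgMap (twistMul mV mW τ) (eV ⊗ₜ eW) (pr f g) where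
  map_one := by simp [hf.map_one, hg.map_one]
  map_mul x y := by
    induction x with
    | zero => simp
    | add a b ha hb => simp only [map_add, add_tmul, add_mul, ha, hb]
    | tmul v w =>
    induction y with
    | zero => simp
    | add a b ha hb => simp only [map_add, tmul_add, mul_add, ha, hb]
    | tmul v' w' =>
      have h1 : ∀ t : V ⊗[k] W, pr f g (TensorProduct.map (mV ∘ₗ TensorProduct.mk k V V v)
          (mW ∘ₗ (TensorProduct.mk k W W).flip w') t) = f v * pr f g t * g w' := by
        intro t
        induction t with
        | zero => simp
        | add a b ha hb => simp only [map_add, mul_add, add_mul, ha, hb]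
        | tmul p q => simp [hf.map_mul, hg.map_mul, mul_assoc]
      rw [twistMul_tmul, h1, ← h w v']
      simp [mul_assoc]

end TwistRelations

/-! ### Exchange relations in E ⊗ X between elements of E and coaction legs. -/

section Smash

variable {k H : Type*} [Field k] [Ring H] [HopfAlgebra k H]
  {M V W E X : Type*} [Ring M] [Algebra k M] [AddCommGroup V] [Module k V]
  [AddCommGroup W] [Module k W] [Ring E] [Algebra k E] [Ring X] [Algebra k X]

/-- Moving γ past f v and then past g w is the hexagon for a coacting strand crossing a tensor
product. -/
theorem TwistRel.pr_left {f : V →ₗ[k] M} {g : W →ₗ[k] M} {T : Type*} [AddCommGroup T] [Module k T]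
    {γ : T →ₗ[k] M} {ℓ : T →ₗ[k] H ⊗[k] T} (hℓ : IsCopCoaction ℓ) {aV : H ⊗[k] V →ₗ[k] V}
    {aW : H ⊗[k] W →ₗ[k] W} (hf : TwistRel f γ (cbr ℓ aV))
    (hg : TwistRel g γ (cbr ℓ aW)) :
    TwistRel (pr f g) γ (cbr ℓ (tensAct aV aW)) := by
  intro h t
  induction t with
  | zero => simp
  | add a b ha hb => simp only [map_add, tmul_add, mul_add, ha, hb]
  | tmul v w =>
    have h1 := cbr_tensor_right (g := LinearMap.id) (a := aV) (a' := aW) hℓ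
      (isHLinear_id _) h v w
    rw [LinearMap.id_apply] at h1
    rw [h1, pr_tmul, ← mul_assoc, hf]
    generalize cbr ℓ aV (h ⊗ₜ v) = t
    induction t with
    | zero => simp
    | add a b ha hb => simp only [map_add, add_tmul, add_mul, ha, hb]
    | tmul v' h' =>
      rw [pr_tmul, mul_assoc, hg, liftR_tmul]
      generalize cbr ℓ aW (h' ⊗ₜ w) = t
      induction t with
      | zero => simp
      | add a b ha hb => simp only [map_add, mul_add, ha, hb]
      | tmul a b => simp [mul_assoc]

theorem TwistRel.smash_pr {f : V →ₗ[k] M} {g : W →ₗ[k] M} {γ : H →ₗ[k] M}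
    {aV : H ⊗[k] V →ₗ[k] V} {aW : H ⊗[k] W →ₗ[k] W} (hf : TwistRel f γ (cbr (cop k H) aV))
    (hg : TwistRel g γ (cbr (cop k H) aW)) :
    TwistRel (pr f g) γ (cbr (cop k H) (tensAct aV aW)) :=
  hf.pr_left isCopCoaction_cop hg

theorem TwistRel.comp_hLinear {f : W →ₗ[k] M} {γ : H →ₗ[k] M}
    {aV : H ⊗[k] V →ₗ[k] V} {aW : H ⊗[k] W →ₗ[k] W} (hf : TwistRel f γ (cbr (cop k H) aW))
    {φ : V →ₗ[k] W} (hφ : IsHLinear aV aW φ) : TwistRel (f ∘ₗ φ) γ (cbr (cop k H) aV) := by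
  intro h v
  rw [comp_apply, hf, cbr_map_right _ hφ]
  generalize cbr (cop k H) aV (h ⊗ₜ v) = t
  induction t with
  | zero => simp
  | add a b ha hb => simp only [map_add, ha, hb]
  | tmul a b => simp

/-- `x ↦ j(x₍₋₁₎) ⊗ i(x₍₀₎)`. -/
def legMap (j : H →ₗ[k] E) (i : V →ₗ[k] X) (ℓ : V →ₗ[k] H ⊗[k] V) : V →ₗ[k] E ⊗[k] X :=
  TensorProduct.map j i ∘ₗ ℓ

/-- `y ↦ j y ⊗ 1`. -/
def leftMap (X : Type*) [Ring X] [Algebra k X] (j : V →ₗ[k] E) : V →ₗ[k] E ⊗[k] X :=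
  (Algebra.TensorProduct.includeLeft : E →ₐ[k] E ⊗[k] X).toLinearMap ∘ₗ j

@[simp] theorem leftMap_apply (j : V →ₗ[k] E) (v : V) : leftMap X j v = j v ⊗ₜ 1 := rfl

theorem lTensor_rTensor_eq_legMap (j : H →ₗ[k] E) (i : V →ₗ[k] X) (ℓ : V →ₗ[k] H ⊗[k] V) (v : V) :
    lTensor E i (rTensor V j (ℓ v)) = legMap j i ℓ v := by
  rw [← comp_apply, LinearMap.lTensor_comp_rTensor]
  rfl

/-- In (j(x₍₋₁₎) ⊗ i(x₍₀₎))(j(y) ⊗ 1) only the E-factors must be reordered. The smash relation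
splits x₍₋₁₎, and coassociativity turns the two pieces into one leg acting on y and one leg
remaining in E. -/
theorem twistRel_leftMap_legMap {jH : H →ₗ[k] E} {jY : W →ₗ[k] E} {iX : V →ₗ[k] X}
    {ℓ : V →ₗ[k] H ⊗[k] V} {a : H ⊗[k] W →ₗ[k] W} (hℓ : IsCopCoaction ℓ)
    (hs : TwistRel jY jH (cbr (cop k H) a)) :
    TwistRel (leftMap X jY) (legMap jH iX ℓ) (cbr ℓ a) := by
  intro x y
  let Φ : H ⊗[k] (H ⊗[k] V) →ₗ[k] E ⊗[k] X :=
    pr (leftMap X jY ∘ₗ orbit a y) (TensorProduct.map jH iX)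
  have h1 : ∀ s : H ⊗[k] V, TensorProduct.map jH iX s * leftMap X jY y =
      Φ (TensorProduct.assoc k H H V (rTensor V (cop k H) s)) := by
    intro s
    induction s with
    | zero => simp
    | add a b ha hb => simp only [map_add, add_mul, ha, hb]
    | tmul h v =>
      rw [map_tmul, leftMap_apply, Algebra.TensorProduct.tmul_mul_tmul, hs, mul_one,
        cbr_tmul, rTensor_tmul]
      generalize cop k H h = t
      induction t with
      | zero => simp
      | add a b ha hb => simp only [map_add, add_tmul, ha, hb]
      | tmul a b => simp [Φ]
  have h2 : ∀ s : H ⊗[k] V, Φ (lTensor H ℓ s) =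
      pr (leftMap X jY) (legMap jH iX ℓ) (rTensor V (orbit a y) s) := by
    intro s
    induction s with
    | zero => simp
    | add a b ha hb => simp only [map_add, ha, hb]
    | tmul h v => simp [Φ, legMap]
  rw [cbr_tmul, ← h2, ← hℓ.coassoc, ← h1]
  rfl

theorem isAlgMap_legMap {jH : H →ₗ[k] E} {iV : V →ₗ[k] X} {ℓ : V →ₗ[k] H ⊗[k] V}
    {m : V ⊗[k] V →ₗ[k] V} {e : V} (hj : IsAlgMap (mul' k H) 1 jH)
    (hi : IsAlgMap m e iV) (hℓ : ∀ t, ℓ (m t) = lTensor H m (tensorCoact ℓ ℓ t))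
    (he : ℓ e = 1 ⊗ₜ e) : IsAlgMap m e (legMap jH iV ℓ) where
  map_one := by
    simp [legMap, he, hj.map_one, hi.map_one, Algebra.TensorProduct.one_def]
  map_mul x y := by
    simp only [legMap, comp_apply]
    rw [hℓ, tensorCoact_tmul]
    generalize ℓ x = s
    generalize ℓ y = t
    induction s with
    | zero => simp
    | add a b ha hb => simp only [map_add, add_tmul, add_mul, ha, hb]
    | tmul a v =>
    induction t with
    | zero => simp
    | add a b ha hb => simp only [map_add, tmul_add, mul_add, ha, hb]
    | tmul b w =>
      have := hj.map_mul a b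
      rw [LinearMap.mul'_apply] at this
      simp [this, hi.map_mul]

theorem isAlgMap_leftMap {j : V →ₗ[k] E} {m : V ⊗[k] V →ₗ[k] V} {e : V} (hj : IsAlgMap m e j) :
    IsAlgMap m e (leftMap X j) := hj.algHom_comp _

end Smash

/-! ### Bundling a product on a vector space as a ring. -/

section AlgebraOfProduct

variable {k V : Type*} [Field k] [AddCommGroup V] [Module k V] {m : V ⊗[k] V →ₗ[k] V} {e : V}

/-- The space `V`, viewed as a ring with the product `m`. -/
def AlgOf (_h : IsAlgebraProduct m e) : Type _ := V

variable (h : IsAlgebraProduct m e)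

instance : AddCommGroup (AlgOf h) := inferInstanceAs (AddCommGroup V)

instance : Module k (AlgOf h) := inferInstanceAs (Module k V)

/-- The identity map from `V` to `AlgOf h`. -/
def AlgOf.of : V ≃ₗ[k] AlgOf h := LinearEquiv.refl k V

instance : Ring (AlgOf h) :=
  { (inferInstance : AddCommGroup (AlgOf h)) with
    mul := fun x y => AlgOf.of h (m ((AlgOf.of h).symm x ⊗ₜ (AlgOf.of h).symm y))
    one := AlgOf.of h e
    mul_assoc := h.assoc
    one_mul := h.one_mul
    mul_one := h.mul_one
    left_distrib := fun x y z => (congrArg m (tmul_add (R := k) (x : V) y z)).trans (map_add m _ _)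
    right_distrib := fun x y z => (congrArg m (add_tmul (R := k) (x : V) y z)).trans (map_add m _ _)
    zero_mul := fun x => (congrArg m (zero_tmul (R := k) V (x : V))).trans (map_zero m)
    mul_zero := fun x => (congrArg m (tmul_zero (R := k) V (x : V))).trans (map_zero m) }

theorem AlgOf.of_mul (x y : V) : AlgOf.of h (m (x ⊗ₜ y)) = AlgOf.of h x * AlgOf.of h y := rfl

instance : Algebra k (AlgOf h) :=
  Algebra.ofModule
    (fun r x y => (congrArg m (smul_tmul' (R := k) r (x : V) (y : V)).symm).trans (map_smul m r _))
    (fun r x y => (congrArg m (tmul_smul (R := k) r (x : V) (y : V))).trans (map_smul m r _))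

end AlgebraOfProduct

/-! ### The canonical maps into a twisted tensor product. -/

section TwistedTensorProduct

variable {k : Type*} [Field k] {V W : Type*} [AddCommGroup V] [Module k V]
  [AddCommGroup W] [Module k W] {mV : V ⊗[k] V →ₗ[k] V} {eV : V} {mW : W ⊗[k] W →ₗ[k] W} {eW : W}
  {τ : W ⊗[k] V →ₗ[k] V ⊗[k] W}

/-- `v ↦ v ⊗ 1`, as a map to the twisted tensor product. -/
def twistLeft (h : IsAlgebraProduct (twistMul mV mW τ) (eV ⊗ₜ[k] eW)) : V →ₗ[k] AlgOf h :=
  (AlgOf.of h).toLinearMap ∘ₗ (TensorProduct.mk k V W).flip eW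

/-- `w ↦ 1 ⊗ w`, as a map to the twisted tensor product. -/
def twistRight (h : IsAlgebraProduct (twistMul mV mW τ) (eV ⊗ₜ[k] eW)) : W →ₗ[k] AlgOf h :=
  (AlgOf.of h).toLinearMap ∘ₗ TensorProduct.mk k V W eV

/-- For the canonical maps `pr` is the identity of V ⊗ W, so an identity proved after multiplying
into every algebra with the right exchange relation already holds in V ⊗ W. -/
theorem IsTwist.pr_twistLeft_twistRight (hτ : IsTwist mV eV mW eW τ) (hV : IsAlgebraProduct mV eV)
    (hW : IsAlgebraProduct mW eW)
    (h : IsAlgebraProduct (twistMul mV mW τ) (eV ⊗ₜ[k] eW)) (t : V ⊗[k] W) :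
    pr (twistLeft h) (twistRight h) t = AlgOf.of h t := by
  induction t with
  | zero => simp
  | add a b ha hb => simp only [map_add, ha, hb]
  | tmul v w =>
    rw [pr_tmul]
    change AlgOf.of h (twistMul mV mW τ ((v ⊗ₜ eW) ⊗ₜ (eV ⊗ₜ w))) = _
    rw [twistMul_tmul, hτ.one_left]
    simp [hV.mul_one, hW.one_mul]

theorem IsTwist.isAlgMap_twistLeft (hτ : IsTwist mV eV mW eW τ)
    (hW : IsAlgebraProduct mW eW)
    (h : IsAlgebraProduct (twistMul mV mW τ) (eV ⊗ₜ[k] eW)) :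
    IsAlgMap mV eV (twistLeft h) where
  map_one := rfl
  map_mul x y := by
    change _ = AlgOf.of h (twistMul mV mW τ ((x ⊗ₜ eW) ⊗ₜ (y ⊗ₜ eW)))
    rw [twistMul_tmul, hτ.one_left]
    simp [hW.mul_one, twistLeft]

theorem IsTwist.isAlgMap_twistRight (hτ : IsTwist mV eV mW eW τ) (hV : IsAlgebraProduct mV eV)
    (h : IsAlgebraProduct (twistMul mV mW τ) (eV ⊗ₜ[k] eW)) :
    IsAlgMap mW eW (twistRight h) where
  map_one := rfl
  map_mul x y := by
    change _ = AlgOf.of h (twistMul mV mW τ ((eV ⊗ₜ x) ⊗ₜ (eV ⊗ₜ y)))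
    rw [twistMul_tmul, hτ.one_right]
    simp [hV.mul_one, twistRight]

theorem IsTwist.twistRel (hτ : IsTwist mV eV mW eW τ) (hV : IsAlgebraProduct mV eV)
    (hW : IsAlgebraProduct mW eW)
    (h : IsAlgebraProduct (twistMul mV mW τ) (eV ⊗ₜ[k] eW)) :
    TwistRel (twistLeft h) (twistRight h) τ := fun w v => by
  rw [hτ.pr_twistLeft_twistRight hV hW]
  change AlgOf.of h (twistMul mV mW τ ((eV ⊗ₜ w) ⊗ₜ (v ⊗ₜ eW))) = _
  rw [twistMul_tmul]
  congr 1
  generalize τ (w ⊗ₜ v) = t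
  induction t with
  | zero => simp
  | add a b ha hb => simp only [map_add, ha, hb]
  | tmul a b => simp [hV.one_mul, hW.mul_one]

end TwistedTensorProduct

/-! ### Exchange relations between two coaction legs. -/

section TwistHexagons

variable {k H : Type*} [Field k] [Ring H] [HopfAlgebra k H] {M V V' W W' E X : Type*} [Ring M]
  [Algebra k M] [AddCommGroup V] [Module k V] [AddCommGroup V'] [Module k V']
  [AddCommGroup W] [Module k W] [AddCommGroup W'] [Module k W']
  [Ring E] [Algebra k E] [Ring X] [Algebra k X]

/-- The X-factors are reordered by assumption, producing an action on the element whose leg sits in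
E. The Yetter–Drinfeld condition rewrites the E-factor accordingly, so that the legs are exchanged
by the same map. -/
theorem twistRel_legMap_legMap {jH : H →ₗ[k] E} {iV : V →ₗ[k] X} {iW : W →ₗ[k] X}
    {ℓ : V →ₗ[k] H ⊗[k] V} {a : H ⊗[k] V →ₗ[k] V} {ℓW : W →ₗ[k] H ⊗[k] W}
    (hY : IsYetterDrinfeld a ℓ) (hW : IsCopCoaction ℓW)
    (hj : IsAlgMap (mul' k H) 1 jH) (hs : TwistRel iV iW (cbr ℓW a)) :
    TwistRel (legMap jH iV ℓ) (legMap jH iW ℓW) (cbr ℓW a) := by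
  intro w x
  have hc := hW.coassoc w
  let Φ : (H ⊗[k] V) ⊗[k] W →ₗ[k] E ⊗[k] X := pr (TensorProduct.map jH iV)
    ((Algebra.TensorProduct.includeRight : X →ₐ[k] E ⊗[k] X).toLinearMap ∘ₗ iW)
  let L : H ⊗[k] H →ₗ[k] H ⊗[k] V := TensorProduct.map (mul' k H) a ∘ₗ
    (TensorProduct.tensorTensorTensorComm k H H H V).toLinearMap ∘ₗ
      (TensorProduct.mk k (H ⊗[k] H) (H ⊗[k] V)).flip (ℓ x)
  let L' : H ⊗[k] H →ₗ[k] H ⊗[k] V := rTensor V (mul' k H) ∘ₗ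
    (TensorProduct.rightComm k H V H).toLinearMap ∘ₗ rTensor H ℓ ∘ₗ
      rTensor H (orbit a x)
  have hL : L ∘ₗ cop k H = L' ∘ₗ cop k H := by
    ext g
    have := hY g x
    rw [cbr_tmul] at this
    exact this
  have h1 : ∀ s : H ⊗[k] W, TensorProduct.map jH iW s * legMap jH iV ℓ x =
      Φ (rTensor W L ((TensorProduct.assoc k H H W).symm
        (lTensor H ℓW s))) := by
    intro s
    induction s with
    | zero => simp
    | add a b ha hb => simp only [map_add, add_mul, ha, hb]
    | tmul g g' =>
      simp only [L, legMap, comp_apply]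
      generalize ℓ x = r
      induction r with
      | zero => simp
      | add a b ha hb =>
        simp only [map_add, mul_add, LinearMap.comp_add, LinearMap.rTensor_add,
          LinearMap.add_apply, ha, hb]
      | tmul h' v =>
        rw [map_tmul, map_tmul, Algebra.TensorProduct.tmul_mul_tmul,
          hs, cbr_tmul, lTensor_tmul]
        generalize ℓW g' = t
        induction t with
        | zero => simp
        | add a b ha hb => simp only [map_add, tmul_add, ha, hb]
        | tmul a b =>
          have := hj.map_mul g h'
          rw [LinearMap.mul'_apply] at this
          simp [Φ, this]
  have h2 : ∀ s : H ⊗[k] W, pr (legMap jH iV ℓ) (legMap jH iW ℓW)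
      (rTensor W (orbit a x) s) =
      Φ (rTensor W L' ((TensorProduct.assoc k H H W).symm
        (lTensor H ℓW s))) := by
    intro s
    induction s with
    | zero => simp
    | add a b ha hb => simp only [map_add, ha, hb]
    | tmul g g' =>
      rw [rTensor_tmul, pr_tmul, lTensor_tmul]
      simp only [legMap, comp_apply]
      generalize ℓW g' = t
      induction t with
      | zero => simp
      | add a b ha hb => simp only [map_add, tmul_add, mul_add, ha, hb]
      | tmul b c =>
        simp only [L', assoc_symm_tmul, rTensor_tmul, comp_apply,
          LinearEquiv.coe_coe]
        generalize ℓ (orbit a x g) = r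
        induction r with
        | zero => simp
        | add a b ha hb => simp only [map_add, add_tmul, add_mul, ha, hb]
        | tmul h' v =>
          have := hj.map_mul h' b
          rw [LinearMap.mul'_apply] at this
          simp [Φ, this]
  have h3 := h1 (ℓW w)
  rw [← hc, LinearEquiv.symm_apply_apply, ← LinearMap.rTensor_comp_apply, hL] at h3
  rw [cbr_tmul, h2, ← hc, LinearEquiv.symm_apply_apply, ← LinearMap.rTensor_comp_apply, ← h3]
  rfl

theorem twistRel_legMap_cop {jH : H →ₗ[k] E} {iH : H →ₗ[k] X} {iV : V →ₗ[k] X}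
    {ℓ : V →ₗ[k] H ⊗[k] V} {a : H ⊗[k] V →ₗ[k] V} (hY : IsYetterDrinfeld a ℓ)
    (hj : IsAlgMap (mul' k H) 1 jH) (hs : TwistRel iV iH (cbr (cop k H) a)) :
    TwistRel (legMap jH iV ℓ) (legMap jH iH (cop k H)) (cbr (cop k H) a) :=
  twistRel_legMap_legMap hY isCopCoaction_cop hj hs

end TwistHexagons

/-! ### Maps satisfying the double relations, and multiplicativity of the legs. -/

section DoubleMaps

variable {k A H : Type*} [Field k] [Ring A] [HopfAlgebra k A] [Ring H] [HopfAlgebra k H]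
  {B C D E X : Type*} [Ring B] [Algebra k B] [Coalgebra k B]
  [Ring C] [Algebra k C] [Coalgebra k C] [Ring D] [Algebra k D] [Ring E] [Algebra k E]
  [Ring X] [Algebra k X]

/-- Maps from `C`, `H`, `B` to an algebra `E` which satisfy the defining relations of the braided
Drinfeld double. -/
structure DoubleMaps (Q : WeakQuasitriangularPair k A H) (δC : C →ₗ[k] A ⊗[k] C)
    (δB : B →ₗ[k] A ⊗[k] B) (ev : C ⊗[k] B →ₗ[k] k) (jC : C →ₗ[k] E) (jH : H →ₗ[k] E)
    (jB : B →ₗ[k] E) : Prop where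
  algC : IsAlgMap (mul' k C) 1 jC
  algH : IsAlgMap (mul' k H) 1 jH
  algB : IsAlgMap (mul' k B) 1 jB
  actB : TwistRel jB jH (smashTwist Q.pair δB)
  actC : TwistRel jC jH (smashTwist Q.pair δC)
  cross : ∀ c b, crossRelLeft Q jC jB δC δB ev (c ⊗ₜ b) = crossRelRight Q jH jC jB δC δB ev (c ⊗ₜ b)

variable (Q : WeakQuasitriangularPair k A H)

/-- In E ⊗ X the leg is the product of b₁ ⊗ 1 and Rbar⁻¹(b₂₍₋₁₎) ⊗ b₂₍₀₎. This factorisation reduces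
its properties to exchange relations between two simple maps. -/
theorem lTensor_leftLeg (jH : H →ₗ[k] E) (jB : B →ₗ[k] E) (iB : B →ₗ[k] X)
    (δB : B →ₗ[k] A ⊗[k] B) :
    lTensor E iB ∘ₗ leftLeg Q jH jB δB =
      pr (leftMap X jB) (legMap jH iB (leg Q.Rbarinv δB)) ∘ₗ Coalgebra.comul := by
  ext b
  simp only [leftLeg, comp_apply]
  generalize (Coalgebra.comul b : B ⊗[k] B) = t
  induction t with
  | zero => simp
  | add a b ha hb => simp only [map_add, ha, hb]
  | tmul a b =>
    rw [pr_tmul, lTensor_tmul]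
    simp only [legMap, comp_apply]
    generalize leg Q.Rbarinv δB b = t
    induction t with
    | zero => simp
    | add a b ha hb => simp only [map_add, tmul_add, mul_add, ha, hb]
    | tmul h b => simp

/-- The same factorisation in the opposite order, as (R⁻¹(d₀₍₋₁₎) ⊗ d₀₍₀₎)(d₁ ⊗ 1). -/
theorem lTensor_rightLeg (jH : H →ₗ[k] E) (jC : C →ₗ[k] E) (iD : D →ₗ[k] X)
    (δD : D →ₗ[k] A ⊗[k] D) (ρ : D →ₗ[k] D ⊗[k] C) :
    lTensor E iD ∘ₗ rightLeg Q jH jC δD ρ =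
      pr (legMap jH iD (leg Q.Rinv δD)) (leftMap X jC) ∘ₗ ρ := by
  ext d
  simp only [rightLeg, comp_apply]
  generalize ρ d = t
  induction t with
  | zero => simp
  | add a b ha hb => simp only [map_add, ha, hb]
  | tmul d c =>
    rw [pr_tmul, rTensor_tmul]
    simp only [legMap, comp_apply]
    generalize leg Q.Rinv δD d = t
    induction t with
    | zero => simp
    | add a b ha hb => simp only [map_add, add_tmul, add_mul, ha, hb]
    | tmul h b => simp

variable {Q} {δB : LeftCoaction k A B} {δC : LeftCoaction k A C} {δD : LeftCoaction k A D}
  {ev : C ⊗[k] B →ₗ[k] k} {ρ : D →ₗ[k] D ⊗[k] C}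
  {jC : C →ₗ[k] E} {jH : H →ₗ[k] E} {jB : B →ₗ[k] E}

/-- C coacts on itself. With this choice of D, statements about the coaction on D become statements
about the coproduct of the double. -/
theorem IsBraidedBialgebra.isBraidedRightComoduleAlgebra
    (hC : IsBraidedBialgebra Q δC.coact) :
    IsBraidedRightComoduleAlgebra Q δC.coact δC.coact (Coalgebra.comul : C →ₗ[k] C ⊗[k] C) where
  algebra := hC.algebra
  colinear := hC.comul_colinear
  coassoc := Coalgebra.coassoc
  counit := by
    ext c
    simp
  map_mul := hC.comul_mul
  map_one := hC.comul_one

namespace DoubleMaps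

theorem twistRel_leftMap_B (h : DoubleMaps Q δC.coact δB.coact ev jC jH jB) (iD : D →ₗ[k] X)
    {f : A →ₗ[k] H} (hf : IsCopBialgMap Q.pair f) :
    TwistRel (leftMap X jB) (legMap jH iD (leg f δD.coact))
      (cbr (leg f δD.coact) (act Q.pair δB.coact)) :=
  twistRel_leftMap_legMap (hf.isCopCoaction δD) h.actB

theorem twistRel_leftMap_C (h : DoubleMaps Q δC.coact δB.coact ev jC jH jB) (iD : D →ₗ[k] X)
    {f : A →ₗ[k] H} (hf : IsCopBialgMap Q.pair f) :
    TwistRel (leftMap X jC) (legMap jH iD (leg f δD.coact))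
      (cbr (leg f δD.coact) (act Q.pair δC.coact)) :=
  twistRel_leftMap_legMap (hf.isCopCoaction δD) h.actC

theorem isAlgMap_legMap (h : DoubleMaps Q δC.coact δB.coact ev jC jH jB)
    (hD : IsComoduleAlgebra δD.coact) {iD : D →ₗ[k] X}
    (hi : IsAlgMap (mul' k D) 1 iD) {f : A →ₗ[k] H} (hf : IsCopBialgMap Q.pair f) :
    IsAlgMap (mul' k D) 1 (legMap jH iD (leg f δD.coact)) :=
  BraidedDouble.isAlgMap_legMap h.algH hi (hD.leg_mul hf) (hf.leg_of_coinvariant hD.one_coinvariant)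

/-- The two factors of the leg are exchanged by Ψ, so together they define an algebra map on the
braided square of B, and Δ_B is multiplicative into that square. -/
theorem isAlgMap_leftLeg (h : DoubleMaps Q δC.coact δB.coact ev jC jH jB)
    (hB : IsBraidedBialgebra Q δB.coact) {iB : B →ₗ[k] X}
    (hi : IsAlgMap (mul' k B) 1 iB) :
    IsAlgMap (mul' k B) 1 (lTensor E iB ∘ₗ leftLeg Q jH jB δB.coact) := by
  have hR := Q.isCopBialgMap_Rbarinv
  have ht : TwistRel (leftMap X jB) (legMap jH iB (leg Q.Rbarinv δB.coact))
      (braid Q δB.coact δB.coact) := by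
    rw [braid_eq_cbr]
    exact h.twistRel_leftMap_B iB hR
  have hp := ht.isAlgMap_pr (isAlgMap_leftMap h.algB) (h.isAlgMap_legMap hB.algebra hi hR)
  rw [lTensor_leftLeg]
  refine ⟨fun x y => ?_, ?_⟩
  · have := LinearMap.congr_fun hB.comul_mul (x ⊗ₜ y)
    simp only [comp_apply] at this
    rw [comp_apply, this]
    exact hp.map_mul _ _
  · rw [comp_apply, hB.comul_one]
    exact hp.map_one

/-- As for the left leg, with the C-coaction in place of Δ_B. The exchange relation is first
obtained for Ψ⁻¹ and then inverted, because here the leg in E stands to the left of c. -/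
theorem isAlgMap_rightLeg (h : DoubleMaps Q δC.coact δB.coact ev jC jH jB)
    (hD : IsBraidedRightComoduleAlgebra Q δC.coact δD.coact ρ) {iD : D →ₗ[k] X}
    (hi : IsAlgMap (mul' k D) 1 iD) :
    IsAlgMap (mul' k D) 1 (lTensor E iD ∘ₗ rightLeg Q jH jC δD.coact ρ) := by
  have hR := Q.isCopBialgMap_Rinv
  have ht : TwistRel (legMap jH iD (leg Q.Rinv δD.coact)) (leftMap X jC)
      (braid Q δC.coact δD.coact) :=
    (h.twistRel_leftMap_C iD hR).inv (braidInv_braid Q δD δC)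
  have hp := ht.isAlgMap_pr (h.isAlgMap_legMap hD.algebra hi hR) (isAlgMap_leftMap h.algC)
  rw [lTensor_rightLeg]
  refine ⟨fun x y => ?_, ?_⟩
  · have := LinearMap.congr_fun hD.map_mul (x ⊗ₜ y)
    simp only [comp_apply] at this
    rw [comp_apply, this]
    exact hp.map_mul _ _
  · rw [comp_apply, hD.map_one]
    exact hp.map_one

theorem isAlgMap_legMap_cop (h : DoubleMaps Q δC.coact δB.coact ev jC jH jB)
    {iH : H →ₗ[k] X} (hi : IsAlgMap (mul' k H) 1 iH) :
    IsAlgMap (mul' k H) 1 (legMap jH iH (cop k H)) :=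
  BraidedDouble.isAlgMap_legMap h.algH hi cop_mul' cop_one

/-- Both factors of the leg satisfy the exchange rule with H, the second by the Yetter–Drinfeld
condition; hence so does their product, and Δ_B is H-linear. -/
theorem twistRel_leftLeg (h : DoubleMaps Q δC.coact δB.coact ev jC jH jB)
    (hB : IsBraidedBialgebra Q δB.coact) {iB : B →ₗ[k] X} {iH : H →ₗ[k] X}
    (hs : TwistRel iB iH (smashTwist Q.pair δB.coact)) :
    TwistRel (lTensor E iB ∘ₗ leftLeg Q jH jB δB.coact) (legMap jH iH (cop k H))
      (smashTwist Q.pair δB.coact) := by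
  have hR := Q.isCopBialgMap_Rbarinv
  rw [lTensor_leftLeg]
  refine TwistRel.comp_hLinear (TwistRel.smash_pr (twistRel_leftMap_legMap isCopCoaction_cop h.actB)
    (twistRel_legMap_cop (hR.isYetterDrinfeld δB) h.algH hs)) ?_
  rw [← Q.pairing.act_tensorCoact]
  exact hB.comul_colinear.isHLinear _

theorem twistRel_rightLeg (h : DoubleMaps Q δC.coact δB.coact ev jC jH jB)
    (hD : IsBraidedRightComoduleAlgebra Q δC.coact δD.coact ρ) {iD : D →ₗ[k] X} {iH : H →ₗ[k] X}
    (hs : TwistRel iD iH (smashTwist Q.pair δD.coact)) :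
    TwistRel (lTensor E iD ∘ₗ rightLeg Q jH jC δD.coact ρ) (legMap jH iH (cop k H))
      (smashTwist Q.pair δD.coact) := by
  have hR := Q.isCopBialgMap_Rinv
  rw [lTensor_rightLeg]
  refine TwistRel.comp_hLinear (TwistRel.smash_pr
    (twistRel_legMap_cop (hR.isYetterDrinfeld δD) h.algH hs)
    (twistRel_leftMap_legMap isCopCoaction_cop h.actC)) ?_
  rw [← Q.pairing.act_tensorCoact]
  exact hD.colinear.isHLinear _

end DoubleMaps

end DoubleMaps

/-! ### Multiplying in E while combining the second tensor factors. -/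

section Fuse

variable {k E V W Z Z' V' W' : Type*} [Field k] [Ring E] [Algebra k E] [AddCommGroup V] [Module k V]
  [AddCommGroup W] [Module k W] [AddCommGroup Z] [Module k Z] [AddCommGroup Z'] [Module k Z']
  [AddCommGroup V'] [Module k V'] [AddCommGroup W'] [Module k W']

/-- `(x ⊗ v) ⊗ (y ⊗ w) ↦ x y ⊗ π (v ⊗ w)`. -/
def fuse (E : Type*) [Ring E] [Algebra k E] (π : V ⊗[k] W →ₗ[k] Z) :
    (E ⊗[k] V) ⊗[k] (E ⊗[k] W) →ₗ[k] E ⊗[k] Z :=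
  TensorProduct.map (mul' k E) π ∘ₗ
    (TensorProduct.tensorTensorTensorComm k E V E W).toLinearMap

@[simp] theorem fuse_tmul (π : V ⊗[k] W →ₗ[k] Z) (x y : E) (v : V) (w : W) :
    fuse E π ((x ⊗ₜ v) ⊗ₜ (y ⊗ₜ w)) = (x * y) ⊗ₜ π (v ⊗ₜ w) := by
  simp [fuse]

theorem lTensor_fuse (g : Z →ₗ[k] Z') (π : V ⊗[k] W →ₗ[k] Z) (t : (E ⊗[k] V) ⊗[k] (E ⊗[k] W)) :
    lTensor E g (fuse E π t) = fuse E (g ∘ₗ π) t := by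
  simp only [fuse, comp_apply, ← comp_apply (lTensor E g),
    LinearMap.lTensor_comp_map]

theorem fuse_lTensor (π : V ⊗[k] W →ₗ[k] Z) (f : V' →ₗ[k] V) (g : W' →ₗ[k] W) (s : E ⊗[k] V')
    (t : E ⊗[k] W') :
    fuse E π (lTensor E f s ⊗ₜ lTensor E g t) =
      fuse E (π ∘ₗ TensorProduct.map f g) (s ⊗ₜ t) := by
  induction s with
  | zero => simp
  | add a b ha hb => simp only [map_add, add_tmul, ha, hb]
  | tmul x v =>
  induction t with
  | zero => simp
  | add a b ha hb => simp only [map_add, tmul_add, ha, hb]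
  | tmul y w => simp

theorem fuse_pr {X : Type*} [Ring X] [Algebra k X] (f : V →ₗ[k] X) (g : W →ₗ[k] X) (s : E ⊗[k] V)
    (t : E ⊗[k] W) :
    fuse E (pr f g) (s ⊗ₜ t) = lTensor E f s * lTensor E g t := by
  induction s with
  | zero => simp
  | add a b ha hb => simp only [map_add, add_tmul, add_mul, ha, hb]
  | tmul x v =>
  induction t with
  | zero => simp
  | add a b ha hb => simp only [map_add, tmul_add, mul_add, ha, hb]
  | tmul y w => simp

theorem fuse_pr_map {X : Type*} [Ring X] [Algebra k X] (f : V →ₗ[k] X) (g : W →ₗ[k] X)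
    (φ : V' →ₗ[k] E ⊗[k] V) (ψ : W' →ₗ[k] E ⊗[k] W) (t : V' ⊗[k] W') :
    fuse E (pr f g) (TensorProduct.map φ ψ t) =
      pr (lTensor E f ∘ₗ φ) (lTensor E g ∘ₗ ψ) t := by
  induction t with
  | zero => simp
  | add a b ha hb => simp only [map_add, ha, hb]
  | tmul v w => rw [map_tmul, fuse_pr, pr_tmul]; rfl

end Fuse

/-! ### Reordering four factors along braidings. -/

section Sandwich

variable {k H : Type*} [Field k] [Ring H] [HopfAlgebra k H] {M V W Y Z : Type*} [Ring M]
  [Algebra k M] [AddCommGroup V] [Module k V] [AddCommGroup W] [Module k W]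
  [AddCommGroup Y] [Module k Y] [AddCommGroup Z] [Module k Z]

/-- `(v ⊗ y) ⊗ (z ⊗ w) ↦ f v * P (y ⊗ z) * g w`. -/
def sandwich (f : V →ₗ[k] M) (P : Y ⊗[k] Z →ₗ[k] M) (g : W →ₗ[k] M) :
    (V ⊗[k] Y) ⊗[k] (Z ⊗[k] W) →ₗ[k] M :=
  pr (pr f P ∘ₗ (TensorProduct.assoc k V Y Z).toLinearMap) g ∘ₗ
    (TensorProduct.assoc k (V ⊗[k] Y) Z W).symm.toLinearMap

@[simp] theorem sandwich_tmul (f : V →ₗ[k] M) (P : Y ⊗[k] Z →ₗ[k] M) (g : W →ₗ[k] M)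
    (v : V) (y : Y) (z : Z) (w : W) :
    sandwich f P g ((v ⊗ₜ y) ⊗ₜ (z ⊗ₜ w)) = f v * P (y ⊗ₜ z) * g w := by
  simp [sandwich]

/-- In f · u · u' · g, move g left past u' by `h₃`, then f right past u and g by `h₁` and `h₂`. The
three crossings, with the one already inside P, make up a single crossing of a pair past a pair. -/
theorem sandwich_cbr {ℓV : V →ₗ[k] H ⊗[k] V} (hV : IsCopCoaction ℓV)
    {ℓY : Y →ₗ[k] H ⊗[k] Y} (hY : IsCopCoaction ℓY)
    {aZ : H ⊗[k] Z →ₗ[k] Z} (hZ : IsHAction aZ) {aW : H ⊗[k] W →ₗ[k] W} (hW : IsHAction aW)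
    {f : V →ₗ[k] M} {u : Z →ₗ[k] M} {u' : Y →ₗ[k] M} {g : W →ₗ[k] M}
    (h₁ : TwistRel u f (cbr ℓV aZ)) (h₂ : TwistRel g f (cbr ℓV aW))
    (h₃ : TwistRel g u' (cbr ℓY aW)) (t : (V ⊗[k] Y) ⊗[k] (Z ⊗[k] W)) :
    sandwich f (pr u u' ∘ₗ cbr ℓY aZ) g t =
      pr (pr u g) (pr f u') (cbr (tensorCoact ℓV ℓY) (tensAct aZ aW) t) := by
  refine eq_of_tmul (f := sandwich f (pr u u' ∘ₗ cbr ℓY aZ) g)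
    (g := pr (pr u g) (pr f u') ∘ₗ cbr (tensorCoact ℓV ℓY) (tensAct aZ aW)) (fun p q => ?_) t
  induction p with
  | zero => simp
  | add a b ha hb => simp only [map_add, add_tmul, ha, hb]
  | tmul v y =>
  induction q with
  | zero => simp
  | add a b ha hb => simp only [map_add, tmul_add, ha, hb]
  | tmul z w =>
  have e1 : ∀ s : (Z ⊗[k] W) ⊗[k] Y, pr (pr u g) (pr f u')
      (liftL (cbr ℓV (tensAct aZ aW)) LinearMap.id (v ⊗ₜ s)) = f v * pr (pr u g) u' s := by
    intro s
    induction s with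
    | zero => simp
    | add a b ha hb => simp only [map_add, tmul_add, mul_add, ha, hb]
    | tmul r y =>
      rw [liftL_tmul, pr_tmul, ← mul_assoc, (h₁.pr_left hV h₂)]
      generalize cbr ℓV (tensAct aZ aW) (v ⊗ₜ r) = s
      induction s with
      | zero => simp
      | add a b ha hb => simp only [map_add, add_mul, ha, hb]
      | tmul r v => simp [mul_assoc]
  have e2 : ∀ s : Z ⊗[k] Y, pr (pr u g) u' (liftR (cbr ℓY aW) LinearMap.id (s ⊗ₜ w)) =
      pr u u' s * g w := by
    intro s
    induction s with
    | zero => simp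
    | add a b ha hb => simp only [map_add, add_tmul, add_mul, ha, hb]
    | tmul z y =>
      rw [liftR_tmul, pr_tmul, mul_assoc, h₃]
      generalize cbr ℓY aW (y ⊗ₜ w) = s
      induction s with
      | zero => simp
      | add a b ha hb => simp only [map_add, mul_add, ha, hb]
      | tmul r v => simp [mul_assoc]
  have e3 := cbr_tensor_left (ℓ := ℓV) (ℓ' := ℓY) (ℓ'' := tensorCoact ℓV ℓY)
    (isHAction_tensAct hZ hW) (f := LinearMap.id) (x := v) (x' := y) (by simp) (z ⊗ₜ w)
  have e4 := cbr_tensor_right (a := aZ) (a' := aW) hY (isHLinear_id (tensAct aZ aW)) y z w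
  rw [LinearMap.id_apply] at e3 e4
  rw [comp_apply, e3, e1, e4, e2, sandwich_tmul, comp_apply, mul_assoc]

end Sandwich

/-! ### Coassociativity of the legs with respect to ρ and Δ_B. -/

section LegCoassociativity

variable {k A H : Type*} [Field k] [Ring A] [HopfAlgebra k A] [Ring H] [HopfAlgebra k H]
  {Q : WeakQuasitriangularPair k A H}
  {B C D E M : Type*} [Ring B] [Algebra k B] [Coalgebra k B]
  [Ring C] [Algebra k C] [Coalgebra k C] [Ring D] [Algebra k D] [Ring E] [Algebra k E]
  [Ring M] [Algebra k M]
  {δB : LeftCoaction k A B} {δC : LeftCoaction k A C} {δD : LeftCoaction k A D}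
  {ρ : D →ₗ[k] D ⊗[k] C} {jH : H →ₗ[k] E}

/-- Colinearity of ρ spreads R⁻¹ of the coaction over d₀ and d₁, and coassociativity of ρ then
exhibits a right leg of C in the second position. -/
theorem lTensor_coact_rightLeg (hj : IsAlgMap (mul' k H) 1 jH) (jC : C →ₗ[k] E)
    (hD : IsBraidedRightComoduleAlgebra Q δC.coact δD.coact ρ) (d : D) :
    lTensor E ρ (rightLeg Q jH jC δD.coact ρ d) =
      fuse E LinearMap.id (TensorProduct.map (rTensor D jH ∘ₗ leg Q.Rinv δD.coact)
        (rightLeg Q jH jC δC.coact Coalgebra.comul) (ρ d)) := by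
  let Φ : (D ⊗[k] C) ⊗[k] C →ₗ[k] E ⊗[k] (D ⊗[k] C) :=
    rTensor (D ⊗[k] C) (mul' k E ∘ₗ TensorProduct.map jH jC) ∘ₗ
      (TensorProduct.rightComm k H (D ⊗[k] C) C).toLinearMap ∘ₗ
      rTensor C (leg Q.Rinv (tensorCoact δD.coact δC.coact))
  have h1 : ∀ t : D ⊗[k] C, lTensor E ρ (rTensor D
      (mul' k E ∘ₗ TensorProduct.map jH jC) (TensorProduct.rightComm k H D C
        (rTensor C (leg Q.Rinv δD.coact) t))) = Φ (rTensor C ρ t) := by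
    intro t
    induction t with
    | zero => simp
    | add a b ha hb => simp only [map_add, ha, hb]
    | tmul d c =>
      simp only [Φ, comp_apply, rTensor_tmul, hD.colinear.leg,
        LinearEquiv.coe_coe]
      generalize leg Q.Rinv δD.coact d = t
      induction t with
      | zero => simp
      | add a b ha hb => simp only [map_add, add_tmul, ha, hb]
      | tmul h d => simp
  have h2 : ∀ t : D ⊗[k] C, fuse E LinearMap.id (TensorProduct.map
      (rTensor D jH ∘ₗ leg Q.Rinv δD.coact)
        (rightLeg Q jH jC δC.coact Coalgebra.comul) t) =
      Φ ((TensorProduct.assoc k D C C).symm (lTensor D Coalgebra.comul t)) := by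
    intro t
    induction t with
    | zero => simp
    | add a b ha hb => simp only [map_add, ha, hb]
    | tmul d c =>
      simp only [map_tmul, rightLeg, comp_apply, lTensor_tmul]
      generalize (Coalgebra.comul c : C ⊗[k] C) = t
      induction t with
      | zero => simp
      | add a b ha hb => simp only [map_add, tmul_add, ha, hb]
      | tmul c c' =>
        simp only [Φ, comp_apply, assoc_symm_tmul, rTensor_tmul,
          Q.isCopBialgMap_Rinv.leg_tensorCoact, LinearEquiv.coe_coe]
        rw [tensorCoact_tmul]
        generalize leg Q.Rinv δD.coact d = s
        generalize leg Q.Rinv δC.coact c = t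
        induction s with
        | zero => simp
        | add a b ha hb => simp only [map_add, add_tmul, ha, hb]
        | tmul h d =>
        induction t with
        | zero => simp
        | add a b ha hb => simp only [map_add, add_tmul, tmul_add, ha, hb]
        | tmul h' c =>
          have := hj.map_mul h h'
          rw [LinearMap.mul'_apply] at this
          simp [this, mul_assoc]
  have h3 := LinearMap.congr_fun hD.coassoc d
  simp only [comp_apply, LinearEquiv.coe_coe] at h3
  rw [h2, ← h3, LinearEquiv.symm_apply_apply, ← h1]
  rfl

theorem lTensor_comul_leftLeg (hj : IsAlgMap (mul' k H) 1 jH) (jB : B →ₗ[k] E)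
    (hB : IsBraidedBialgebra Q δB.coact) (b : B) :
    lTensor E Coalgebra.comul (leftLeg Q jH jB δB.coact b) =
      fuse E LinearMap.id (TensorProduct.map (leftLeg Q jH jB δB.coact)
        (rTensor B jH ∘ₗ leg Q.Rbarinv δB.coact) (Coalgebra.comul b)) := by
  let Φ : B ⊗[k] (B ⊗[k] B) →ₗ[k] E ⊗[k] (B ⊗[k] B) :=
    rTensor (B ⊗[k] B) (mul' k E ∘ₗ TensorProduct.map jB jH) ∘ₗ
      (TensorProduct.assoc k B H (B ⊗[k] B)).symm.toLinearMap ∘ₗ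
      lTensor B (leg Q.Rbarinv (tensorCoact δB.coact δB.coact))
  have h1 : ∀ t : B ⊗[k] B, lTensor E Coalgebra.comul (rTensor B
      (mul' k E ∘ₗ TensorProduct.map jB jH) ((TensorProduct.assoc k B H B).symm
        (lTensor B (leg Q.Rbarinv δB.coact) t))) =
      Φ (lTensor B Coalgebra.comul t) := by
    intro t
    induction t with
    | zero => simp
    | add a b ha hb => simp only [map_add, ha, hb]
    | tmul b b' =>
      simp only [Φ, comp_apply, lTensor_tmul, hB.comul_colinear.leg,
        LinearEquiv.coe_coe]
      generalize leg Q.Rbarinv δB.coact b' = t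
      induction t with
      | zero => simp
      | add a b ha hb => simp only [map_add, tmul_add, ha, hb]
      | tmul h d => simp
  have h2 : ∀ t : B ⊗[k] B, fuse E LinearMap.id (TensorProduct.map (leftLeg Q jH jB δB.coact)
        (rTensor B jH ∘ₗ leg Q.Rbarinv δB.coact) t) =
      Φ (TensorProduct.assoc k B B B (rTensor B Coalgebra.comul t)) := by
    intro t
    induction t with
    | zero => simp
    | add a b ha hb => simp only [map_add, ha, hb]
    | tmul b y =>
      simp only [map_tmul, leftLeg, comp_apply, rTensor_tmul]
      generalize (Coalgebra.comul b : B ⊗[k] B) = t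
      induction t with
      | zero => simp
      | add a b ha hb => simp only [map_add, add_tmul, ha, hb]
      | tmul b b' =>
        simp only [Φ, comp_apply, assoc_tmul, lTensor_tmul,
          Q.isCopBialgMap_Rbarinv.leg_tensorCoact, LinearEquiv.coe_coe]
        rw [tensorCoact_tmul]
        generalize leg Q.Rbarinv δB.coact b' = s
        generalize leg Q.Rbarinv δB.coact y = t
        induction s with
        | zero => simp
        | add a b ha hb => simp only [map_add, add_tmul, tmul_add, ha, hb]
        | tmul h d =>
        induction t with
        | zero => simp
        | add a b ha hb => simp only [map_add, tmul_add, ha, hb]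
        | tmul h' c =>
          have := hj.map_mul h h'
          rw [LinearMap.mul'_apply] at this
          simp [this, mul_assoc]
  have h3 := Coalgebra.coassoc_apply (R := k) b
  rw [h2, h3, ← h1]
  rfl

/-- Coassociativity on both sides: evaluation inside the middle pair of factors is the same as
evaluation first, followed by expanding the outer factors by ρ and Δ_B. -/
theorem sandwich_contract (hD : IsBraidedRightComoduleAlgebra Q δC.coact δD.coact ρ)
    (ev : C ⊗[k] B →ₗ[k] k) (f : D →ₗ[k] M) (P : C ⊗[k] B →ₗ[k] M) (g : B →ₗ[k] M)
    (d : D) (b : B) :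
    sandwich f (P ∘ₗ contract ev ∘ₗ TensorProduct.map Coalgebra.comul Coalgebra.comul) g
        (ρ d ⊗ₜ Coalgebra.comul b) =
      sandwich f P g (TensorProduct.map ρ Coalgebra.comul
        (contract ev (ρ d ⊗ₜ Coalgebra.comul b))) := by
  let Ξ : ((D ⊗[k] C) ⊗[k] C) ⊗[k] (B ⊗[k] (B ⊗[k] B)) →ₗ[k] M := sandwich f P g ∘ₗ contract ev
  have h1 : ∀ (s : D ⊗[k] C) (t : B ⊗[k] B), sandwich f (P ∘ₗ contract ev ∘ₗ
      TensorProduct.map Coalgebra.comul Coalgebra.comul) g (s ⊗ₜ t) =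
      Ξ ((TensorProduct.assoc k D C C).symm (lTensor D Coalgebra.comul s) ⊗ₜ
        TensorProduct.assoc k B B B (rTensor B Coalgebra.comul t)) := by
    intro s t
    induction s with
    | zero => simp
    | add a b ha hb => simp only [map_add, add_tmul, ha, hb]
    | tmul d c =>
    induction t with
    | zero => simp
    | add a b ha hb => simp only [map_add, tmul_add, ha, hb]
    | tmul b y =>
      rw [sandwich_tmul, comp_apply, comp_apply, map_tmul,
        lTensor_tmul, rTensor_tmul]
      generalize (Coalgebra.comul c : C ⊗[k] C) = s
      generalize (Coalgebra.comul b : B ⊗[k] B) = t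
      induction s with
      | zero => simp
      | add a b ha hb => simp only [map_add, add_tmul, tmul_add, mul_add, add_mul, ha, hb]
      | tmul c c' =>
      induction t with
      | zero => simp
      | add a b ha hb => simp only [map_add, add_tmul, tmul_add, mul_add, add_mul, ha, hb]
      | tmul b b' => simp [Ξ, contract_tmul]
  have h2 : ∀ (s : D ⊗[k] C) (t : B ⊗[k] B), sandwich f P g (TensorProduct.map ρ Coalgebra.comul
        (contract ev (s ⊗ₜ t))) =
      Ξ (rTensor C ρ s ⊗ₜ lTensor B Coalgebra.comul t) := by
    intro s t
    induction s with
    | zero => simp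
    | add a b ha hb => simp only [map_add, add_tmul, ha, hb]
    | tmul d c =>
    induction t with
    | zero => simp
    | add a b ha hb => simp only [map_add, tmul_add, ha, hb]
    | tmul b y =>
      simp [Ξ, contract_tmul]
  have h3 := LinearMap.congr_fun hD.coassoc d
  simp only [comp_apply, LinearEquiv.coe_coe] at h3
  rw [h1, h2, ← h3, LinearEquiv.symm_apply_apply, Coalgebra.coassoc_apply]

/-- Evaluating the inner C and B factors isolates exactly the expression on the right of the cross
relation, sitting in E between the legs of D and B. -/
theorem fuse_contract (ev : C ⊗[k] B →ₗ[k] k) (f : D →ₗ[k] M) (g : B →ₗ[k] M)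
    (s : E ⊗[k] D) (r : E ⊗[k] C) (r' : E ⊗[k] B) (s' : E ⊗[k] B) :
    fuse E (pr f g ∘ₗ contract ev) (fuse E LinearMap.id (s ⊗ₜ r) ⊗ₜ
      fuse E LinearMap.id (r' ⊗ₜ s')) =
    lTensor E f s * (TensorProduct.rid k E (TensorProduct.map (mul' k E) ev
      (TensorProduct.tensorTensorTensorComm k E C E B (r ⊗ₜ r')))) ⊗ₜ[k] 1 *
        lTensor E g s' := by
  induction s with
  | zero => simp
  | add a b ha hb => simp only [map_add, add_tmul, add_mul, ha, hb]
  | tmul x d =>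
  induction r with
  | zero => simp
  | add a b ha hb => simp only [map_add, add_tmul, tmul_add, add_mul, mul_add, ha, hb]
  | tmul y c =>
  induction r' with
  | zero => simp
  | add a b ha hb => simp only [map_add, add_tmul, tmul_add, add_mul, mul_add, ha, hb]
  | tmul z b =>
  induction s' with
  | zero => simp
  | add a b ha hb => simp only [map_add, tmul_add, mul_add, ha, hb]
  | tmul w b' => simp [contract_tmul, mul_assoc, smul_tmul]

end LegCoassociativity

/-! ### The cross relation makes the legs commute with T. -/

section Core

variable {k A H : Type*} [Field k] [Ring A] [HopfAlgebra k A] [Ring H] [HopfAlgebra k H]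
  {Q : WeakQuasitriangularPair k A H}
  {B C D E X : Type*} [Ring B] [Algebra k B] [Coalgebra k B]
  [Ring C] [Algebra k C] [Coalgebra k C] [Ring D] [Algebra k D] [Ring E] [Algebra k E]
  [Ring X] [Algebra k X]
  {δB : LeftCoaction k A B} {δC : LeftCoaction k A C} {δD : LeftCoaction k A D}
  {ev : C ⊗[k] B →ₗ[k] k} {ρ : D →ₗ[k] D ⊗[k] C}
  {jC : C →ₗ[k] E} {jH : H →ₗ[k] E} {jB : B →ₗ[k] E}

/-- Naturality of Ψ⁻¹ along the colinear map ρ in one variable and the H-linear map Δ_B in the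
other. -/
theorem cbr_tensor_map_comul (hB : IsBraidedBialgebra Q δB.coact)
    (hD : IsBraidedRightComoduleAlgebra Q δC.coact δD.coact ρ) (t : D ⊗[k] B) :
    cbr (tensorCoact (leg Q.Rinv δD.coact) (leg Q.Rinv δC.coact))
      (tensAct (act Q.pair δB.coact) (act Q.pair δB.coact))
        (TensorProduct.map ρ Coalgebra.comul t) =
    TensorProduct.map Coalgebra.comul ρ (braidInv Q δD.coact δB.coact t) := by
  have hΔ : IsHLinear (act Q.pair δB.coact)
      (tensAct (act Q.pair δB.coact) (act Q.pair δB.coact))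
        (Coalgebra.comul : B →ₗ[k] B ⊗[k] B) := by
    rw [← Q.pairing.act_tensorCoact]
    exact hB.comul_colinear.isHLinear _
  induction t with
  | zero => simp
  | add a b ha hb => simp only [map_add, ha, hb]
  | tmul d b =>
    have hρ := hD.colinear.leg Q.Rinv d
    rw [Q.isCopBialgMap_Rinv.leg_tensorCoact] at hρ
    rw [map_tmul, cbr_map_left _ hρ, cbr_map_right _ hΔ, ← comp_apply,
      LinearMap.lTensor_comp_rTensor, braidInv_eq_cbr]

namespace DoubleMaps

/-- Multiplying in X makes the calculation one of reordering factors in E ⊗ X: the legs expand to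
(leg of D)(middle term)(leg of B), the cross relation replaces the middle term by the product of B
and C in the other order, and the four factors regroup into a left leg times a right leg. -/
theorem fuse_invTwist_of_twistRel (h : DoubleMaps Q δC.coact δB.coact ev jC jH jB)
    (hB : IsBraidedBialgebra Q δB.coact)
    (hD : IsBraidedRightComoduleAlgebra Q δC.coact δD.coact ρ) {iB : B →ₗ[k] X} {iD : D →ₗ[k] X}
    (hi : TwistRel iB iD (braidInv Q δD.coact δB.coact)) (d : D) (b : B) :
    fuse E (pr iB iD ∘ₗ invTwist Q δB.coact δD.coact ev ρ)
      (rightLeg Q jH jC δD.coact ρ d ⊗ₜ leftLeg Q jH jB δB.coact b) =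
    fuse E (pr iB iD) (TensorProduct.map (leftLeg Q jH jB δB.coact) (rightLeg Q jH jC δD.coact ρ)
      (invTwist Q δB.coact δD.coact ev ρ (d ⊗ₜ b))) := by
  have hR := Q.isCopBialgMap_Rinv
  have hR' := Q.isCopBialgMap_Rbarinv
  -- The Ψ⁻¹ contained in T is absorbed by multiplying in X in the other order.
  have e1 : pr iB iD ∘ₗ invTwist Q δB.coact δD.coact ev ρ =
      (pr iD iB ∘ₗ contract ev) ∘ₗ TensorProduct.map ρ Coalgebra.comul := by
    ext d b
    exact (hi.pr_eq _).symm
  have hcross : crossRelRight Q jH jC jB δC.coact δB.coact ev =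
      crossRelLeft Q jC jB δC.coact δB.coact ev :=
    TensorProduct.ext' fun c b => (h.cross c b).symm
  -- The inner C- and B-legs combine under evaluation into `crossRelRight`, the only place where the
  -- cross relation is applied.
  have e2 : ∀ (s : D ⊗[k] C) (t : B ⊗[k] B), fuse E (pr iD iB ∘ₗ contract ev)
      (fuse E LinearMap.id (TensorProduct.map (rTensor D jH ∘ₗ leg Q.Rinv δD.coact)
        (rightLeg Q jH jC δC.coact Coalgebra.comul) s) ⊗ₜ
      fuse E LinearMap.id (TensorProduct.map (leftLeg Q jH jB δB.coact)
        (rTensor B jH ∘ₗ leg Q.Rbarinv δB.coact) t)) =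
      sandwich (legMap jH iD (leg Q.Rinv δD.coact))
        ((Algebra.TensorProduct.includeLeft : E →ₐ[k] E ⊗[k] X).toLinearMap ∘ₗ
          crossRelRight Q jH jC jB δC.coact δB.coact ev)
        (legMap jH iB (leg Q.Rbarinv δB.coact)) (s ⊗ₜ t) := by
    intro s t
    induction s with
    | zero => simp
    | add a b ha hb => simp only [map_add, add_tmul, ha, hb]
    | tmul d c =>
    induction t with
    | zero => simp
    | add a b ha hb => simp only [map_add, tmul_add, ha, hb]
    | tmul b y =>
      rw [map_tmul, map_tmul, fuse_contract, sandwich_tmul,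
        comp_apply (rTensor D jH),
          comp_apply (rTensor B jH),
        lTensor_rTensor_eq_legMap, lTensor_rTensor_eq_legMap]
      rfl
  have e3 : (Algebra.TensorProduct.includeLeft : E →ₐ[k] E ⊗[k] X).toLinearMap ∘ₗ
      crossRelLeft Q jC jB δC.coact δB.coact ev =
      (pr (leftMap X jB) (leftMap X jC) ∘ₗ braidInv Q δC.coact δB.coact) ∘ₗ contract ev ∘ₗ
        TensorProduct.map Coalgebra.comul Coalgebra.comul :=
    TensorProduct.ext' fun c b =>
      algHom_pr (Algebra.TensorProduct.includeLeft : E →ₐ[k] E ⊗[k] X) jB jC _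
  have hBB := Q.pairing.isHAction_act δB
  -- The three exchange relations used in the regrouping are: B in E with the D-leg, the B-leg with
  -- the D-leg, and C in E with the B-leg, the last by inverting a relation along Ψ.
  rw [e1, ← fuse_lTensor, lTensor_coact_rightLeg h.algH jC hD, lTensor_comul_leftLeg h.algH jB hB,
    e2, hcross, e3, sandwich_contract hD, braidInv_eq_cbr,
    sandwich_cbr (hR.isCopCoaction δD) (hR.isCopCoaction δC) hBB hBB
      (h.twistRel_leftMap_B iD hR)
      (twistRel_legMap_legMap (hR'.isYetterDrinfeld δB) (hR.isCopCoaction δD) h.algH hi)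
      (TwistRel.inv (h.twistRel_leftMap_C iB hR')
        (fun t => by rw [← braid_eq_cbr, ← braidInv_eq_cbr, braid_braidInv]))]
  rw [cbr_tensor_map_comul hB hD, pr_map, ← lTensor_leftLeg, ← lTensor_rightLeg, ← fuse_pr_map]
  rfl

/-- The previous identity for the universal choice X = B ⊗ D with product twisted by Ψ⁻¹, where
multiplication of the two canonical maps is a linear isomorphism and can be cancelled. -/
theorem fuse_invTwist (h : DoubleMaps Q δC.coact δB.coact ev jC jH jB)
    (hB : IsBraidedBialgebra Q δB.coact)
    (hD : IsBraidedRightComoduleAlgebra Q δC.coact δD.coact ρ) (d : D) (b : B) :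
    fuse E (invTwist Q δB.coact δD.coact ev ρ)
      (rightLeg Q jH jC δD.coact ρ d ⊗ₜ leftLeg Q jH jB δB.coact b) =
    fuse E LinearMap.id (TensorProduct.map (leftLeg Q jH jB δB.coact)
      (rightLeg Q jH jC δD.coact ρ) (invTwist Q δB.coact δD.coact ev ρ (d ⊗ₜ b))) := by
  have hτ := isTwist_leg hB.algebra hD.algebra Q.pairing Q.isCopBialgMap_Rinv
  have hBa := isAlgebraProduct_mul' k B
  have hDa := isAlgebraProduct_mul' k D
  have hX := hτ.isAlgebraProduct hBa hDa
  have hi := hτ.twistRel hBa hDa hX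
  have hpr : pr (twistLeft hX) (twistRight hX) = (AlgOf.of hX).toLinearMap :=
    LinearMap.ext (hτ.pr_twistLeft_twistRight hBa hDa hX)
  have key := h.fuse_invTwist_of_twistRel hB hD hi d b
  rw [hpr, ← lTensor_fuse, ← LinearMap.comp_id (AlgOf.of hX).toLinearMap, ← lTensor_fuse,
    LinearMap.comp_id] at key
  exact (LinearEquiv.lTensor E (AlgOf.of hX)).injective key

/-- An algebra whose B and D exchange along T therefore has legs that exchange along T as well; this
is multiplicativity of the coaction on the mixed products of the crossed product. -/
theorem twistRel_leftLeg_rightLeg (h : DoubleMaps Q δC.coact δB.coact ev jC jH jB)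
    (hB : IsBraidedBialgebra Q δB.coact)
    (hD : IsBraidedRightComoduleAlgebra Q δC.coact δD.coact ρ) {iB : B →ₗ[k] X} {iD : D →ₗ[k] X}
    (hi : TwistRel iB iD (invTwist Q δB.coact δD.coact ev ρ)) :
    TwistRel (lTensor E iB ∘ₗ leftLeg Q jH jB δB.coact)
      (lTensor E iD ∘ₗ rightLeg Q jH jC δD.coact ρ)
      (invTwist Q δB.coact δD.coact ev ρ) := fun d b => by
  have e : pr iD iB = pr iB iD ∘ₗ invTwist Q δB.coact δD.coact ev ρ := LinearMap.ext hi.pr_eq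
  rw [comp_apply, comp_apply, ← fuse_pr, e, ← lTensor_fuse,
    h.fuse_invTwist hB hD, lTensor_fuse, LinearMap.comp_id, fuse_pr_map]

end DoubleMaps

end Core

/-! ### Multiplying in E while pairing the second tensor factors. -/

section FusePair

variable {k E E' V W : Type*} [Field k] [Ring E] [Algebra k E] [Ring E'] [Algebra k E']
  [AddCommGroup V] [Module k V] [AddCommGroup W] [Module k W]

/-- `(x ⊗ v) ⊗ (y ⊗ w) ↦ π (v ⊗ w) x y`, for a form `π`. -/
def fusePair (E : Type*) [Ring E] [Algebra k E] (π : V ⊗[k] W →ₗ[k] k) :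
    (E ⊗[k] V) ⊗[k] (E ⊗[k] W) →ₗ[k] E :=
  (TensorProduct.rid k E).toLinearMap ∘ₗ TensorProduct.map (mul' k E) π ∘ₗ
    (TensorProduct.tensorTensorTensorComm k E V E W).toLinearMap

@[simp] theorem fusePair_tmul (π : V ⊗[k] W →ₗ[k] k) (x y : E) (v : V) (w : W) :
    fusePair E π ((x ⊗ₜ v) ⊗ₜ (y ⊗ₜ w)) = π (v ⊗ₜ w) • (x * y) := by
  simp [fusePair]

theorem fusePair_assoc_symm (π : V ⊗[k] W →ₗ[k] k) (x y : E) (s : E' ⊗[k] V) (t : E' ⊗[k] W) :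
    fusePair (E ⊗[k] E') π ((TensorProduct.assoc k E E' V).symm (x ⊗ₜ s) ⊗ₜ
      (TensorProduct.assoc k E E' W).symm (y ⊗ₜ t)) = (x * y) ⊗ₜ fusePair E' π (s ⊗ₜ t) := by
  induction s with
  | zero => simp
  | add a b ha hb => simp only [map_add, add_tmul, tmul_add, ha, hb]
  | tmul z v =>
  induction t with
  | zero => simp
  | add a b ha hb => simp only [map_add, tmul_add, ha, hb]
  | tmul z' w => simp

theorem lTensor_rTensor_apply {V' E' : Type*} [AddCommGroup V'] [Module k V'] [AddCommGroup E']
    [Module k E'] (f : V →ₗ[k] V') (g : E →ₗ[k] E') (t : E ⊗[k] V) :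
    lTensor E' f (rTensor V g t) =
      rTensor V' g (lTensor E f t) := by
  rw [← comp_apply, ← comp_apply, LinearMap.lTensor_comp_rTensor,
    LinearMap.rTensor_comp_lTensor]

end FusePair

/-! ### Iterated legs and the coproduct relations of the double. -/

section IteratedLegs

variable {k A H : Type*} [Field k] [Ring A] [HopfAlgebra k A] [Ring H] [HopfAlgebra k H]
  {Q : WeakQuasitriangularPair k A H}
  {B C D E E' : Type*} [Ring B] [Algebra k B] [Coalgebra k B]
  [Ring C] [Algebra k C] [Coalgebra k C] [Ring D] [Algebra k D] [Ring E] [Algebra k E]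
  [Ring E'] [Algebra k E']
  {δB : LeftCoaction k A B} {δC : LeftCoaction k A C} {δD : LeftCoaction k A D}
  {ev : C ⊗[k] B →ₗ[k] k} {ρ : D →ₗ[k] D ⊗[k] C}
  {jC : C →ₗ[k] E} {jH : H →ₗ[k] E} {jB : B →ₗ[k] E}

theorem rightLeg_algHom (φ : E →ₐ[k] E') (jH : H →ₗ[k] E) (jC : C →ₗ[k] E)
    (δD : D →ₗ[k] A ⊗[k] D) (ρ : D →ₗ[k] D ⊗[k] C) :
    rightLeg Q (φ.toLinearMap ∘ₗ jH) (φ.toLinearMap ∘ₗ jC) δD ρ =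
      rTensor D φ.toLinearMap ∘ₗ rightLeg Q jH jC δD ρ := by
  have : mul' k E' ∘ₗ TensorProduct.map (φ.toLinearMap ∘ₗ jH) (φ.toLinearMap ∘ₗ jC) =
      φ.toLinearMap ∘ₗ mul' k E ∘ₗ TensorProduct.map jH jC := by
    ext h c
    simp
  simp only [rightLeg, this, LinearMap.rTensor_comp, LinearMap.comp_assoc]

theorem leftLeg_algHom (φ : E →ₐ[k] E') (jH : H →ₗ[k] E) (jB : B →ₗ[k] E)
    (δB : B →ₗ[k] A ⊗[k] B) :
    leftLeg Q (φ.toLinearMap ∘ₗ jH) (φ.toLinearMap ∘ₗ jB) δB =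
      rTensor B φ.toLinearMap ∘ₗ leftLeg Q jH jB δB := by
  have : mul' k E' ∘ₗ TensorProduct.map (φ.toLinearMap ∘ₗ jB) (φ.toLinearMap ∘ₗ jH) =
      φ.toLinearMap ∘ₗ mul' k E ∘ₗ TensorProduct.map jB jH := by
    ext h c
    simp
  simp only [leftLeg, this, LinearMap.rTensor_comp, LinearMap.comp_assoc]

theorem crossRelLeft_algHom (φ : E →ₐ[k] E') (jC : C →ₗ[k] E) (jB : B →ₗ[k] E)
    (δC : C →ₗ[k] A ⊗[k] C) (δB : B →ₗ[k] A ⊗[k] B) (ev : C ⊗[k] B →ₗ[k] k) (t : C ⊗[k] B) :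
    crossRelLeft Q (φ.toLinearMap ∘ₗ jC) (φ.toLinearMap ∘ₗ jB) δC δB ev t =
      φ (crossRelLeft Q jC jB δC δB ev t) :=
  (algHom_pr φ jB jC (braidInv Q δC δB (contract ev (TensorProduct.map Coalgebra.comul
    Coalgebra.comul t)))).symm

theorem crossRelRight_algHom (φ : E →ₐ[k] E') (jH : H →ₗ[k] E) (jC : C →ₗ[k] E) (jB : B →ₗ[k] E)
    (δC : C →ₗ[k] A ⊗[k] C) (δB : B →ₗ[k] A ⊗[k] B) (ev : C ⊗[k] B →ₗ[k] k) (c : C) (b : B) :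
    crossRelRight Q (φ.toLinearMap ∘ₗ jH) (φ.toLinearMap ∘ₗ jC) (φ.toLinearMap ∘ₗ jB) δC δB ev
      (c ⊗ₜ b) = φ (crossRelRight Q jH jC jB δC δB ev (c ⊗ₜ b)) := by
  simp only [crossRelRight, comp_apply, map_tmul, rightLeg_algHom,
    leftLeg_algHom, LinearEquiv.coe_coe]
  generalize rightLeg Q jH jC δC Coalgebra.comul c = s
  generalize leftLeg Q jH jB δB b = t
  induction s with
  | zero => simp
  | add a b ha hb => simp only [map_add, add_tmul, ha, hb]
  | tmul x c =>
  induction t with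
  | zero => simp
  | add a b ha hb => simp only [map_add, tmul_add, ha, hb]
  | tmul y b => simp

/-- The leg formed with the coproducts of the generators is the leg applied twice. This is both
coassociativity on C and D and an ingredient of the cross relation for the coproduct. -/
theorem assoc_rightLeg (hj : IsAlgMap (mul' k H) 1 jH) (jC : C →ₗ[k] E)
    (hD : IsBraidedRightComoduleAlgebra Q δC.coact δD.coact ρ) (d : D) :
    TensorProduct.assoc k E E D (rightLeg Q (legMap jH jH (cop k H))
      (lTensor E jC ∘ₗ rightLeg Q jH jC δC.coact Coalgebra.comul) δD.coact ρ d) =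
    lTensor E (rightLeg Q jH jC δD.coact ρ) (rightLeg Q jH jC δD.coact ρ d) := by
  let π : (H ⊗[k] D) ⊗[k] C →ₗ[k] E ⊗[k] D :=
    rTensor D (mul' k E ∘ₗ TensorProduct.map jH jC) ∘ₗ
      (TensorProduct.rightComm k H D C).toLinearMap
  have hc := Q.isCopBialgMap_Rinv.isCopCoaction δD
  have h1 : ∀ (s : H ⊗[k] D) (c : C), TensorProduct.assoc k E E D (rTensor D
      (mul' k (E ⊗[k] E) ∘ₗ TensorProduct.map (legMap jH jH (cop k H))
        (lTensor E jC ∘ₗ rightLeg Q jH jC δC.coact Coalgebra.comul))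
      (TensorProduct.rightComm k H D C (s ⊗ₜ c))) =
      fuse E π (rTensor (H ⊗[k] D) jH (TensorProduct.assoc k H H D
        (rTensor D (cop k H) s)) ⊗ₜ rightLeg Q jH jC δC.coact Coalgebra.comul c) := by
    intro s c
    induction s with
    | zero => simp
    | add a b ha hb => simp only [map_add, add_tmul, ha, hb]
    | tmul h d =>
      simp only [legMap, comp_apply, TensorProduct.rightComm_tmul,
        rTensor_tmul, map_tmul, LinearMap.mul'_apply]
      generalize cop k H h = s
      generalize rightLeg Q jH jC δC.coact Coalgebra.comul c = t
      induction s with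
      | zero => simp
      | add a b ha hb => simp only [map_add, add_tmul, add_mul, ha, hb]
      | tmul h d =>
      induction t with
      | zero => simp
      | add a b ha hb => simp only [map_add, tmul_add, add_tmul, mul_add, ha, hb]
      | tmul y b => simp [π]
  have h2 : ∀ t : D ⊗[k] C, TensorProduct.assoc k E E D (rTensor D
      (mul' k (E ⊗[k] E) ∘ₗ TensorProduct.map (legMap jH jH (cop k H))
        (lTensor E jC ∘ₗ rightLeg Q jH jC δC.coact Coalgebra.comul))
      (TensorProduct.rightComm k H D C (rTensor C (leg Q.Rinv δD.coact) t))) =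
      fuse E (π ∘ₗ rTensor C (leg Q.Rinv δD.coact)) (TensorProduct.map
        (rTensor D jH ∘ₗ leg Q.Rinv δD.coact)
        (rightLeg Q jH jC δC.coact Coalgebra.comul) t) := by
    intro t
    induction t with
    | zero => simp
    | add a b ha hb => simp only [map_add, ha, hb]
    | tmul d c =>
      have h3 := fuse_lTensor π (leg Q.Rinv δD.coact) LinearMap.id
        (rTensor D jH (leg Q.Rinv δD.coact d))
        (rightLeg Q jH jC δC.coact Coalgebra.comul c)
      rw [LinearMap.lTensor_id, LinearMap.id_apply] at h3
      rw [rTensor_tmul, h1, hc.coassoc, ← lTensor_rTensor_apply]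
      exact h3
  have h4 := h2 (ρ d)
  change _ = lTensor E ((π ∘ₗ rTensor C (leg Q.Rinv δD.coact)) ∘ₗ ρ) _
  rw [LinearMap.lTensor_comp_apply, lTensor_coact_rightLeg hj jC hD, lTensor_fuse,
    LinearMap.comp_id, ← h4]
  rfl

theorem assoc_leftLeg (hj : IsAlgMap (mul' k H) 1 jH) (jB : B →ₗ[k] E)
    (hB : IsBraidedBialgebra Q δB.coact) (b : B) :
    TensorProduct.assoc k E E B (leftLeg Q (legMap jH jH (cop k H))
      (lTensor E jB ∘ₗ leftLeg Q jH jB δB.coact) δB.coact b) =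
    lTensor E (leftLeg Q jH jB δB.coact) (leftLeg Q jH jB δB.coact b) := by
  let π : B ⊗[k] (H ⊗[k] B) →ₗ[k] E ⊗[k] B :=
    rTensor B (mul' k E ∘ₗ TensorProduct.map jB jH) ∘ₗ
      (TensorProduct.assoc k B H B).symm.toLinearMap
  have hc := Q.isCopBialgMap_Rbarinv.isCopCoaction δB
  have h1 : ∀ (s : H ⊗[k] B) (c : B), TensorProduct.assoc k E E B (rTensor B
      (mul' k (E ⊗[k] E) ∘ₗ TensorProduct.map
        (lTensor E jB ∘ₗ leftLeg Q jH jB δB.coact) (legMap jH jH (cop k H)))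
      ((TensorProduct.assoc k B H B).symm (c ⊗ₜ s))) =
      fuse E π (leftLeg Q jH jB δB.coact c ⊗ₜ rTensor (H ⊗[k] B) jH
        (TensorProduct.assoc k H H B (rTensor B (cop k H) s))) := by
    intro s c
    induction s with
    | zero => simp
    | add a b ha hb => simp only [map_add, tmul_add, ha, hb]
    | tmul h d =>
      simp only [legMap, comp_apply, TensorProduct.assoc_symm_tmul,
        rTensor_tmul, map_tmul, LinearMap.mul'_apply]
      generalize cop k H h = s
      generalize leftLeg Q jH jB δB.coact c = t
      induction s with
      | zero => simp
      | add a b ha hb => simp only [map_add, tmul_add, add_tmul, mul_add, ha, hb]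
      | tmul h d =>
      induction t with
      | zero => simp
      | add a b ha hb => simp only [map_add, add_tmul, add_mul, ha, hb]
      | tmul y b => simp [π]
  have h2 : ∀ t : B ⊗[k] B, TensorProduct.assoc k E E B (rTensor B
      (mul' k (E ⊗[k] E) ∘ₗ TensorProduct.map
        (lTensor E jB ∘ₗ leftLeg Q jH jB δB.coact) (legMap jH jH (cop k H)))
      ((TensorProduct.assoc k B H B).symm (lTensor B (leg Q.Rbarinv δB.coact) t))) =
      fuse E (π ∘ₗ lTensor B (leg Q.Rbarinv δB.coact)) (TensorProduct.map
        (leftLeg Q jH jB δB.coact) (rTensor B jH ∘ₗ leg Q.Rbarinv δB.coact) t) := by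
    intro t
    induction t with
    | zero => simp
    | add a b ha hb => simp only [map_add, ha, hb]
    | tmul d c =>
      have h3 := fuse_lTensor π LinearMap.id (leg Q.Rbarinv δB.coact)
        (leftLeg Q jH jB δB.coact d) (rTensor B jH (leg Q.Rbarinv δB.coact c))
      rw [LinearMap.lTensor_id, LinearMap.id_apply] at h3
      rw [lTensor_tmul, h1, hc.coassoc, ← lTensor_rTensor_apply]
      exact h3
  have h4 := h2 (Coalgebra.comul b)
  change _ = lTensor E ((π ∘ₗ lTensor B (leg Q.Rbarinv δB.coact)) ∘ₗ
    Coalgebra.comul) _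
  rw [LinearMap.lTensor_comp_apply, lTensor_comul_leftLeg hj jB hB, lTensor_fuse,
    LinearMap.comp_id, ← h4]
  rfl

/-- The coproduct of the braided Drinfeld double, on the generators. -/
theorem DoubleMaps.comul (h : DoubleMaps Q δC.coact δB.coact ev jC jH jB)
    (hB : IsBraidedBialgebra Q δB.coact) (hC : IsBraidedBialgebra Q δC.coact) :
    DoubleMaps Q δC.coact δB.coact ev
      (lTensor E jC ∘ₗ rightLeg Q jH jC δC.coact Coalgebra.comul)
      (legMap jH jH (cop k H)) (lTensor E jB ∘ₗ leftLeg Q jH jB δB.coact) where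
  algC := h.isAlgMap_rightLeg hC.isBraidedRightComoduleAlgebra h.algC
  algH := h.isAlgMap_legMap_cop h.algH
  algB := h.isAlgMap_leftLeg hB h.algB
  actB := h.twistRel_leftLeg hB h.actB
  actC := h.twistRel_rightLeg hC.isBraidedRightComoduleAlgebra h.actC
  cross c b := by
    have hC' := hC.isBraidedRightComoduleAlgebra
    have hcross : crossRelRight Q jH jC jB δC.coact δB.coact ev =
        crossRelLeft Q jC jB δC.coact δB.coact ev :=
      TensorProduct.ext' fun c b => (h.cross c b).symm
    -- By coassociativity of the legs, the right side of the cross relation in E ⊗ E is the same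
    -- expression in the second factor E, fused with legs in the first; there the relation of E
    -- applies.
    have h1 : ∀ (s : E ⊗[k] C) (t : E ⊗[k] B), fusePair (E ⊗[k] E) ev
          ((TensorProduct.assoc k E E C).symm (lTensor E
              (rightLeg Q jH jC δC.coact Coalgebra.comul) s) ⊗ₜ
            (TensorProduct.assoc k E E B).symm (lTensor E
              (leftLeg Q jH jB δB.coact) t)) =
        lTensor E (crossRelRight Q jH jC jB δC.coact δB.coact ev)
          (fuse E LinearMap.id (s ⊗ₜ t)) := by
      intro s t
      induction s with
      | zero => simp
      | add a b ha hb => simp only [map_add, add_tmul, ha, hb]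
      | tmul x c =>
      induction t with
      | zero => simp
      | add a b ha hb => simp only [map_add, tmul_add, ha, hb]
      | tmul y b =>
        rw [lTensor_tmul, lTensor_tmul, fusePair_assoc_symm, fuse_tmul,
          lTensor_tmul]
        rfl
    have h2 := h1 (rightLeg Q jH jC δC.coact Coalgebra.comul c) (leftLeg Q jH jB δB.coact b)
    rw [← assoc_rightLeg h.algH jC hC', ← assoc_leftLeg h.algH jB hB, LinearEquiv.symm_apply_apply,
      LinearEquiv.symm_apply_apply, hcross, lTensor_fuse, LinearMap.comp_id] at h2
    refine Eq.trans ?_ h2.symm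
    -- For D = C and ρ = Δ_C, the left side of the cross relation is by definition multiplication
    -- after T.
    have h3 := h.fuse_invTwist hB hC' c b
    change _ = fuse E (pr jB jC ∘ₗ invTwist Q δB.coact δC.coact ev Coalgebra.comul) _
    rw [← lTensor_fuse, h3, lTensor_fuse, LinearMap.comp_id, fuse_pr_map]
    rfl

end IteratedLegs

/-! ### Transport of coassociativity and counit laws along a map. -/

section CoactionTransport

variable {k E V X : Type*} [Field k] [AddCommGroup E] [Module k E] [AddCommGroup V] [Module k V]
  [AddCommGroup X] [Module k X] {Δ : E →ₗ[k] E ⊗[k] E} {ε : E →ₗ[k] k}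
  {ℓ : V →ₗ[k] E ⊗[k] V} {δ : X →ₗ[k] E ⊗[k] X} {i : V →ₗ[k] X}

/-- Applied to the inclusion i of a family of generators with its own leg ℓ, so that coassociativity
of δ need only be known for ℓ. -/
theorem coassoc_of_intertwine (hδ : δ ∘ₗ i = lTensor E i ∘ₗ ℓ) {v : V}
    (hℓ : TensorProduct.assoc k E E V (rTensor V Δ (ℓ v)) = lTensor E ℓ (ℓ v)) :
    TensorProduct.assoc k E E X (rTensor X Δ (δ (i v))) =
      lTensor E δ (δ (i v)) := by
  have h1 : ∀ t : E ⊗[k] V, TensorProduct.assoc k E E X (rTensor X Δ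
      (lTensor E i t)) = lTensor E (lTensor E i)
        (TensorProduct.assoc k E E V (rTensor V Δ t)) := by
    intro t
    induction t with
    | zero => simp
    | add a b ha hb => simp only [map_add, ha, hb]
    | tmul x v =>
      simp only [lTensor_tmul, rTensor_tmul]
      generalize Δ x = t
      induction t with
      | zero => simp
      | add a b ha hb => simp only [map_add, add_tmul, ha, hb]
      | tmul x y => simp
  have h2 := LinearMap.congr_fun hδ v
  simp only [comp_apply] at h2
  rw [h2, h1, hℓ, ← LinearMap.lTensor_comp_apply, ← LinearMap.lTensor_comp_apply, hδ]

theorem counit_of_intertwine (hδ : δ ∘ₗ i = lTensor E i ∘ₗ ℓ) {v : V}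
    (hℓ : TensorProduct.lid k V (rTensor V ε (ℓ v)) = v) :
    TensorProduct.lid k X (rTensor X ε (δ (i v))) = i v := by
  have h1 : ∀ t : E ⊗[k] V, TensorProduct.lid k X (rTensor X ε
      (lTensor E i t)) = i (TensorProduct.lid k V (rTensor V ε t)) := by
    intro t
    induction t with
    | zero => simp
    | add a b ha hb => simp only [map_add, ha, hb]
    | tmul x v => simp
  have h2 := LinearMap.congr_fun hδ v
  simp only [comp_apply] at h2
  rw [h2, h1, hℓ]

end CoactionTransport

/-! ### Counits of the legs and of the double. -/

section Counits

variable {k A H : Type*} [Field k] [Ring A] [HopfAlgebra k A] [Ring H] [HopfAlgebra k H]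
  {Q : WeakQuasitriangularPair k A H}
  {B C D E : Type*} [Ring B] [Algebra k B] [Coalgebra k B]
  [Ring C] [Algebra k C] [Coalgebra k C] [Ring D] [Algebra k D] [Ring E] [Algebra k E]
  {δB : LeftCoaction k A B} {δC : LeftCoaction k A C} {δD : LeftCoaction k A D}
  {ev : C ⊗[k] B →ₗ[k] k} {ρ : D →ₗ[k] D ⊗[k] C}
  {jC : C →ₗ[k] E} {jH : H →ₗ[k] E} {jB : B →ₗ[k] E}

theorem lid_rightLeg_counit (hD : IsBraidedRightComoduleAlgebra Q δC.coact δD.coact ρ) (d : D) :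
    TensorProduct.lid k D (rightLeg Q Coalgebra.counit Coalgebra.counit δD.coact ρ d) = d := by
  have h1 : ∀ (s : H ⊗[k] D) (c : C), TensorProduct.lid k D (rTensor D
      (mul' k k ∘ₗ TensorProduct.map Coalgebra.counit Coalgebra.counit)
        (TensorProduct.rightComm k H D C (s ⊗ₜ c))) =
      Coalgebra.counit (R := k) c •
        TensorProduct.lid k D (rTensor D Coalgebra.counit s) := by
    intro s c
    induction s with
    | zero => simp
    | add a b ha hb => simp only [map_add, add_tmul, smul_add, ha, hb]
    | tmul x v => simp [smul_smul, mul_comm]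
  have h2 : ∀ t : D ⊗[k] C, TensorProduct.lid k D (rTensor D
      (mul' k k ∘ₗ TensorProduct.map Coalgebra.counit Coalgebra.counit)
        (TensorProduct.rightComm k H D C (rTensor C (leg Q.Rinv δD.coact) t))) =
      TensorProduct.rid k D (lTensor D Coalgebra.counit t) := by
    intro t
    induction t with
    | zero => simp
    | add a b ha hb => simp only [map_add, ha, hb]
    | tmul d c =>
      rw [rTensor_tmul, h1, (Q.isCopBialgMap_Rinv.isCopCoaction δD).counit]
      simp
  exact (h2 (ρ d)).trans (LinearMap.congr_fun hD.counit d)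

theorem lid_leftLeg_counit (b : B) :
    TensorProduct.lid k B (leftLeg Q Coalgebra.counit Coalgebra.counit δB.coact b) = b := by
  have h1 : ∀ (s : H ⊗[k] B) (b : B), TensorProduct.lid k B (rTensor B
      (mul' k k ∘ₗ TensorProduct.map Coalgebra.counit Coalgebra.counit)
        ((TensorProduct.assoc k B H B).symm (b ⊗ₜ s))) =
      Coalgebra.counit (R := k) b •
        TensorProduct.lid k B (rTensor B Coalgebra.counit s) := by
    intro s c
    induction s with
    | zero => simp
    | add a b ha hb => simp only [map_add, tmul_add, smul_add, ha, hb]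
    | tmul x v => simp [smul_smul]
  have h2 : ∀ t : B ⊗[k] B, TensorProduct.lid k B (rTensor B
      (mul' k k ∘ₗ TensorProduct.map Coalgebra.counit Coalgebra.counit)
        ((TensorProduct.assoc k B H B).symm (lTensor B (leg Q.Rbarinv δB.coact) t))) =
      TensorProduct.lid k B (rTensor B Coalgebra.counit t) := by
    intro t
    induction t with
    | zero => simp
    | add a b ha hb => simp only [map_add, ha, hb]
    | tmul d c =>
      rw [lTensor_tmul, h1, (Q.isCopBialgMap_Rbarinv.isCopCoaction δB).counit]
      simp
  refine (h2 (Coalgebra.comul b)).trans ?_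
  rw [Coalgebra.rTensor_counit_comul]
  simp

theorem leg_counit (hB : IsBraidedBialgebra Q δB.coact) {f : A →ₗ[k] H} (hf : f 1 = 1) (b : B) :
    lTensor H Coalgebra.counit (leg f δB.coact b) =
      1 ⊗ₜ[k] (Coalgebra.counit b : k) := by
  rw [leg, comp_apply, lTensor_rTensor_apply, hB.counit_colinear, rTensor_tmul,
    hf]

/-- The counit on the second factor is colinear, so it trivialises the coaction and R⁻¹(1) = 1
disappears; the remaining term is the counit law of C. -/
theorem lTensor_counit_rightLeg (hC : IsBraidedBialgebra Q δC.coact) (hj : jH 1 = 1)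
    (jC : C →ₗ[k] E) (c : C) :
    lTensor E Coalgebra.counit (rightLeg Q jH jC δC.coact Coalgebra.comul c) =
      jC c ⊗ₜ[k] (1 : k) := by
  have h1 : ∀ (s : H ⊗[k] C) (c : C), lTensor E Coalgebra.counit (rTensor C
      (mul' k E ∘ₗ TensorProduct.map jH jC) (TensorProduct.rightComm k H C C (s ⊗ₜ c))) =
      rTensor k (mul' k E ∘ₗ TensorProduct.map jH jC)
        (TensorProduct.rightComm k H k C (lTensor H Coalgebra.counit s ⊗ₜ c)) := by
    intro s c
    induction s with
    | zero => simp
    | add a b ha hb => simp only [map_add, add_tmul, ha, hb]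
    | tmul x v => simp
  have h2 : ∀ t : C ⊗[k] C, lTensor E Coalgebra.counit (rTensor C
      (mul' k E ∘ₗ TensorProduct.map jH jC)
        (TensorProduct.rightComm k H C C (rTensor C (leg Q.Rinv δC.coact) t))) =
      jC (TensorProduct.lid k C (rTensor C Coalgebra.counit t)) ⊗ₜ[k] (1 : k) := by
    intro t
    induction t with
    | zero => simp
    | add a b ha hb => simp only [map_add, add_tmul, ha, hb]
    | tmul d c =>
      rw [rTensor_tmul, h1, leg_counit hC Q.isCopBialgMap_Rinv.map_one]
      simp [hj, smul_tmul]
  refine (h2 (Coalgebra.comul c)).trans ?_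
  rw [Coalgebra.rTensor_counit_comul]
  simp

theorem lTensor_counit_leftLeg (hB : IsBraidedBialgebra Q δB.coact) (hj : jH 1 = 1)
    (jB : B →ₗ[k] E) (b : B) :
    lTensor E Coalgebra.counit (leftLeg Q jH jB δB.coact b) = jB b ⊗ₜ[k] (1 : k) := by
  have h1 : ∀ (s : H ⊗[k] B) (c : B), lTensor E Coalgebra.counit (rTensor B
      (mul' k E ∘ₗ TensorProduct.map jB jH)
        ((TensorProduct.assoc k B H B).symm (c ⊗ₜ s))) =
      rTensor k (mul' k E ∘ₗ TensorProduct.map jB jH)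
        ((TensorProduct.assoc k B H k).symm (c ⊗ₜ lTensor H Coalgebra.counit s)) := by
    intro s c
    induction s with
    | zero => simp
    | add a b ha hb => simp only [map_add, tmul_add, ha, hb]
    | tmul x v => simp
  have h2 : ∀ t : B ⊗[k] B, lTensor E Coalgebra.counit (rTensor B
      (mul' k E ∘ₗ TensorProduct.map jB jH)
        ((TensorProduct.assoc k B H B).symm (lTensor B (leg Q.Rbarinv δB.coact) t))) =
      jB (TensorProduct.rid k B (lTensor B Coalgebra.counit t)) ⊗ₜ[k] (1 : k) := by
    intro t
    induction t with
    | zero => simp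
    | add a b ha hb => simp only [map_add, add_tmul, ha, hb]
    | tmul d c =>
      rw [lTensor_tmul, h1, leg_counit hB Q.isCopBialgMap_Rbarinv.map_one]
      simp [hj, smul_tmul]
  refine (h2 (Coalgebra.comul b)).trans ?_
  rw [Coalgebra.lTensor_counit_comul]
  simp

/-- The counit is H-linear into the unit object, hence blind to crossings. -/
theorem pr_counit_cbr {X : Type*} [AddCommGroup X] [Module k X] (hB : IsBraidedBialgebra Q δB.coact)
    {ℓ : X →ₗ[k] H ⊗[k] X} (hℓ : IsCopCoaction ℓ) (g : X →ₗ[k] k) (x : X) (b : B) :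
    pr Coalgebra.counit g (cbr ℓ (act Q.pair δB.coact) (x ⊗ₜ b)) =
      g x * Coalgebra.counit (R := k) b := by
  have h1 := cbr_map_right ℓ (hB.isColinear_counit.isHLinear Q.pair) x b
  rw [cbr_trivCoact Q.pairing hℓ] at h1
  have h2 := pr_map (LinearMap.id : k →ₗ[k] k) g Coalgebra.counit LinearMap.id
    (cbr ℓ (act Q.pair δB.coact) (x ⊗ₜ b))
  rw [← LinearMap.rTensor_def, ← h1] at h2
  rw [mul_comm]
  exact h2.symm.trans (by simp)

/-- Once crossings are invisible, the exchange relations hold by commutativity of the field, and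
both sides of the cross relation reduce to ev(c, b). -/
theorem DoubleMaps.counit (hB : IsBraidedBialgebra Q δB.coact)
    (hC : IsBraidedBialgebra Q δC.coact) (ev : C ⊗[k] B →ₗ[k] k) :
    DoubleMaps Q δC.coact δB.coact ev (Coalgebra.counit : C →ₗ[k] k)
      (Coalgebra.counit : H →ₗ[k] k) (Coalgebra.counit : B →ₗ[k] k) where
  algC := ⟨hC.counit_mul, hC.counit_one⟩
  algH := ⟨Bialgebra.counit_mul, Bialgebra.counit_one⟩
  algB := ⟨hB.counit_mul, hB.counit_one⟩
  actB h b := by rw [smashTwist_eq_cbr, pr_counit_cbr hB isCopCoaction_cop]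
  actC h c := by rw [smashTwist_eq_cbr, pr_counit_cbr hC isCopCoaction_cop]
  cross c b := by
    have h1 : ∀ (s : k ⊗[k] C) (t : k ⊗[k] B), fusePair k ev (s ⊗ₜ t) =
        ev (TensorProduct.lid k C s ⊗ₜ TensorProduct.lid k B t) := by
      intro s t
      induction s with
      | zero => simp
      | add a b ha hb => simp only [map_add, add_tmul, ha, hb]
      | tmul x c =>
      induction t with
      | zero => simp
      | add a b ha hb => simp only [map_add, tmul_add, ha, hb]
      | tmul y b => simp [← smul_tmul', mul_comm, mul_left_comm, mul_assoc]
    have h2 : ∀ t : C ⊗[k] B, pr (Coalgebra.counit : B →ₗ[k] k) (Coalgebra.counit : C →ₗ[k] k)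
        (braidInv Q δC.coact δB.coact t) = pr Coalgebra.counit Coalgebra.counit t := by
      intro t
      induction t with
      | zero => simp
      | add a b ha hb => simp only [map_add, ha, hb]
      | tmul c b =>
        rw [braidInv_eq_cbr, pr_counit_cbr hB (Q.isCopBialgMap_Rinv.isCopCoaction δC), pr_tmul]
    have h3 : ∀ (s : C ⊗[k] C) (t : B ⊗[k] B),
        pr (Coalgebra.counit : C →ₗ[k] k) (Coalgebra.counit : B →ₗ[k] k) (contract ev (s ⊗ₜ t)) =
        ev (TensorProduct.lid k C (rTensor C Coalgebra.counit s) ⊗ₜ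
          TensorProduct.rid k B (lTensor B Coalgebra.counit t)) := by
      intro s t
      induction s with
      | zero => simp
      | add a b ha hb => simp only [map_add, add_tmul, ha, hb]
      | tmul x c =>
      induction t with
      | zero => simp
      | add a b ha hb => simp only [map_add, tmul_add, ha, hb]
      | tmul y b => simp [contract_tmul, ← smul_tmul', mul_comm, mul_assoc]
    have h4 := h1 (rightLeg Q Coalgebra.counit Coalgebra.counit δC.coact Coalgebra.comul c)
      (leftLeg Q Coalgebra.counit Coalgebra.counit δB.coact b)
    rw [lid_rightLeg_counit hC.isBraidedRightComoduleAlgebra, lid_leftLeg_counit] at h4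
    refine Eq.trans ?_ h4.symm
    refine (h2 _).trans ?_
    rw [comp_apply, map_tmul, h3, Coalgebra.rTensor_counit_comul,
      Coalgebra.lTensor_counit_comul]
    simp

end Counits

/-! ### Universal property of the double. -/

section DoubleAlgebra

variable {k A H : Type*} [Field k] [Ring A] [HopfAlgebra k A] [Ring H] [HopfAlgebra k H]
  {Q : WeakQuasitriangularPair k A H}
  {B C E : Type*} [Ring B] [Algebra k B] [Coalgebra k B]
  [Ring C] [Algebra k C] [Coalgebra k C] [Ring E] [Algebra k E]
  {δB : B →ₗ[k] A ⊗[k] B} {δC : C →ₗ[k] A ⊗[k] C}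
  {ev : C ⊗[k] B →ₗ[k] k}
  {jC : C →ₗ[k] E} {jH : H →ₗ[k] E} {jB : B →ₗ[k] E}

theorem Drin.hom_ext {f g : Drin Q δC δB ev →ₐ[k] E}
    (hC : ∀ c, f (Drin.inC Q δC δB ev c) = g (Drin.inC Q δC δB ev c))
    (hH : ∀ h, f (Drin.inH Q δC δB ev h) = g (Drin.inH Q δC δB ev h))
    (hB : ∀ b, f (Drin.inB Q δC δB ev b) = g (Drin.inB Q δC δB ev b)) : f = g := by
  apply RingQuot.ringQuot_ext'
  apply TensorAlgebra.hom_ext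
  apply LinearMap.prod_ext
  · exact LinearMap.ext hC
  · apply LinearMap.prod_ext
    · exact LinearMap.ext hH
    · exact LinearMap.ext hB

variable (Q δC δB ev) in
theorem Drin.doubleMaps : DoubleMaps Q δC δB ev (Drin.inC Q δC δB ev) (Drin.inH Q δC δB ev)
    (Drin.inB Q δC δB ev) where
  algC := ⟨fun c c' => (RingQuot.mkAlgHom_rel k (.mulC c c')).trans (map_mul _ _ _),
    (RingQuot.mkAlgHom_rel k .oneC).trans (map_one _)⟩
  algH := ⟨fun c c' => (RingQuot.mkAlgHom_rel k (.mulH c c')).trans (map_mul _ _ _),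
    (RingQuot.mkAlgHom_rel k .oneH).trans (map_one _)⟩
  algB := ⟨fun c c' => (RingQuot.mkAlgHom_rel k (.mulB c c')).trans (map_mul _ _ _),
    (RingQuot.mkAlgHom_rel k .oneB).trans (map_one _)⟩
  actB h b := ((map_mul _ _ _).symm.trans (RingQuot.mkAlgHom_rel k (.actB h b))).trans
    (algHom_pr _ _ _ _)
  actC h c := ((map_mul _ _ _).symm.trans (RingQuot.mkAlgHom_rel k (.actC h c))).trans
    (algHom_pr _ _ _ _)
  cross c b := by
    have := RingQuot.mkAlgHom_rel k (DrinRel.cross (Q := Q) (δC := δC) (δB := δB) (ev := ev) c b)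
    rw [← crossRelLeft_algHom, ← crossRelRight_algHom] at this
    exact this

/-- The algebra map from the braided Drinfeld double determined by its values on the generators. -/
def DoubleMaps.lift (h : DoubleMaps Q δC δB ev jC jH jB) : Drin Q δC δB ev →ₐ[k] E :=
  RingQuot.liftAlgHom k ⟨TensorAlgebra.lift k (jC.coprod (jH.coprod jB)), by
    set φ := TensorAlgebra.lift k (jC.coprod (jH.coprod jB))
    have eC : φ.toLinearMap ∘ₗ genC k C H B = jC := by ext c; simp [φ, genC]
    have eH : φ.toLinearMap ∘ₗ genH k C H B = jH := by ext c; simp [φ, genH]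
    have eB : φ.toLinearMap ∘ₗ genB k C H B = jB := by ext c; simp [φ, genB]
    have eC' : ∀ c, φ (genC k C H B c) = jC c := LinearMap.congr_fun eC
    have eH' : ∀ c, φ (genH k C H B c) = jH c := LinearMap.congr_fun eH
    have eB' : ∀ c, φ (genB k C H B c) = jB c := LinearMap.congr_fun eB
    intro x y r
    cases r with
    | mulC c c' => rw [map_mul φ, eC', eC', eC']; exact h.algC.map_mul c c'
    | oneC => rw [map_one φ, eC']; exact h.algC.map_one
    | mulH c c' => rw [map_mul φ, eH', eH', eH']; exact h.algH.map_mul c c'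
    | oneH => rw [map_one φ, eH']; exact h.algH.map_one
    | mulB c c' => rw [map_mul φ, eB', eB', eB']; exact h.algB.map_mul c c'
    | oneB => rw [map_one φ, eB']; exact h.algB.map_one
    | actB g b =>
      rw [map_mul φ, eH', eB', h.actB g b]
      exact ((algHom_pr φ _ _ _).trans (by rw [eB, eH])).symm
    | actC g b =>
      rw [map_mul φ, eH', eC', h.actC g b]
      exact ((algHom_pr φ _ _ _).trans (by rw [eC, eH])).symm
    | cross c b =>
      rw [← crossRelLeft_algHom, ← crossRelRight_algHom, eC, eB, eH]
      exact h.cross c b⟩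

@[simp] theorem DoubleMaps.lift_inC (h : DoubleMaps Q δC δB ev jC jH jB) (c : C) :
    h.lift (Drin.inC Q δC δB ev c) = jC c := by
  simp [DoubleMaps.lift, Drin.inC, genC]

@[simp] theorem DoubleMaps.lift_inH (h : DoubleMaps Q δC δB ev jC jH jB) (c : H) :
    h.lift (Drin.inH Q δC δB ev c) = jH c := by
  simp [DoubleMaps.lift, Drin.inH, genH]

@[simp] theorem DoubleMaps.lift_inB (h : DoubleMaps Q δC δB ev jC jH jB) (c : B) :
    h.lift (Drin.inB Q δC δB ev c) = jB c := by
  simp [DoubleMaps.lift, Drin.inB, genB]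

end DoubleAlgebra

/-! ### Coaction axioms as equalities of algebra maps. -/

section CoactionHoms

variable {k E X V : Type*} [Field k] [Ring E] [Algebra k E] [Ring X] [Algebra k X]
  [AddCommGroup V] [Module k V]

/-- `(Δ ⊗ id) δ`, as an algebra map. -/
def coassocLeft (Δ : E →ₐ[k] E ⊗[k] E) (δ : X →ₐ[k] E ⊗[k] X) : X →ₐ[k] E ⊗[k] (E ⊗[k] X) :=
  (Algebra.TensorProduct.assoc k k k E E X).toAlgHom.comp
    ((Algebra.TensorProduct.map Δ (AlgHom.id k X)).comp δ)

/-- `(id ⊗ δ) δ`, as an algebra map. -/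
def coassocRight (δ : X →ₐ[k] E ⊗[k] X) : X →ₐ[k] E ⊗[k] (E ⊗[k] X) :=
  (Algebra.TensorProduct.map (AlgHom.id k E) δ).comp δ

/-- `(ε ⊗ id) δ`, as an algebra map. -/
def counitLeft (ε : E →ₐ[k] k) (δ : X →ₐ[k] E ⊗[k] X) : X →ₐ[k] X :=
  (Algebra.TensorProduct.lid k X).toAlgHom.comp
    ((Algebra.TensorProduct.map ε (AlgHom.id k X)).comp δ)

/-- `(id ⊗ ε) Δ`, as an algebra map. -/
def counitRight (ε : E →ₐ[k] k) (Δ : E →ₐ[k] E ⊗[k] E) : E →ₐ[k] E :=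
  (Algebra.TensorProduct.rid k k E).toAlgHom.comp
    ((Algebra.TensorProduct.map (AlgHom.id k E) ε).comp Δ)

theorem counitRight_apply (ε : E →ₐ[k] k) (Δ : E →ₐ[k] E ⊗[k] E) (x : E) :
    counitRight ε Δ x = TensorProduct.rid k E (lTensor E ε.toLinearMap (Δ x)) := rfl

variable {Δ : E →ₐ[k] E ⊗[k] E} {ε : E →ₐ[k] k} {δ : X →ₐ[k] E ⊗[k] X} {ℓ : V →ₗ[k] E ⊗[k] V}
  {i : V →ₗ[k] X}

theorem coassocLeft_of_intertwine (hδ : δ.toLinearMap ∘ₗ i = lTensor E i ∘ₗ ℓ) {v : V}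
    (hℓ : TensorProduct.assoc k E E V (rTensor V Δ.toLinearMap (ℓ v)) =
      lTensor E ℓ (ℓ v)) :
    coassocLeft Δ δ (i v) = coassocRight δ (i v) :=
  coassoc_of_intertwine hδ hℓ

theorem counitLeft_of_intertwine (hδ : δ.toLinearMap ∘ₗ i = lTensor E i ∘ₗ ℓ) {v : V}
    (hℓ : TensorProduct.lid k V (rTensor V ε.toLinearMap (ℓ v)) = v) :
    counitLeft ε δ (i v) = i v :=
  counit_of_intertwine hδ hℓ

end CoactionHoms

/-! ### The coaction axioms on generators. -/

section LegCoactions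

variable {k A H : Type*} [Field k] [Ring A] [HopfAlgebra k A] [Ring H] [HopfAlgebra k H]
  {Q : WeakQuasitriangularPair k A H}
  {B C D E : Type*} [Ring B] [Algebra k B] [Coalgebra k B]
  [Ring C] [Algebra k C] [Coalgebra k C] [Ring D] [Algebra k D] [Ring E] [Algebra k E]
  {δB : LeftCoaction k A B} {δC : LeftCoaction k A C} {δD : LeftCoaction k A D}
  {ρ : D →ₗ[k] D ⊗[k] C}
  {jC : C →ₗ[k] E} {jH : H →ₗ[k] E} {jB : B →ₗ[k] E} {Δ : E →ₐ[k] E ⊗[k] E} {ε : E →ₐ[k] k}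

theorem coassoc_rightLeg (hj : IsAlgMap (mul' k H) 1 jH)
    (hD : IsBraidedRightComoduleAlgebra Q δC.coact δD.coact ρ)
    (hH : Δ.toLinearMap ∘ₗ jH = legMap jH jH (cop k H))
    (hC : Δ.toLinearMap ∘ₗ jC =
      lTensor E jC ∘ₗ rightLeg Q jH jC δC.coact Coalgebra.comul) (d : D) :
    TensorProduct.assoc k E E D (rTensor D Δ.toLinearMap
      (rightLeg Q jH jC δD.coact ρ d)) =
    lTensor E (rightLeg Q jH jC δD.coact ρ) (rightLeg Q jH jC δD.coact ρ d) := by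
  rw [← assoc_rightLeg hj jC hD, ← comp_apply (rTensor D _),
    ← rightLeg_algHom, hH, hC]

theorem coassoc_leftLeg (hj : IsAlgMap (mul' k H) 1 jH)
    (hB : IsBraidedBialgebra Q δB.coact)
    (hH : Δ.toLinearMap ∘ₗ jH = legMap jH jH (cop k H))
    (hB' : Δ.toLinearMap ∘ₗ jB = lTensor E jB ∘ₗ leftLeg Q jH jB δB.coact) (b : B) :
    TensorProduct.assoc k E E B (rTensor B Δ.toLinearMap
      (leftLeg Q jH jB δB.coact b)) =
    lTensor E (leftLeg Q jH jB δB.coact) (leftLeg Q jH jB δB.coact b) := by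
  rw [← assoc_leftLeg hj jB hB, ← comp_apply (rTensor B _),
    ← leftLeg_algHom, hH, hB']

theorem coassoc_rTensor_cop (hH : Δ.toLinearMap ∘ₗ jH = legMap jH jH (cop k H)) (h : H) :
    TensorProduct.assoc k E E H (rTensor H Δ.toLinearMap
      (rTensor H jH (cop k H h))) =
    lTensor E (rTensor H jH ∘ₗ cop k H)
      (rTensor H jH (cop k H h)) := by
  have h1 : ∀ t : H ⊗[k] H, TensorProduct.assoc k E E H (rTensor H
      (legMap jH jH (cop k H)) t) = TensorProduct.map jH (rTensor H jH)
        (TensorProduct.assoc k H H H (rTensor H (cop k H) t)) := by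
    intro t
    induction t with
    | zero => simp
    | add a b ha hb => simp only [map_add, ha, hb]
    | tmul x v =>
      simp only [rTensor_tmul, legMap, comp_apply]
      generalize cop k H x = t
      induction t with
      | zero => simp
      | add a b ha hb => simp only [map_add, add_tmul, ha, hb]
      | tmul x y => simp
  rw [← LinearMap.rTensor_comp_apply, hH, h1, isCopCoaction_cop.coassoc]
  generalize cop k H h = t
  induction t with
  | zero => simp
  | add a b ha hb => simp only [map_add, ha, hb]
  | tmul x y => simp

theorem counit_rightLeg (hD : IsBraidedRightComoduleAlgebra Q δC.coact δD.coact ρ)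
    (hH : ε.toLinearMap ∘ₗ jH = Coalgebra.counit) (hC : ε.toLinearMap ∘ₗ jC = Coalgebra.counit)
    (d : D) :
    TensorProduct.lid k D (rTensor D ε.toLinearMap (rightLeg Q jH jC δD.coact ρ d)) =
      d := by
  rw [← comp_apply (rTensor D _), ← rightLeg_algHom, hH, hC,
    lid_rightLeg_counit hD]

theorem counit_leftLeg (hH : ε.toLinearMap ∘ₗ jH = Coalgebra.counit)
    (hB : ε.toLinearMap ∘ₗ jB = Coalgebra.counit) (b : B) :
    TensorProduct.lid k B (rTensor B ε.toLinearMap (leftLeg Q jH jB δB.coact b)) = b := by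
  rw [← comp_apply (rTensor B _), ← leftLeg_algHom, hH, hB,
    lid_leftLeg_counit]

theorem counit_rTensor_cop (hH : ε.toLinearMap ∘ₗ jH = Coalgebra.counit) (h : H) :
    TensorProduct.lid k H (rTensor H ε.toLinearMap
      (rTensor H jH (cop k H h))) = h := by
  rw [← LinearMap.rTensor_comp_apply, hH, isCopCoaction_cop.counit]

theorem legMap_eq_lTensor {X : Type*} [Ring X] [Algebra k X] (i : H →ₗ[k] X) (jH : H →ₗ[k] E) :
    legMap jH i (cop k H) = lTensor E i ∘ₗ rTensor H jH ∘ₗ cop k H := by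
  rw [← LinearMap.comp_assoc, LinearMap.lTensor_comp_rTensor]
  rfl

theorem lTensor_counit_cop (h : H) :
    lTensor H Coalgebra.counit (cop k H h) = h ⊗ₜ[k] (1 : k) := by
  have := Coalgebra.rTensor_counit_comul (R := k) h
  apply (TensorProduct.comm k H k).injective
  rw [TensorProduct.comm_tmul, ← this]
  simp only [cop, comp_apply, LinearEquiv.coe_coe]
  generalize (Coalgebra.comul h : H ⊗[k] H) = t
  induction t with
  | zero => simp
  | add a b ha hb => simp only [map_add, ha, hb]
  | tmul x y => simp

theorem counitRight_of_comp_eq {V : Type*} [AddCommGroup V] [Module k V] {i : V →ₗ[k] E}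
    {ℓ : V →ₗ[k] E ⊗[k] V} {e : V →ₗ[k] k} (hΔ : Δ.toLinearMap ∘ₗ i = lTensor E i ∘ₗ ℓ)
    (hε : ε.toLinearMap ∘ₗ i = e) {v : V} (hℓ : lTensor E e (ℓ v) = i v ⊗ₜ[k] (1 : k)) :
    counitRight ε Δ (i v) = i v := by
  have h1 := LinearMap.congr_fun hΔ v
  simp only [comp_apply, AlgHom.toLinearMap_apply] at h1
  rw [counitRight_apply, h1, ← LinearMap.lTensor_comp_apply, hε, hℓ]
  simp

end LegCoactions

/-! ### The bialgebra structure of the double. -/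

section DoubleCoalgebra

variable {k A H : Type*} [Field k] [Ring A] [HopfAlgebra k A] [Ring H] [HopfAlgebra k H]
  {Q : WeakQuasitriangularPair k A H}
  {B C D : Type*} [Ring B] [Algebra k B] [Coalgebra k B]
  [Ring C] [Algebra k C] [Coalgebra k C] [Ring D] [Algebra k D]
  {δB : LeftCoaction k A B} {δC : LeftCoaction k A C} {δD : LeftCoaction k A D}
  {ev : C ⊗[k] B →ₗ[k] k} {ρ : D →ₗ[k] D ⊗[k] C}
  (hB : IsBraidedBialgebra Q δB.coact) (hC : IsBraidedBialgebra Q δC.coact)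

namespace Drin

variable (ev)

/-- The coproduct of the braided Drinfeld double. -/
def comulHom : Drin Q δC.coact δB.coact ev →ₐ[k]
    Drin Q δC.coact δB.coact ev ⊗[k] Drin Q δC.coact δB.coact ev :=
  ((Drin.doubleMaps Q δB.coact δC.coact ev).comul hB hC).lift

/-- The counit of the braided Drinfeld double. -/
def counitHom : Drin Q δC.coact δB.coact ev →ₐ[k] k := (DoubleMaps.counit hB hC ev).lift

local notation "E" => Drin Q (LeftCoaction.coact δC) (LeftCoaction.coact δB) ev
local notation "iC" => Drin.inC Q (LeftCoaction.coact δC) (LeftCoaction.coact δB) ev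
local notation "iH" => Drin.inH Q (LeftCoaction.coact δC) (LeftCoaction.coact δB) ev
local notation "iB" => Drin.inB Q (LeftCoaction.coact δC) (LeftCoaction.coact δB) ev

theorem comulHom_comp_inC : (comulHom ev hB hC).toLinearMap ∘ₗ iC =
    lTensor E iC ∘ₗ rightLeg Q iH iC δC.coact Coalgebra.comul :=
  LinearMap.ext fun c => DoubleMaps.lift_inC _ c

theorem comulHom_comp_inB : (comulHom ev hB hC).toLinearMap ∘ₗ iB =
    lTensor E iB ∘ₗ leftLeg Q iH iB δB.coact :=
  LinearMap.ext fun c => DoubleMaps.lift_inB _ c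

theorem comulHom_comp_inH : (comulHom ev hB hC).toLinearMap ∘ₗ iH = legMap iH iH (cop k H) :=
  LinearMap.ext fun c => DoubleMaps.lift_inH _ c

theorem counitHom_comp_inC : (counitHom ev hB hC).toLinearMap ∘ₗ iC = Coalgebra.counit :=
  LinearMap.ext fun c => DoubleMaps.lift_inC _ c

theorem counitHom_comp_inB : (counitHom ev hB hC).toLinearMap ∘ₗ iB = Coalgebra.counit :=
  LinearMap.ext fun c => DoubleMaps.lift_inB _ c

theorem counitHom_comp_inH : (counitHom ev hB hC).toLinearMap ∘ₗ iH = Coalgebra.counit :=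
  LinearMap.ext fun c => DoubleMaps.lift_inH _ c

theorem coassoc_rightLeg (hD : IsBraidedRightComoduleAlgebra Q δC.coact δD.coact ρ) (d : D) :
    TensorProduct.assoc k E E D (rTensor D (comulHom ev hB hC).toLinearMap
      (rightLeg Q iH iC δD.coact ρ d)) =
    lTensor E (rightLeg Q iH iC δD.coact ρ) (rightLeg Q iH iC δD.coact ρ d) :=
  BraidedDouble.coassoc_rightLeg (Drin.doubleMaps Q δB.coact δC.coact ev).algH hD
    (comulHom_comp_inH ev hB hC) (comulHom_comp_inC ev hB hC) d

theorem coassoc_leftLeg (b : B) :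
    TensorProduct.assoc k E E B (rTensor B (comulHom ev hB hC).toLinearMap
      (leftLeg Q iH iB δB.coact b)) =
    lTensor E (leftLeg Q iH iB δB.coact) (leftLeg Q iH iB δB.coact b) :=
  BraidedDouble.coassoc_leftLeg (Drin.doubleMaps Q δB.coact δC.coact ev).algH hB
    (comulHom_comp_inH ev hB hC) (comulHom_comp_inB ev hB hC) b

theorem coassoc_cop (h : H) :
    TensorProduct.assoc k E E H (rTensor H (comulHom ev hB hC).toLinearMap
      (rTensor H iH (cop k H h))) =
    lTensor E (rTensor H iH ∘ₗ cop k H)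
      (rTensor H iH (cop k H h)) :=
  coassoc_rTensor_cop (comulHom_comp_inH ev hB hC) h

theorem counit_rightLeg (hD : IsBraidedRightComoduleAlgebra Q δC.coact δD.coact ρ) (d : D) :
    TensorProduct.lid k D (rTensor D (counitHom ev hB hC).toLinearMap
      (rightLeg Q iH iC δD.coact ρ d)) = d :=
  BraidedDouble.counit_rightLeg hD (counitHom_comp_inH ev hB hC) (counitHom_comp_inC ev hB hC) d

theorem counit_leftLeg (b : B) :
    TensorProduct.lid k B (rTensor B (counitHom ev hB hC).toLinearMap
      (leftLeg Q iH iB δB.coact b)) = b :=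
  BraidedDouble.counit_leftLeg (counitHom_comp_inH ev hB hC) (counitHom_comp_inB ev hB hC) b

theorem counit_cop (h : H) :
    TensorProduct.lid k H (rTensor H (counitHom ev hB hC).toLinearMap
      (rTensor H iH (cop k H h))) = h :=
  counit_rTensor_cop (counitHom_comp_inH ev hB hC) h

/-- The coalgebra structure of the braided Drinfeld double. -/
@[reducible] def coalgebra : Coalgebra k E where
  comul := (comulHom ev hB hC).toLinearMap
  counit := (counitHom ev hB hC).toLinearMap
  coassoc := by
    have hC' := hC.isBraidedRightComoduleAlgebra
    have : coassocLeft (comulHom ev hB hC) (comulHom ev hB hC) = coassocRight (comulHom ev hB hC) :=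
      Drin.hom_ext
        (fun c => coassocLeft_of_intertwine (comulHom_comp_inC ev hB hC)
          (coassoc_rightLeg ev hB hC hC' c))
        (fun h => coassocLeft_of_intertwine ((comulHom_comp_inH ev hB hC).trans
          (legMap_eq_lTensor iH iH)) (coassoc_cop ev hB hC h))
        (fun b => coassocLeft_of_intertwine (comulHom_comp_inB ev hB hC)
          (coassoc_leftLeg ev hB hC b))
    ext x : 1
    exact DFunLike.congr_fun this x
  rTensor_counit_comp_comul := by
    have hC' := hC.isBraidedRightComoduleAlgebra
    have : counitLeft (counitHom ev hB hC) (comulHom ev hB hC) = AlgHom.id k E :=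
      Drin.hom_ext
        (fun c => counitLeft_of_intertwine (comulHom_comp_inC ev hB hC)
          (counit_rightLeg ev hB hC hC' c))
        (fun h => counitLeft_of_intertwine ((comulHom_comp_inH ev hB hC).trans
          (legMap_eq_lTensor iH iH)) (counit_cop ev hB hC h))
        (fun b => counitLeft_of_intertwine (comulHom_comp_inB ev hB hC)
          (counit_leftLeg ev hB hC b))
    ext x : 1
    apply (TensorProduct.lid k E).injective
    refine (DFunLike.congr_fun this x).trans ?_
    simp
  lTensor_counit_comp_comul := by
    have hj := (Drin.doubleMaps Q δB.coact δC.coact ev).algH.map_one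
    have : counitRight (counitHom ev hB hC) (comulHom ev hB hC) = AlgHom.id k E :=
      Drin.hom_ext
        (fun c => counitRight_of_comp_eq (comulHom_comp_inC ev hB hC) (counitHom_comp_inC ev hB hC)
          (lTensor_counit_rightLeg hC hj iC c))
        (fun h => counitRight_of_comp_eq ((comulHom_comp_inH ev hB hC).trans
          (legMap_eq_lTensor iH iH)) (counitHom_comp_inH ev hB hC)
          ((lTensor_rTensor_apply _ _ _).trans (by
            rw [lTensor_counit_cop, rTensor_tmul])))
        (fun b => counitRight_of_comp_eq (comulHom_comp_inB ev hB hC) (counitHom_comp_inB ev hB hC)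
          (lTensor_counit_leftLeg hB hj iB b))
    ext x : 1
    apply (TensorProduct.rid k E).injective
    refine (DFunLike.congr_fun this x).trans ?_
    simp

theorem isDrinBialgebra :
    @IsDrinBialgebra k A H _ _ _ _ _ Q B C _ _ _ _ _ _ δC.coact δB.coact ev
      (coalgebra ev hB hC) :=
  letI := coalgebra ev hB hC
  { comul_mul := map_mul (comulHom ev hB hC)
    comul_one := map_one (comulHom ev hB hC)
    counit_mul := map_mul (counitHom ev hB hC)
    counit_one := map_one (counitHom ev hB hC)
    comul_H := LinearMap.congr_fun (comulHom_comp_inH ev hB hC)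
    comul_B := LinearMap.congr_fun (comulHom_comp_inB ev hB hC)
    comul_C := LinearMap.congr_fun (comulHom_comp_inC ev hB hC)
    counit_H := LinearMap.congr_fun (counitHom_comp_inH ev hB hC)
    counit_B := LinearMap.congr_fun (counitHom_comp_inB ev hB hC)
    counit_C := LinearMap.congr_fun (counitHom_comp_inC ev hB hC) }

end Drin

end DoubleCoalgebra

/-! ### Algebra maps and coactions on twisted products. -/

section AlgOfHoms

variable {k V W M N : Type*} [Field k] [AddCommGroup V] [Module k V] [AddCommGroup W] [Module k W]
  [Ring M] [Algebra k M] [Ring N] [Algebra k N]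

/-- The algebra map on `AlgOf h` given by a multiplicative map. -/
def IsAlgMap.toAlgHom {m : V ⊗[k] V →ₗ[k] V} {e : V} (h : IsAlgebraProduct m e) {f : V →ₗ[k] M}
    (hf : IsAlgMap m e f) : AlgOf h →ₐ[k] M :=
  AlgHom.ofLinearMap (f ∘ₗ (AlgOf.of h).symm.toLinearMap) hf.map_one
    fun x y => hf.map_mul ((AlgOf.of h).symm x) ((AlgOf.of h).symm y)

theorem IsAlgMap.toAlgHom_of {m : V ⊗[k] V →ₗ[k] V} {e : V} (h : IsAlgebraProduct m e)
    {f : V →ₗ[k] M} (hf : IsAlgMap m e f) (v : V) : hf.toAlgHom h (AlgOf.of h v) = f v := rfl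

theorem pr_lTensor_algHom {X Y : Type*} [Ring X] [Algebra k X] [Ring Y] [Algebra k Y]
    (φ : X →ₐ[k] Y) {Z Z' : Type*} [AddCommGroup Z] [Module k Z] [AddCommGroup Z'] [Module k Z']
    (i : Z →ₗ[k] X) (i' : Z' →ₗ[k] X) (ℓ : V →ₗ[k] M ⊗[k] Z) (ℓ' : W →ₗ[k] M ⊗[k] Z')
    (t : V ⊗[k] W) :
    pr (lTensor M (φ.toLinearMap ∘ₗ i) ∘ₗ ℓ)
        (lTensor M (φ.toLinearMap ∘ₗ i') ∘ₗ ℓ') t =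
      lTensor M φ.toLinearMap (pr (lTensor M i ∘ₗ ℓ)
        (lTensor M i' ∘ₗ ℓ') t) := by
  rw [LinearMap.lTensor_comp, LinearMap.lTensor_comp]
  exact (algHom_pr (Algebra.TensorProduct.map (AlgHom.id k M) φ) (lTensor M i ∘ₗ ℓ)
    (lTensor M i' ∘ₗ ℓ') t).symm

section Twist

variable {mV : V ⊗[k] V →ₗ[k] V} {eV : V} {mW : W ⊗[k] W →ₗ[k] W} {eW : W}
  {τ : W ⊗[k] V →ₗ[k] V ⊗[k] W}

/-- Every element is a sum of products of the two canonical images, so these generate the algebra.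
-/
theorem IsTwist.algHom_ext (hτ : IsTwist mV eV mW eW τ) (hV : IsAlgebraProduct mV eV)
    (hW : IsAlgebraProduct mW eW) (h : IsAlgebraProduct (twistMul mV mW τ) (eV ⊗ₜ[k] eW))
    {F G : AlgOf h →ₐ[k] N} (h₁ : ∀ v, F (twistLeft h v) = G (twistLeft h v))
    (h₂ : ∀ w, F (twistRight h w) = G (twistRight h w)) : F = G := by
  ext x
  have hx := hτ.pr_twistLeft_twistRight hV hW h ((AlgOf.of h).symm x)
  rw [LinearEquiv.apply_symm_apply] at hx
  have e₁ : F.toLinearMap ∘ₗ twistLeft h = G.toLinearMap ∘ₗ twistLeft h := LinearMap.ext h₁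
  have e₂ : F.toLinearMap ∘ₗ twistRight h = G.toLinearMap ∘ₗ twistRight h := LinearMap.ext h₂
  rw [← hx, algHom_pr, algHom_pr, e₁, e₂]

theorem IsAlgMap.toAlgHom_twistLeft (h : IsAlgebraProduct (twistMul mV mW τ) (eV ⊗ₜ[k] eW))
    {f : V →ₗ[k] M} {g : W →ₗ[k] M} (hf : IsAlgMap (twistMul mV mW τ) (eV ⊗ₜ[k] eW) (pr f g))
    (hg : g eW = 1) (v : V) : hf.toAlgHom h (twistLeft h v) = f v := by
  refine (IsAlgMap.toAlgHom_of h hf (v ⊗ₜ eW)).trans ?_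
  rw [pr_tmul, hg, mul_one]

theorem IsAlgMap.toAlgHom_twistRight (h : IsAlgebraProduct (twistMul mV mW τ) (eV ⊗ₜ[k] eW))
    {f : V →ₗ[k] M} {g : W →ₗ[k] M} (hf : IsAlgMap (twistMul mV mW τ) (eV ⊗ₜ[k] eW) (pr f g))
    (hg : f eV = 1) (w : W) : hf.toAlgHom h (twistRight h w) = g w := by
  refine (IsAlgMap.toAlgHom_of h hf (eV ⊗ₜ w)).trans ?_
  rw [pr_tmul, hg, one_mul]

end Twist

variable {m : V ⊗[k] V →ₗ[k] V} {e : V} (h : IsAlgebraProduct m e)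

/-- A coaction on the algebra `AlgOf h`, as a map on the underlying space. -/
def coactOf (δ : AlgOf h →ₐ[k] M ⊗[k] AlgOf h) : V →ₗ[k] M ⊗[k] V :=
  lTensor M (AlgOf.of h).symm.toLinearMap ∘ₗ δ.toLinearMap ∘ₗ (AlgOf.of h).toLinearMap

theorem coactOf_comp (δ : AlgOf h →ₐ[k] M ⊗[k] AlgOf h) :
    coactOf h δ ∘ₗ (AlgOf.of h).symm.toLinearMap =
      lTensor M (AlgOf.of h).symm.toLinearMap ∘ₗ δ.toLinearMap := rfl

theorem lTensor_of_tensorMul (s t : M ⊗[k] V) :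
    lTensor M (AlgOf.of h).toLinearMap
      (tensorMul (mul' k M) m (s ⊗ₜ t)) =
    lTensor M (AlgOf.of h).toLinearMap s *
      lTensor M (AlgOf.of h).toLinearMap t := by
  induction s with
  | zero => simp
  | add a b ha hb => simp only [map_add, add_tmul, add_mul, ha, hb]
  | tmul x v =>
  induction t with
  | zero => simp
  | add a b ha hb => simp only [map_add, tmul_add, mul_add, ha, hb]
  | tmul y w =>
    rw [tensorMul, twistMul_tmul]
    simp [AlgOf.of_mul]

theorem lTensor_of_symm_apply (t : M ⊗[k] AlgOf h) :
    lTensor M (AlgOf.of h).toLinearMap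
      (lTensor M (AlgOf.of h).symm.toLinearMap t) = t := by
  rw [← LinearMap.lTensor_comp_apply]
  simp

theorem isCoactionMultiplicative_coactOf (δ : AlgOf h →ₐ[k] M ⊗[k] AlgOf h) :
    IsCoactionMultiplicative m e (coactOf h δ) where
  map_mul x y := by
    apply (LinearEquiv.lTensor M (AlgOf.of h)).injective
    refine Eq.trans ?_ (lTensor_of_tensorMul h _ _).symm
    simp only [coactOf, comp_apply, lTensor_of_symm_apply]
    refine (lTensor_of_symm_apply h _).trans ?_
    exact map_mul δ (AlgOf.of h x) (AlgOf.of h y)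
  map_one := by
    change lTensor M (AlgOf.of h).symm.toLinearMap (δ 1) = _
    rw [map_one, Algebra.TensorProduct.one_def, lTensor_tmul]
    rfl

/-- The coaction on `V` obtained from a coaction on `AlgOf h` which is an algebra map. -/
def leftCoactionOf [Coalgebra k M] {Δ : M →ₐ[k] M ⊗[k] M} {ε : M →ₐ[k] k}
    (hΔ : Coalgebra.comul = Δ.toLinearMap) (hε : Coalgebra.counit = ε.toLinearMap)
    (δ : AlgOf h →ₐ[k] M ⊗[k] AlgOf h) (h₁ : coassocLeft Δ δ = coassocRight δ)
    (h₂ : counitLeft ε δ = AlgHom.id k _) : LeftCoaction k M V where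
  coact := coactOf h δ
  coassoc := by
    ext v : 1
    rw [hΔ]
    exact coassoc_of_intertwine (coactOf_comp h δ) (v := AlgOf.of h v)
      (DFunLike.congr_fun h₁ (AlgOf.of h v))
  counit := by
    ext v : 1
    rw [hε]
    exact counit_of_intertwine (coactOf_comp h δ) (v := AlgOf.of h v)
      (DFunLike.congr_fun h₂ (AlgOf.of h v))

end AlgOfHoms

/-! ### Multiplicativity of the coactions on the crossed products. -/

section CrossedCoactions

variable {k A H : Type*} [Field k] [Ring A] [HopfAlgebra k A] [Ring H] [HopfAlgebra k H]
  {Q : WeakQuasitriangularPair k A H}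
  {B C D E X : Type*} [Ring B] [Algebra k B] [Coalgebra k B]
  [Ring C] [Algebra k C] [Coalgebra k C] [Ring D] [Algebra k D] [Ring E] [Algebra k E]
  [Ring X] [Algebra k X]
  {δB : LeftCoaction k A B} {δC : LeftCoaction k A C} {δD : LeftCoaction k A D}
  {ev : C ⊗[k] B →ₗ[k] k} {ρ : D →ₗ[k] D ⊗[k] C} {S : B →ₗ[k] B}
  {jC : C →ₗ[k] E} {jH : H →ₗ[k] E} {jB : B →ₗ[k] E}
  {iD : D →ₗ[k] X} {iB : B →ₗ[k] X} {iH : H →ₗ[k] X}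

/-- The exchange of D with B is inverted to one along T, carried over to the legs, and inverted
back; the universal property of the twisted product then applies. -/
theorem DoubleMaps.isAlgMap_crossCoact (h : DoubleMaps Q δC.coact δB.coact ev jC jH jB)
    (hB : IsBraidedBialgebra Q δB.coact) (hev : IsBraidedPairing δC.coact δB.coact ev)
    (hD : IsBraidedRightComoduleAlgebra Q δC.coact δD.coact ρ) (hS : IsBraidedAntipode δB.coact S)
    (hiD : IsAlgMap (mul' k D) 1 iD) (hiB : IsAlgMap (mul' k B) 1 iB)
    (hr : TwistRel iD iB
      (crossTwist Q δB.coact δD.coact (inducedAction Q δB.coact S ev δD.coact ρ))) :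
    IsAlgMap (crossMul Q δB.coact δD.coact (inducedAction Q δB.coact S ev δD.coact ρ)) (1 ⊗ₜ 1)
      (pr (lTensor E iD ∘ₗ rightLeg Q jH jC δD.coact ρ)
        (lTensor E iB ∘ₗ leftLeg Q jH jB δB.coact)) :=
  ((h.twistRel_leftLeg_rightLeg hB hD (hr.inv (crossTwist_invTwist hB hev hD hS))).inv
    (invTwist_crossTwist hB hev hD hS)).isAlgMap_pr (h.isAlgMap_rightLeg hD hiD)
      (h.isAlgMap_leftLeg hB hiB)

theorem DoubleMaps.isAlgMap_crossSmashCoact (h : DoubleMaps Q δC.coact δB.coact ev jC jH jB)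
    (hB : IsBraidedBialgebra Q δB.coact) (hev : IsBraidedPairing δC.coact δB.coact ev)
    (hD : IsBraidedRightComoduleAlgebra Q δC.coact δD.coact ρ) (hS : IsBraidedAntipode δB.coact S)
    (hiD : IsAlgMap (mul' k D) 1 iD) (hiB : IsAlgMap (mul' k B) 1 iB)
    (hiH : IsAlgMap (mul' k H) 1 iH)
    (hr : TwistRel iD iB
      (crossTwist Q δB.coact δD.coact (inducedAction Q δB.coact S ev δD.coact ρ)))
    (hrD : TwistRel iD iH (smashTwist Q.pair δD.coact))
    (hrB : TwistRel iB iH (smashTwist Q.pair δB.coact)) :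
    IsAlgMap (crossSmashMul Q δB.coact δD.coact (inducedAction Q δB.coact S ev δD.coact ρ))
      ((1 ⊗ₜ 1) ⊗ₜ 1)
      (pr (pr (lTensor E iD ∘ₗ rightLeg Q jH jC δD.coact ρ)
        (lTensor E iB ∘ₗ leftLeg Q jH jB δB.coact)) (legMap jH iH (cop k H))) := by
  refine TwistRel.isAlgMap_pr ?_ (h.isAlgMap_crossCoact hB hev hD hS hiD hiB hr)
    (h.isAlgMap_legMap_cop hiH)
  rw [smashTwist_eq_cbr, Q.pairing.act_tensorCoact]
  exact (h.twistRel_rightLeg hD hrD).smash_pr (h.twistRel_leftLeg hB hrB)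

theorem isColinear_mk_one {V W : Type*} [AddCommGroup V] [Module k V] [AddCommGroup W] [Module k W]
    (δV : V →ₗ[k] A ⊗[k] V) {δW : W →ₗ[k] A ⊗[k] W} {w : W} (hw : δW w = 1 ⊗ₜ w) :
    IsColinear δV (tensorCoact δV δW) ((TensorProduct.mk k V W).flip w) := by
  ext v
  simp only [comp_apply, LinearMap.flip_apply, TensorProduct.mk_apply]
  rw [tensorCoact_tmul, hw]
  generalize δV v = t
  induction t with
  | zero => simp
  | add a b ha hb => simp only [map_add, add_tmul, ha, hb]
  | tmul x v => simp

theorem isColinear_one_mk {V W : Type*} [AddCommGroup V] [Module k V] [AddCommGroup W] [Module k W]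
    {δV : V →ₗ[k] A ⊗[k] V} (δW : W →ₗ[k] A ⊗[k] W) {v : V} (hv : δV v = 1 ⊗ₜ v) :
    IsColinear δW (tensorCoact δV δW) (TensorProduct.mk k V W v) := by
  ext w
  simp only [comp_apply, TensorProduct.mk_apply]
  rw [tensorCoact_tmul, hv]
  generalize δW w = t
  induction t with
  | zero => simp
  | add a b ha hb => simp only [map_add, tmul_add, ha, hb]
  | tmul x v => simp

end CrossedCoactions

/-! ### The coactions of the double on D ⋊ B and D ⋊ B ⋊ H. -/

section Main

variable {k A H : Type*} [Field k] [Ring A] [HopfAlgebra k A] [Ring H] [HopfAlgebra k H]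
  {Q : WeakQuasitriangularPair k A H}
  {B C D : Type*} [Ring B] [Algebra k B] [Coalgebra k B]
  [Ring C] [Algebra k C] [Coalgebra k C] [Ring D] [Algebra k D]
  {δB : LeftCoaction k A B} {δC : LeftCoaction k A C} {δD : LeftCoaction k A D}
  {ev : C ⊗[k] B →ₗ[k] k} {ρ : D →ₗ[k] D ⊗[k] C} {S : B →ₗ[k] B}
  (hB : IsBraidedBialgebra Q δB.coact) (hev : IsBraidedPairing δC.coact δB.coact ev)
  (hD : IsBraidedRightComoduleAlgebra Q δC.coact δD.coact ρ) (hS : IsBraidedAntipode δB.coact S)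

local notation "E" => Drin Q (LeftCoaction.coact δC) (LeftCoaction.coact δB) ev
local notation "DB" => AlgOf (isAlgebraProduct_crossMul hB hev hD hS)
local notation "DBH" => AlgOf (isAlgebraProduct_crossSmashMul hB hev hD hS)

/-- The embedding of `D ⋊ B` into `D ⋊ B ⋊ H`, as an algebra map. -/
def inclDBHom : DB →ₐ[k] DBH :=
  IsAlgMap.toAlgHom _ ((isTwist_crossSmash hB hev hD hS).isAlgMap_twistLeft
    (isAlgebraProduct_mul' k H) (isAlgebraProduct_crossSmashMul hB hev hD hS))

/-- The embedding of `D` into the algebra `D ⋊ B`. -/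
def ofD : D →ₗ[k] DB := twistLeft (isAlgebraProduct_crossMul hB hev hD hS)

/-- The embedding of `B` into the algebra `D ⋊ B`. -/
def ofB : B →ₗ[k] DB := twistRight (isAlgebraProduct_crossMul hB hev hD hS)

/-- The embedding of `H` into the algebra `D ⋊ B ⋊ H`. -/
def ofH : H →ₗ[k] DBH := twistRight (isAlgebraProduct_crossSmashMul hB hev hD hS)

theorem isAlgMap_ofD : IsAlgMap (mul' k D) 1 (ofD hB hev hD hS) :=
  (isTwist_crossTwist hB hev hD hS).isAlgMap_twistLeft (isAlgebraProduct_mul' k B) _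

theorem isAlgMap_ofB : IsAlgMap (mul' k B) 1 (ofB hB hev hD hS) :=
  (isTwist_crossTwist hB hev hD hS).isAlgMap_twistRight (isAlgebraProduct_mul' k D) _

theorem isAlgMap_ofH : IsAlgMap (mul' k H) 1 (ofH hB hev hD hS) :=
  (isTwist_crossSmash hB hev hD hS).isAlgMap_twistRight
    (isAlgebraProduct_crossMul hB hev hD hS) _

theorem twistRel_ofD_ofB : TwistRel (ofD hB hev hD hS) (ofB hB hev hD hS)
    (crossTwist Q δB.coact δD.coact (inducedAction Q δB.coact S ev δD.coact ρ)) :=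
  (isTwist_crossTwist hB hev hD hS).twistRel (isAlgebraProduct_mul' k D)
    (isAlgebraProduct_mul' k B) _

theorem twistRel_twistLeft_ofH :
    TwistRel (twistLeft (isAlgebraProduct_crossSmashMul hB hev hD hS)) (ofH hB hev hD hS)
      (smashTwist Q.pair (tensorCoact δD.coact δB.coact)) :=
  (isTwist_crossSmash hB hev hD hS).twistRel (isAlgebraProduct_crossMul hB hev hD hS)
    (isAlgebraProduct_mul' k H) _

/-- The inclusion of D in D ⊗ B is colinear because the unit of B is coinvariant, so the exchange
rule of H with D ⋊ B restricts to D. -/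
theorem twistRel_ofD_ofH :
    TwistRel ((inclDBHom hB hev hD hS).toLinearMap ∘ₗ ofD hB hev hD hS) (ofH hB hev hD hS)
      (smashTwist Q.pair δD.coact) :=
  TwistRel.comp_hLinear (twistRel_twistLeft_ofH hB hev hD hS)
    ((isColinear_mk_one δD.coact hB.algebra.one_coinvariant).isHLinear Q.pair)

theorem twistRel_ofB_ofH :
    TwistRel ((inclDBHom hB hev hD hS).toLinearMap ∘ₗ ofB hB hev hD hS) (ofH hB hev hD hS)
      (smashTwist Q.pair δB.coact) :=
  TwistRel.comp_hLinear (twistRel_twistLeft_ofH hB hev hD hS)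
    ((isColinear_one_mk δB.coact hD.algebra.one_coinvariant).isHLinear Q.pair)

theorem isAlgMap_crossCoactHom : IsAlgMap
    (crossMul Q δB.coact δD.coact (inducedAction Q δB.coact S ev δD.coact ρ)) (1 ⊗ₜ 1)
      (pr (M := E ⊗[k] DB) (lTensor E (ofD hB hev hD hS) ∘ₗ
          rightLeg Q (Drin.inH Q δC.coact δB.coact ev)
          (Drin.inC Q δC.coact δB.coact ev) δD.coact ρ)
        (lTensor E (ofB hB hev hD hS) ∘ₗ leftLeg Q (Drin.inH Q δC.coact δB.coact ev)
          (Drin.inB Q δC.coact δB.coact ev) δB.coact)) :=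
  (Drin.doubleMaps Q δB.coact δC.coact ev).isAlgMap_crossCoact hB hev hD hS
    (isAlgMap_ofD hB hev hD hS) (isAlgMap_ofB hB hev hD hS) (twistRel_ofD_ofB hB hev hD hS)

/-- The coaction of the braided Drinfeld double on `D ⋊ B`. -/
def crossCoactHom : DB →ₐ[k] E ⊗[k] DB :=
  IsAlgMap.toAlgHom _ (isAlgMap_crossCoactHom hB hev hD hS)

theorem isAlgMap_crossSmashCoactHom : IsAlgMap
    (crossSmashMul Q δB.coact δD.coact (inducedAction Q δB.coact S ev δD.coact ρ))
      ((1 ⊗ₜ 1) ⊗ₜ 1)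
      (pr (pr (lTensor E ((inclDBHom hB hev hD hS).toLinearMap ∘ₗ ofD hB hev hD hS) ∘ₗ
          rightLeg Q (Drin.inH Q δC.coact δB.coact ev)
          (Drin.inC Q δC.coact δB.coact ev) δD.coact ρ)
        (lTensor E ((inclDBHom hB hev hD hS).toLinearMap ∘ₗ ofB hB hev hD hS) ∘ₗ
          leftLeg Q (Drin.inH Q δC.coact δB.coact ev) (Drin.inB Q δC.coact δB.coact ev) δB.coact))
        (legMap (Drin.inH Q δC.coact δB.coact ev) (ofH hB hev hD hS) (cop k H))) :=
  (Drin.doubleMaps Q δB.coact δC.coact ev).isAlgMap_crossSmashCoact hB hev hD hS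
    ((isAlgMap_ofD hB hev hD hS).algHom_comp _) ((isAlgMap_ofB hB hev hD hS).algHom_comp _)
    (isAlgMap_ofH hB hev hD hS) ((twistRel_ofD_ofB hB hev hD hS).algHom_comp _)
    (twistRel_ofD_ofH hB hev hD hS) (twistRel_ofB_ofH hB hev hD hS)

/-- The coaction of the braided Drinfeld double on `D ⋊ B ⋊ H`. -/
def crossSmashCoactHom : DBH →ₐ[k] E ⊗[k] DBH :=
  IsAlgMap.toAlgHom _ (isAlgMap_crossSmashCoactHom hB hev hD hS)

theorem crossCoactHom_comp_ofD : (crossCoactHom hB hev hD hS).toLinearMap ∘ₗ ofD hB hev hD hS =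
    lTensor E (ofD hB hev hD hS) ∘ₗ rightLeg Q (Drin.inH Q δC.coact δB.coact ev)
      (Drin.inC Q δC.coact δB.coact ev) δD.coact ρ :=
  LinearMap.ext fun d => IsAlgMap.toAlgHom_twistLeft _ (isAlgMap_crossCoactHom hB hev hD hS)
    ((Drin.doubleMaps Q δB.coact δC.coact ev).isAlgMap_leftLeg hB
      (isAlgMap_ofB hB hev hD hS)).map_one d

theorem crossCoactHom_comp_ofB : (crossCoactHom hB hev hD hS).toLinearMap ∘ₗ ofB hB hev hD hS =
    lTensor E (ofB hB hev hD hS) ∘ₗ leftLeg Q (Drin.inH Q δC.coact δB.coact ev)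
      (Drin.inB Q δC.coact δB.coact ev) δB.coact :=
  LinearMap.ext fun d => IsAlgMap.toAlgHom_twistRight _ (isAlgMap_crossCoactHom hB hev hD hS)
    ((Drin.doubleMaps Q δB.coact δC.coact ev).isAlgMap_rightLeg hD
      (isAlgMap_ofD hB hev hD hS)).map_one d

/-- On D ⋊ B the H-factor of the coaction is its value at 1, which is trivial, so the larger
coaction restricts to the smaller one. This also gives its values on D and B and makes D ⋊ B a
subcomodule. -/
theorem crossSmashCoactHom_inclDBHom (x : D ⊗[k] B) :
    crossSmashCoactHom hB hev hD hS (inclDBHom hB hev hD hS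
      (AlgOf.of (isAlgebraProduct_crossMul hB hev hD hS) x)) =
    lTensor E (inclDBHom hB hev hD hS).toLinearMap (crossCoactHom hB hev hD hS
      (AlgOf.of (isAlgebraProduct_crossMul hB hev hD hS) x)) := by
  refine (IsAlgMap.toAlgHom_twistLeft _ (isAlgMap_crossSmashCoactHom hB hev hD hS)
    ((Drin.doubleMaps Q δB.coact δC.coact ev).isAlgMap_legMap_cop
      (isAlgMap_ofH hB hev hD hS)).map_one x).trans ?_
  exact pr_lTensor_algHom (inclDBHom hB hev hD hS) (ofD hB hev hD hS) (ofB hB hev hD hS) _ _ x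

theorem crossSmashCoactHom_comp_ofD :
    (crossSmashCoactHom hB hev hD hS).toLinearMap ∘ₗ
      ((inclDBHom hB hev hD hS).toLinearMap ∘ₗ ofD hB hev hD hS) =
    lTensor E ((inclDBHom hB hev hD hS).toLinearMap ∘ₗ ofD hB hev hD hS) ∘ₗ
      rightLeg Q (Drin.inH Q δC.coact δB.coact ev)
      (Drin.inC Q δC.coact δB.coact ev) δD.coact ρ := by
  ext d
  refine (crossSmashCoactHom_inclDBHom hB hev hD hS (d ⊗ₜ 1)).trans ?_
  refine (congrArg (lTensor E (inclDBHom hB hev hD hS).toLinearMap)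
    (LinearMap.congr_fun (crossCoactHom_comp_ofD hB hev hD hS) d)).trans ?_
  rw [LinearMap.lTensor_comp]
  rfl

theorem crossSmashCoactHom_comp_ofB :
    (crossSmashCoactHom hB hev hD hS).toLinearMap ∘ₗ
      ((inclDBHom hB hev hD hS).toLinearMap ∘ₗ ofB hB hev hD hS) =
    lTensor E ((inclDBHom hB hev hD hS).toLinearMap ∘ₗ ofB hB hev hD hS) ∘ₗ
      leftLeg Q (Drin.inH Q δC.coact δB.coact ev)
      (Drin.inB Q δC.coact δB.coact ev) δB.coact := by
  ext d
  refine (crossSmashCoactHom_inclDBHom hB hev hD hS (1 ⊗ₜ d)).trans ?_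
  refine (congrArg (lTensor E (inclDBHom hB hev hD hS).toLinearMap)
    (LinearMap.congr_fun (crossCoactHom_comp_ofB hB hev hD hS) d)).trans ?_
  rw [LinearMap.lTensor_comp]
  rfl

theorem crossSmashCoactHom_comp_ofH :
    (crossSmashCoactHom hB hev hD hS).toLinearMap ∘ₗ ofH hB hev hD hS =
    legMap (Drin.inH Q δC.coact δB.coact ev) (ofH hB hev hD hS) (cop k H) :=
  LinearMap.ext fun h => IsAlgMap.toAlgHom_twistRight _
    (isAlgMap_crossSmashCoactHom hB hev hD hS)
    (((Drin.doubleMaps Q δB.coact δC.coact ev).isAlgMap_crossCoact hB hev hD hS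
    ((isAlgMap_ofD hB hev hD hS).algHom_comp _) ((isAlgMap_ofB hB hev hD hS).algHom_comp _)
    ((twistRel_ofD_ofB hB hev hD hS).algHom_comp _)).map_one) h

variable {N : Type*} [Ring N] [Algebra k N]

theorem crossHom_ext {F G : DB →ₐ[k] N}
    (h₁ : ∀ d, F (ofD hB hev hD hS d) = G (ofD hB hev hD hS d))
    (h₂ : ∀ b, F (ofB hB hev hD hS b) = G (ofB hB hev hD hS b)) : F = G :=
  (isTwist_crossTwist hB hev hD hS).algHom_ext (isAlgebraProduct_mul' k D)
    (isAlgebraProduct_mul' k B) _ h₁ h₂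

theorem crossSmashHom_ext {F G : DBH →ₐ[k] N}
    (h₁ : ∀ d, F (inclDBHom hB hev hD hS (ofD hB hev hD hS d)) =
      G (inclDBHom hB hev hD hS (ofD hB hev hD hS d)))
    (h₂ : ∀ b, F (inclDBHom hB hev hD hS (ofB hB hev hD hS b)) =
      G (inclDBHom hB hev hD hS (ofB hB hev hD hS b)))
    (h₃ : ∀ h, F (ofH hB hev hD hS h) = G (ofH hB hev hD hS h)) : F = G := by
  have e : F.comp (inclDBHom hB hev hD hS) = G.comp (inclDBHom hB hev hD hS) :=
    crossHom_ext hB hev hD hS h₁ h₂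
  exact (isTwist_crossSmash hB hev hD hS).algHom_ext (isAlgebraProduct_crossMul hB hev hD hS)
    (isAlgebraProduct_mul' k H) _ (fun x => DFunLike.congr_fun e
      (AlgOf.of (isAlgebraProduct_crossMul hB hev hD hS) x)) h₃

variable (hC : IsBraidedBialgebra Q δC.coact)

theorem coassoc_crossCoactHom :
    coassocLeft (Drin.comulHom ev hB hC) (crossCoactHom hB hev hD hS) =
      coassocRight (crossCoactHom hB hev hD hS) :=
  crossHom_ext hB hev hD hS
    (fun d => coassocLeft_of_intertwine (crossCoactHom_comp_ofD hB hev hD hS)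
      (Drin.coassoc_rightLeg ev hB hC hD d))
    (fun b => coassocLeft_of_intertwine (crossCoactHom_comp_ofB hB hev hD hS)
      (Drin.coassoc_leftLeg ev hB hC b))

theorem counit_crossCoactHom :
    counitLeft (Drin.counitHom ev hB hC) (crossCoactHom hB hev hD hS) = AlgHom.id k _ :=
  crossHom_ext hB hev hD hS
    (fun d => counitLeft_of_intertwine (crossCoactHom_comp_ofD hB hev hD hS)
      (Drin.counit_rightLeg ev hB hC hD d))
    (fun b => counitLeft_of_intertwine (crossCoactHom_comp_ofB hB hev hD hS)
      (Drin.counit_leftLeg ev hB hC b))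

theorem coassoc_crossSmashCoactHom :
    coassocLeft (Drin.comulHom ev hB hC) (crossSmashCoactHom hB hev hD hS) =
      coassocRight (crossSmashCoactHom hB hev hD hS) :=
  crossSmashHom_ext hB hev hD hS
    (fun d => coassocLeft_of_intertwine (crossSmashCoactHom_comp_ofD hB hev hD hS)
      (Drin.coassoc_rightLeg ev hB hC hD d))
    (fun b => coassocLeft_of_intertwine (crossSmashCoactHom_comp_ofB hB hev hD hS)
      (Drin.coassoc_leftLeg ev hB hC b))
    (fun h => coassocLeft_of_intertwine ((crossSmashCoactHom_comp_ofH hB hev hD hS).trans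
      (legMap_eq_lTensor _ _)) (Drin.coassoc_cop ev hB hC h))

theorem counit_crossSmashCoactHom :
    counitLeft (Drin.counitHom ev hB hC) (crossSmashCoactHom hB hev hD hS) = AlgHom.id k _ :=
  crossSmashHom_ext hB hev hD hS
    (fun d => counitLeft_of_intertwine (crossSmashCoactHom_comp_ofD hB hev hD hS)
      (Drin.counit_rightLeg ev hB hC hD d))
    (fun b => counitLeft_of_intertwine (crossSmashCoactHom_comp_ofB hB hev hD hS)
      (Drin.counit_leftLeg ev hB hC b))
    (fun h => counitLeft_of_intertwine ((crossSmashCoactHom_comp_ofH hB hev hD hS).trans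
      (legMap_eq_lTensor _ _)) (Drin.counit_cop ev hB hC h))

end Main

/-! ### Coactions on the underlying vector spaces. -/

section CoactOf

variable {k V W M Z : Type*} [Field k] [AddCommGroup V] [Module k V] [AddCommGroup W] [Module k W]
  [Ring M] [Algebra k M] [AddCommGroup Z] [Module k Z]
  {m : V ⊗[k] V →ₗ[k] V} {e : V} (h : IsAlgebraProduct m e)
  {m' : W ⊗[k] W →ₗ[k] W} {e' : W} (h' : IsAlgebraProduct m' e')

theorem coactOf_apply_of_comp_eq {δ : AlgOf h →ₐ[k] M ⊗[k] AlgOf h} {j : Z →ₗ[k] V}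
    {ℓ : Z →ₗ[k] M ⊗[k] Z}
    (hj : δ.toLinearMap ∘ₗ ((AlgOf.of h).toLinearMap ∘ₗ j) =
      lTensor M ((AlgOf.of h).toLinearMap ∘ₗ j) ∘ₗ ℓ) (z : Z) :
    coactOf h δ (j z) = lTensor M j (ℓ z) := by
  refine (congrArg (lTensor M (AlgOf.of h).symm.toLinearMap)
    (LinearMap.congr_fun hj z)).trans ?_
  rw [comp_apply, ← LinearMap.lTensor_comp_apply]
  rfl

theorem coactOf_comp_of_intertwine {δ : AlgOf h →ₐ[k] M ⊗[k] AlgOf h}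
    {δ' : AlgOf h' →ₐ[k] M ⊗[k] AlgOf h'} {j : W →ₗ[k] V} {φ : AlgOf h' →ₗ[k] AlgOf h}
    (hφ : φ ∘ₗ (AlgOf.of h').toLinearMap = (AlgOf.of h).toLinearMap ∘ₗ j)
    (hj : ∀ w, δ (φ (AlgOf.of h' w)) = lTensor M φ (δ' (AlgOf.of h' w))) :
    coactOf h δ ∘ₗ j = lTensor M j ∘ₗ coactOf h' δ' := by
  have hφ' : (AlgOf.of h).symm.toLinearMap ∘ₗ φ = j ∘ₗ (AlgOf.of h').symm.toLinearMap := hφ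
  ext w : 1
  have e₁ : AlgOf.of h (j w) = φ (AlgOf.of h' w) := (LinearMap.congr_fun hφ w).symm
  simp only [coactOf, comp_apply, LinearEquiv.coe_coe, AlgHom.toLinearMap_apply]
  rw [e₁, hj, ← LinearMap.lTensor_comp_apply, hφ', LinearMap.lTensor_comp_apply]

end CoactOf

end BraidedDouble

end

open BraidedDouble in
theorem corollary3p20
    {k A H B C D : Type*} [Field k]
    [Ring A] [HopfAlgebra k A] [Ring H] [HopfAlgebra k H]
    (Q : WeakQuasitriangularPair k A H)
    [Ring B] [Algebra k B] [Coalgebra k B] (δB : LeftCoaction k A B)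
    (hB : IsBraidedBialgebra Q δB.coact)
    (S : B →ₗ[k] B) (hS : IsBraidedAntipode δB.coact S)
    [Ring C] [Algebra k C] [Coalgebra k C] (δC : LeftCoaction k A C)
    (hC : IsBraidedBialgebra Q δC.coact)
    (ev : C ⊗[k] B →ₗ[k] k) (hev : IsBraidedPairing δC.coact δB.coact ev)
    [Ring D] [Algebra k D] (δD : LeftCoaction k A D)
    (ρ : D →ₗ[k] D ⊗[k] C)
    (hD : IsBraidedRightComoduleAlgebra Q δC.coact δD.coact ρ)
    (α : B ⊗[k] D →ₗ[k] D) (hα : α = inducedAction Q δB.coact S ev δD.coact ρ) :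
    IsBraidedModuleAlgebra Q δB.coact δD.coact α ∧
    IsAlgebraProduct (crossMul Q δB.coact δD.coact α) (1 ⊗ₜ 1) ∧
    IsAlgebraProduct (crossSmashMul Q δB.coact δD.coact α) ((1 ⊗ₜ 1) ⊗ₜ 1) ∧
    ∃ _ : Coalgebra k (Drin Q δC.coact δB.coact ev),
      IsDrinBialgebra Q δC.coact δB.coact ev ∧
      ∃ δ : LeftCoaction k (Drin Q δC.coact δB.coact ev) ((D ⊗[k] B) ⊗[k] H),
        IsCoactionMultiplicative (crossSmashMul Q δB.coact δD.coact α) ((1 ⊗ₜ 1) ⊗ₜ 1) δ.coact ∧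
        (∀ d : D, δ.coact (inclD k D B H d) =
          LinearMap.lTensor _ (inclD k D B H)
            (rightLeg Q (Drin.inH Q δC.coact δB.coact ev) (Drin.inC Q δC.coact δB.coact ev)
              δD.coact ρ d)) ∧
        (∀ b : B, δ.coact (inclB k D B H b) =
          LinearMap.lTensor _ (inclB k D B H)
            (leftLeg Q (Drin.inH Q δC.coact δB.coact ev) (Drin.inB Q δC.coact δB.coact ev)
              δB.coact b)) ∧
        (∀ h : H, δ.coact (inclH k D B H h) =
          TensorProduct.map (Drin.inH Q δC.coact δB.coact ev) (inclH k D B H)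
            (TensorProduct.comm k H H (Coalgebra.comul h))) ∧
        ∃ δ' : LeftCoaction k (Drin Q δC.coact δB.coact ev) (D ⊗[k] B),
          IsCoactionMultiplicative (crossMul Q δB.coact δD.coact α) (1 ⊗ₜ 1) δ'.coact ∧
          (∀ x y : D ⊗[k] B,
            inclDB k D B H (crossMul Q δB.coact δD.coact α (x ⊗ₜ y)) =
              crossSmashMul Q δB.coact δD.coact α (inclDB k D B H x ⊗ₜ inclDB k D B H y)) ∧
          δ.coact ∘ₗ inclDB k D B H = LinearMap.lTensor _ (inclDB k D B H) ∘ₗ δ'.coact := by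
  subst hα
  have hDB := isAlgebraProduct_crossMul hB hev hD hS
  have hDBH := isAlgebraProduct_crossSmashMul hB hev hD hS
  -- With this instance the coproduct and counit are definitionally the linear maps of
  -- `Drin.comulHom` and `Drin.counitHom`, which is what the `rfl` arguments below rely on.
  let _ := Drin.coalgebra ev hB hC
  refine ⟨isBraidedModuleAlgebra_inducedAction hB hev hD hS, hDB, hDBH, Drin.coalgebra ev hB hC,
    Drin.isDrinBialgebra ev hB hC,
    leftCoactionOf hDBH rfl rfl (crossSmashCoactHom hB hev hD hS)
      (coassoc_crossSmashCoactHom hB hev hD hS hC) (counit_crossSmashCoactHom hB hev hD hS hC),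
    isCoactionMultiplicative_coactOf hDBH _,
    coactOf_apply_of_comp_eq hDBH (crossSmashCoactHom_comp_ofD hB hev hD hS),
    coactOf_apply_of_comp_eq hDBH (crossSmashCoactHom_comp_ofB hB hev hD hS), fun h => ?_,
    leftCoactionOf hDB rfl rfl (crossCoactHom hB hev hD hS)
      (coassoc_crossCoactHom hB hev hD hS hC) (counit_crossCoactHom hB hev hD hS hC),
    isCoactionMultiplicative_coactOf hDB _,
    fun x y => map_mul (inclDBHom hB hev hD hS) (AlgOf.of hDB x) (AlgOf.of hDB y),
    coactOf_comp_of_intertwine hDBH hDB (φ := (inclDBHom hB hev hD hS).toLinearMap) rfl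
      (crossSmashCoactHom_inclDBHom hB hev hD hS)⟩
  -- On H the leg is the opposite coproduct with its first factor sent to the double; `cop` unfolds
  -- to the flipped coproduct in the goal.
  exact (coactOf_apply_of_comp_eq hDBH (j := inclH k D B H)
    ((crossSmashCoactHom_comp_ofH hB hev hD hS).trans (legMap_eq_lTensor _ _)) h).trans
      (LinearMap.congr_fun (LinearMap.lTensor_comp_rTensor _ _ _) (cop k H h))
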